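/- For all natural numbers $n$ and $\lambda$ there is a natural number $r$ such that the complete graph $K_r$ has the following property. For every topological embedding of (the geometric realization of) $K_r$ in $\mathbb{R}^3$, the image contains an oriented link with $n$ components $Q_1,\dots,Q_n$ (pairwise disjoint oriented simple closed curves) such that for all $i\neq j$ the linking number satisfies $\mathrm{lk}(Q_i,Q_j)\neq 0$ and $|\mathrm{lk}(Q_i,Q_j)|\geq\lambda$. In other words, the linking pattern of this link (the graph with vertices $v_1,\dots,v_n$ in which $v_i$ and $v_j$, $i\ne j$, are joined by an edge exactly when $\mathrm{lk}(Q_i,Q_j)\neq 0$) is the complete graph $K_n$, and every edge $\{v_i,v_j\}$ has weight $|\mathrm{lk}(Q_i,Q_j)|\geq\lambda$. -/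

import Mathlib

open Set Filter Topology

/-- Three-dimensional space `ℝ³`. Only its product topology and its real vector space structure
are used below, so no choice of norm matters. -/
abbrev Space : Type := Fin 3 → ℝ

/-- The geometric realization of a finite simple graph: the vertex `v` is the basis vector `e_v`
of `ℝ^V`, and an edge `uv` is the straight segment from `e_u` to `e_v`. -/
def graphRealization {V : Type*} [DecidableEq V] (G : SimpleGraph V) : Set (V → ℝ) :=
  {x | (∃ v : V, x = Pi.single v 1) ∨
    ∃ u v : V, G.Adj u v ∧ x ∈ segment ℝ (Pi.single u (1 : ℝ)) (Pi.single v (1 : ℝ))}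

/-- The contribution of the oriented segments `a → b` and `c → d` to the signed count of crossings
in the diagram obtained by projecting along `v`, where `v` points towards the viewer. It is zero
unless `a → b` passes over `c → d`; then it is the usual sign of the crossing, i.e. the sign of
`det (b - a, d - c, v)`. -/
noncomputable def overcrossingSign (v a b c d : Space) : ℤ := by
  classical exact
    if ∃ s ∈ Ioo (0 : ℝ) 1, ∃ t ∈ Ioo (0 : ℝ) 1, ∃ h > (0 : ℝ),
        AffineMap.lineMap a b s = AffineMap.lineMap c d t + h • v
    then ((SignType.sign (Matrix.det (Matrix.of ![b - a, d - c, v])) : SignType) : ℤ)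
    else 0

/-- For closed polygons with vertices `P 0, …, P N = P 0` and `Q 0, …, Q N = Q 0`, the direction
`v` is regular if, in the projection along `v`, no vertex of one polygon lies on a (closed) edge of
the other. Then edges of `P` and edges of `Q` cross transversally, at interior points. -/
def IsRegularDirection (N : ℕ) (P Q : ℕ → Space) (v : Space) : Prop :=
  v ≠ 0 ∧ ∀ i < N, ∀ j < N, ∀ t ∈ Icc (0 : ℝ) 1, ∀ h : ℝ,
    P i ≠ AffineMap.lineMap (Q j) (Q (j + 1)) t + h • v ∧
    Q i ≠ AffineMap.lineMap (P j) (P (j + 1)) t + h • v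

/-- The signed count, in the projection along `v`, of the crossings at which the polygon `P` passes
over the polygon `Q`. -/
noncomputable def overcrossingCount (N : ℕ) (P Q : ℕ → Space) (v : Space) : ℤ :=
  ∑ i ∈ Finset.range N, ∑ j ∈ Finset.range N,
    overcrossingSign v (P i) (P (i + 1)) (Q j) (Q (j + 1))

/-- `k` is the linking number of the closed oriented polygons `P` and `Q`: regular projections
exist, and each of them has signed overcrossing count `k`. -/
def HasPolygonalLinkingNumber (N : ℕ) (P Q : ℕ → Space) (k : ℤ) : Prop :=
  (∃ v, IsRegularDirection N P Q v) ∧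
    ∀ v, IsRegularDirection N P Q v → overcrossingCount N P Q v = k

/-- The vertices of the closed polygon inscribed in the loop `γ` at the parameters `i / N`. -/
noncomputable def inscribedPolygon (γ : C(UnitAddCircle, Space)) (N : ℕ) (i : ℕ) : Space :=
  γ (((i : ℝ) / (N : ℝ) : ℝ) : UnitAddCircle)

/-- `k` is the linking number of the (disjoint, continuous, oriented) loops `γ` and `δ`: it is
the linking number of the polygons inscribed in them, for all sufficiently fine subdivisions. -/
def HasLinkingNumber (γ δ : C(UnitAddCircle, Space)) (k : ℤ) : Prop :=
  ∀ᶠ N : ℕ in atTop,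
    HasPolygonalLinkingNumber N (inscribedPolygon γ N) (inscribedPolygon δ N) k

/-- There is at most one linking number. -/
theorem HasLinkingNumber.unique {γ δ : C(UnitAddCircle, Space)} {k l : ℤ}
    (hk : HasLinkingNumber γ δ k) (hl : HasLinkingNumber γ δ l) : k = l := by
  obtain ⟨N, h, h'⟩ := (Filter.Eventually.and hk hl).exists
  obtain ⟨v, hv⟩ := h.1
  exact (h.2 v hv).symm.trans (h'.2 v hv)

/-- An oriented link in `ℝ³` with `n` components: `n` pairwise disjoint simple closed curves, each
with the orientation given by its parametrization by the circle `ℝ / ℤ`. -/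
structure OrientedLink (n : ℕ) where
  component : Fin n → C(UnitAddCircle, Space)
  injective : ∀ i, Function.Injective (component i)
  disjoint : ∀ i j, i ≠ j → Disjoint (range (component i)) (range (component j))

/-- The linking pattern of `L`: there is an edge between `i` and `j` if and only if the linking
number of the two components is nonzero. -/
def OrientedLink.linkingPattern {n : ℕ} (L : OrientedLink n) : SimpleGraph (Fin n) :=
  SimpleGraph.fromRel fun i j =>
    ∃ k : ℤ, HasLinkingNumber (L.component i) (L.component j) k ∧ k ≠ 0

/-- The link `L` is contained in the image of the embedded graph `f`. -/
def OrientedLink.IsContainedIn {n : ℕ} (L : OrientedLink n) {X : Type*} (f : X → Space) : Prop :=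
  ∀ i, range (L.component i) ⊆ range f

/-! ### Orientations and crossing signs -/

/-! Replace the embedded graph by a generic piecewise linear drawing, and let O(ab, cd) be the
signed number of places where the edge ab passes over the edge cd. The linking number of two
disjoint cycles is the sum of O over their pairs of edges. Colour each four-element set of vertices
by the residues of O modulo 2^(t+1) on its six ordered pairs of opposite edges. Ramsey's theorem
(`exists_isHomogeneous`) leaves a large set of vertices on which these residues depend only on the
relative position of the two edges: α₁, α₂ for separated edges, β₁, β₂ for interlaced ones, γ₁, γ₂
for nested ones.

Two facts constrain the residues. First, α₁ = α₂: they are the residues of the linking number of two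
triangles, taken in the two orders (`IsHomogeneous.cycleSum_triangles`, `Generic.cycleSum_comm`).
Second, B = β₁ + β₂ - γ₁ - γ₂ is odd: a generic plane drawing of K₅ has an odd number of crossings
of disjoint edges (`Generic.odd_sum_edgeQuad`), and modulo 2 each of the five K₄ inside it
contributes B. Now let k = 2^t with t ≥ 1 and take n cycles of length k + 2, the a-th one running
through the vertices congruent to a modulo n. Any two of them have linking number congruent to kB +
αk² (`IsHomogeneous.cycleSum_interleaved`), which is an odd multiple of 2^t modulo 2^(t+1), so its
absolute value is at least 2^t.

The parity statement for K₅ is reduced to straight drawings: straightening changes the crossings of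
two edges by winding numbers around vertices, and each winding number enters the total twice
(`Generic.edgeCrossing_eq_straight`). For straight drawings it is a finite check on the signs of ten
orientations, constrained by Plücker relations (`bool_five_points`).

That crossings compute a well-defined linking number rests on `Generic.sum_overcrossingSign`: the
count equals the intersection number of one polygon with a cone over the other, where no projection
direction appears. Perturbation extends this to all regular directions, local constancy gives
invariance under homotopies through disjoint polygons, and hence independence of the fineness of
inscribed polygons (`exists_linkingNumber`). As there are finitely many cycles of a given length,
one subdivision and one small perturbation serve all of them (`exists_generic_approximation`). -/

/-- The determinant of three vectors of `ℝ³`. -/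
def det3 (x y z : Space) : ℝ :=
  x 0 * (y 1 * z 2 - y 2 * z 1) - x 1 * (y 0 * z 2 - y 2 * z 0) + x 2 * (y 0 * z 1 - y 1 * z 0)

theorem det_of_eq_det3 (x y z : Space) : Matrix.det (Matrix.of ![x, y, z]) = det3 x y z := by
  rw [Matrix.det_fin_three]; simp [det3]; ring

/-- The orientation of the triangle `a b c` in the projection along `v`. -/
def orient (v a b c : Space) : ℝ := det3 (b - a) (c - a) v

/-- Six times the signed volume of the tetrahedron `a b c d`. -/
def vol (a b c d : Space) : ℝ := det3 (b - a) (c - a) (d - a)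

theorem orient_swap₁₂ (v a b c : Space) : orient v b a c = -orient v a b c := by
  simp only [orient, det3, Pi.sub_apply]; ring

theorem orient_swap₂₃ (v a b c : Space) : orient v a c b = -orient v a b c := by
  simp only [orient, det3, Pi.sub_apply]; ring

theorem orient_rotate (v a b c : Space) : orient v b c a = orient v a b c := by
  simp only [orient, det3, Pi.sub_apply]; ring

theorem orient_neg (v a b c : Space) : orient (-v) a b c = -orient v a b c := by
  simp only [orient, det3, Pi.sub_apply, Pi.neg_apply]; ring

theorem vol_swap₁₂ (a b c d : Space) : vol b a c d = -vol a b c d := by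
  simp only [vol, det3, Pi.sub_apply]; ring

theorem vol_swap₂₃ (a b c d : Space) : vol a c b d = -vol a b c d := by
  simp only [vol, det3, Pi.sub_apply]; ring

theorem vol_swap₃₄ (a b c d : Space) : vol a b d c = -vol a b c d := by
  simp only [vol, det3, Pi.sub_apply]; ring

theorem vol_swap_pairs (a b c d : Space) : vol c d a b = vol a b c d := by
  simp only [vol, det3, Pi.sub_apply]; ring

/-- The sign of the crossing of `a b` and `c d`, read off from the orientations
`abc`, `abd`, `cda`, `cdb`. -/
noncomputable def signPattern (α β ξ η : ℝ) : ℤ := by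
  classical exact
    if α < 0 ∧ 0 < β ∧ 0 < ξ ∧ η < 0 then 1
    else if 0 < α ∧ β < 0 ∧ ξ < 0 ∧ 0 < η then -1 else 0

/-- The sign of the crossing of the segments `a b` and `c d` in the projection along `v`. -/
noncomputable def crossingSign (v a b c d : Space) : ℤ :=
  signPattern (orient v a b c) (orient v a b d) (orient v c d a) (orient v c d b)

theorem det3_sub_sub (v a b c d : Space) :
    det3 (b - a) (d - c) v = orient v a b d - orient v a b c := by
  simp only [orient, det3, Pi.sub_apply]; ring

theorem det3_sub_sub' (v a b c d : Space) :
    det3 (b - a) (d - c) v = orient v c d a - orient v c d b := by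
  simp only [orient, det3, Pi.sub_apply]; ring

section crossing

variable {v a b c d : Space} {s t h : ℝ}

theorem coord_of_crossing (e : AffineMap.lineMap a b s = AffineMap.lineMap c d t + h • v)
    (i : Fin 3) : s * (b i - a i) + a i = t * (d i - c i) + c i + h * v i := by
  have := congrFun e i
  simpa [AffineMap.lineMap_apply] using this

/-- Cramer's rule for the crossing equation: here and in the next two lemmas the parameters `t`,
`s`, `h` of a crossing become orientations or volumes divided by the common determinant. -/
theorem orient_abc_of_crossing
    (e : AffineMap.lineMap a b s = AffineMap.lineMap c d t + h • v) :
    orient v a b c = -t * det3 (b - a) (d - c) v := by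
  have h0 := coord_of_crossing e 0
  have h1 := coord_of_crossing e 1
  have h2 := coord_of_crossing e 2
  simp only [orient, det3, Pi.sub_apply]
  linear_combination
    (- (b 1 - a 1) * v 2 + (b 2 - a 2) * v 1) * -h0 + ((b 0 - a 0) * v 2 - (b 2 - a 2) * v 0) * -h1
      + (-(b 0 - a 0) * v 1 + (b 1 - a 1) * v 0) * -h2

theorem orient_cda_of_crossing
    (e : AffineMap.lineMap a b s = AffineMap.lineMap c d t + h • v) :
    orient v c d a = s * det3 (b - a) (d - c) v := by
  have h0 := coord_of_crossing e 0
  have h1 := coord_of_crossing e 1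
  have h2 := coord_of_crossing e 2
  simp only [orient, det3, Pi.sub_apply]
  linear_combination
    (- (d 1 - c 1) * v 2 + (d 2 - c 2) * v 1) * h0 + ((d 0 - c 0) * v 2 - (d 2 - c 2) * v 0) * h1
      + (-(d 0 - c 0) * v 1 + (d 1 - c 1) * v 0) * h2

theorem vol_of_crossing
    (e : AffineMap.lineMap a b s = AffineMap.lineMap c d t + h • v) :
    vol a b c d = h * det3 (b - a) (d - c) v := by
  have h0 := coord_of_crossing e 0
  have h1 := coord_of_crossing e 1
  have h2 := coord_of_crossing e 2
  simp only [vol, det3, Pi.sub_apply]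
  linear_combination
    ((b 1 - a 1) * (d 2 - c 2) - (b 2 - a 2) * (d 1 - c 1)) * h0
      + ((b 2 - a 2) * (d 0 - c 0) - (b 0 - a 0) * (d 2 - c 2)) * h1
      + ((b 0 - a 0) * (d 1 - c 1) - (b 1 - a 1) * (d 0 - c 0)) * h2

/-- The converse of the three preceding lemmas: the quotients given by Cramer's rule do solve the
crossing equation. -/
theorem crossing_of_det3_ne_zero (hΔ : det3 (b - a) (d - c) v ≠ 0) :
    (AffineMap.lineMap a b (orient v c d a / det3 (b - a) (d - c) v) : Space) =
      AffineMap.lineMap c d (-orient v a b c / det3 (b - a) (d - c) v) +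
        (vol a b c d / det3 (b - a) (d - c) v) • v := by
  ext i
  simp only [AffineMap.lineMap_apply, vsub_eq_sub, vadd_eq_add, Pi.add_apply, Pi.smul_apply,
    Pi.sub_apply, smul_eq_mul]
  field_simp
  fin_cases i <;> simp only [orient, vol, det3, Pi.sub_apply, Fin.zero_eta, Fin.mk_one,
    Fin.reduceFinMk] <;> ring

end crossing

/-- By Cramer's rule, `s` and `t` lie in the open unit interval and `h` is positive exactly when
four orientations and one volume have prescribed signs. From here on crossings are handled purely
through signs of determinants. -/
theorem overcrossingSign_eq (v a b c d : Space) :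
    overcrossingSign v a b c d =
      if orient v a b c < 0 ∧ 0 < orient v a b d ∧ 0 < orient v c d a ∧ orient v c d b < 0 ∧
        0 < vol a b c d then 1
      else if 0 < orient v a b c ∧ orient v a b d < 0 ∧ orient v c d a < 0 ∧ 0 < orient v c d b ∧
        vol a b c d < 0 then -1
      else 0 := by
  classical
  have e1 := det3_sub_sub v a b c d
  have e2 := det3_sub_sub' v a b c d
  unfold overcrossingSign
  rw [det_of_eq_det3]
  rcases lt_trichotomy (det3 (b - a) (d - c) v) 0 with hΔ | hΔ | hΔ
  · rw [if_neg (show ¬(orient v a b c < 0 ∧ _) from fun h => by linarith [h.1, h.2.1])]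
    rw [sign_neg hΔ]
    refine if_congr ?_ rfl rfl
    constructor
    · rintro ⟨s, hs, t, ht, h, hh, e⟩
      have f1 := orient_abc_of_crossing e
      have f2 := orient_cda_of_crossing e
      have f3 := vol_of_crossing e
      refine ⟨?_, ?_, ?_, ?_, ?_⟩ <;> nlinarith [hs.1, hs.2, ht.1, ht.2]
    · rintro ⟨h1, h2, h3, h4, h5⟩
      refine ⟨_, ⟨?_, ?_⟩, _, ⟨?_, ?_⟩, _, ?_, crossing_of_det3_ne_zero hΔ.ne⟩
      · exact div_pos_of_neg_of_neg h3 hΔ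
      · rw [div_lt_one_of_neg hΔ]; linarith
      · exact div_pos_of_neg_of_neg (by linarith) hΔ
      · rw [div_lt_one_of_neg hΔ]; linarith
      · exact div_pos_of_neg_of_neg h5 hΔ
  -- Edges that are parallel in the projection count as zero on both sides: the sign of the
  -- determinant vanishes, and `orient v a b c` equals `orient v a b d`.
  · rw [hΔ, if_neg (show ¬(orient v a b c < 0 ∧ _) from fun h => by linarith [h.1, h.2.1]),
      if_neg (show ¬(0 < orient v a b c ∧ _) from fun h => by linarith [h.1, h.2.1])]
    simp
  · rw [if_neg (show ¬(0 < orient v a b c ∧ _) from fun h => by linarith [h.1, h.2.1])]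
    rw [sign_pos hΔ]
    refine if_congr ?_ rfl rfl
    constructor
    · rintro ⟨s, hs, t, ht, h, hh, e⟩
      have f1 := orient_abc_of_crossing e
      have f2 := orient_cda_of_crossing e
      have f3 := vol_of_crossing e
      refine ⟨?_, ?_, ?_, ?_, ?_⟩ <;> nlinarith [hs.1, hs.2, ht.1, ht.2]
    · rintro ⟨h1, h2, h3, h4, h5⟩
      refine ⟨_, ⟨?_, ?_⟩, _, ⟨?_, ?_⟩, _, ?_, crossing_of_det3_ne_zero hΔ.ne'⟩
      · exact div_pos h3 hΔ
      · rw [div_lt_one hΔ]; linarith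
      · exact div_pos (by linarith) hΔ
      · rw [div_lt_one hΔ]; linarith
      · exact div_pos h5 hΔ

theorem overcrossingSign_swap_left (v a b c d : Space) :
    overcrossingSign v b a c d = -overcrossingSign v a b c d := by
  rw [overcrossingSign_eq, overcrossingSign_eq, orient_swap₁₂ v a b c, orient_swap₁₂ v a b d,
    vol_swap₁₂ a b]
  simp only [Left.neg_neg_iff, Left.neg_pos_iff]
  split_ifs <;> first | rfl | (exfalso; grind)

theorem overcrossingSign_swap_right (v a b c d : Space) :
    overcrossingSign v a b d c = -overcrossingSign v a b c d := by
  rw [overcrossingSign_eq, overcrossingSign_eq, orient_swap₁₂ v c d a, orient_swap₁₂ v c d b,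
    vol_swap₃₄ a b]
  simp only [Left.neg_neg_iff, Left.neg_pos_iff]
  split_ifs <;> first | rfl | (exfalso; grind)

/-- Looking from the opposite side exchanges over and under but preserves the sign of a crossing;
this is the source of the symmetry of the linking number. -/
theorem overcrossingSign_neg (v a b c d : Space) :
    overcrossingSign (-v) c d a b = overcrossingSign v a b c d := by
  rw [overcrossingSign_eq, overcrossingSign_eq, vol_swap_pairs a b]
  simp only [orient_neg, Left.neg_neg_iff, Left.neg_pos_iff]
  split_ifs <;> first | rfl | (exfalso; grind)

theorem overcrossingSign_self_left (v a c d : Space) : overcrossingSign v a a c d = 0 := by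
  have := overcrossingSign_swap_left v a a c d
  omega

theorem overcrossingSign_self_right (v a b c : Space) : overcrossingSign v a b c c = 0 := by
  have := overcrossingSign_swap_right v a b c c
  omega

theorem crossingSign_swap_left (v a b c d : Space) :
    crossingSign v b a c d = -crossingSign v a b c d := by
  unfold crossingSign signPattern
  rw [orient_swap₁₂ v a b c, orient_swap₁₂ v a b d]
  simp only [Left.neg_neg_iff, Left.neg_pos_iff]
  split_ifs <;> first | rfl | (exfalso; grind)

theorem crossingSign_swap_right (v a b c d : Space) :
    crossingSign v a b d c = -crossingSign v a b c d := by
  unfold crossingSign signPattern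
  rw [orient_swap₁₂ v c d a, orient_swap₁₂ v c d b]
  simp only [Left.neg_neg_iff, Left.neg_pos_iff]
  split_ifs <;> first | rfl | (exfalso; grind)

theorem crossingSign_swap (v a b c d : Space) :
    crossingSign v c d a b = -crossingSign v a b c d := by
  unfold crossingSign signPattern
  split_ifs <;> first | rfl | (exfalso; grind)

/-- If the four points are not coplanar, exactly one of two crossing segments is on top; exchanging
the segments reverses the sign in the plane, whence the minus. -/
theorem crossingSign_eq_sub {v a b c d : Space} (h : vol a b c d ≠ 0) :
    crossingSign v a b c d = overcrossingSign v a b c d - overcrossingSign v c d a b := by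
  rw [overcrossingSign_eq, overcrossingSign_eq, vol_swap_pairs a b]
  unfold crossingSign signPattern
  split_ifs <;> first | rfl | (exfalso; grind)

/-! ### A triangle and a segment -/

/-- The sign of a triangle with orientation `δ` if a point with (unnormalized) barycentric
coordinates `x y z` lies inside it, and `0` otherwise. -/
noncomputable def insideSign (δ x y z : ℝ) : ℤ := by
  classical exact
    if 0 < δ ∧ 0 < x ∧ 0 < y ∧ 0 < z then 1
    else if δ < 0 ∧ x < 0 ∧ y < 0 ∧ z < 0 then -1 else 0

/-- `signPattern` in terms of the signs, `true` standing for positive. -/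
def boolPattern (α β ξ η : Bool) : ℤ :=
  if !α && β && ξ && !η then 1 else if α && !β && !ξ && η then -1 else 0

/-- `insideSign` in terms of the signs, `true` standing for positive. -/
def boolInside (δ x y z : Bool) : ℤ :=
  if δ && x && y && z then 1 else if !δ && !x && !y && !z then -1 else 0

/-- The combinatorial core of `triangle_identity`, checked on all sign vectors. Each hypothesis
records that three terms with sum zero cannot all have the same sign. -/
theorem bool_triangle_identity : ∀ δ c₁ c₂ c₃ d₁ d₂ d₃ y₁ y₂ y₃ : Bool,
    !((c₁ == d₂) == (c₂ != d₁) && (c₁ == d₂) == (δ != y₃)) →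
    !((c₂ == d₃) == (c₃ != d₂) && (c₂ == d₃) == (δ != y₁)) →
    !((c₃ == d₁) == (c₁ != d₃) && (c₃ == d₁) == (δ != y₂)) →
    !((c₁ == y₁) == (c₂ == y₂) && (c₁ == y₁) == (c₃ == y₃)) →
    !((d₁ == y₁) == (d₂ == y₂) && (d₁ == y₁) == (d₃ == y₃)) →
    boolPattern c₃ d₃ y₁ y₂ + boolPattern c₁ d₁ y₂ y₃ + boolPattern c₂ d₂ y₃ y₁ =
      boolInside δ d₁ d₂ d₃ - boolInside δ c₁ c₂ c₃ := by
  decide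

theorem neg_iff_decide_pos_eq_false {x : ℝ} (hx : x ≠ 0) : x < 0 ↔ decide (0 < x) = false := by
  rw [decide_eq_false_iff_not, not_lt]; exact ⟨le_of_lt, fun h => lt_of_le_of_ne h hx⟩

theorem signPattern_eq_boolPattern {α β ξ η : ℝ} (hα : α ≠ 0) (hβ : β ≠ 0) (hξ : ξ ≠ 0)
    (hη : η ≠ 0) : signPattern α β ξ η =
      boolPattern (decide (0 < α)) (decide (0 < β)) (decide (0 < ξ)) (decide (0 < η)) := by
  unfold signPattern boolPattern
  simp only [neg_iff_decide_pos_eq_false hα, neg_iff_decide_pos_eq_false hβ,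
    neg_iff_decide_pos_eq_false hξ, neg_iff_decide_pos_eq_false hη, Bool.and_eq_true,
    Bool.not_eq_true', decide_eq_true_eq, and_assoc]

theorem insideSign_eq_boolInside {δ x y z : ℝ} (hδ : δ ≠ 0) (hx : x ≠ 0) (hy : y ≠ 0)
    (hz : z ≠ 0) : insideSign δ x y z =
      boolInside (decide (0 < δ)) (decide (0 < x)) (decide (0 < y)) (decide (0 < z)) := by
  unfold insideSign boolInside
  simp only [neg_iff_decide_pos_eq_false hδ, neg_iff_decide_pos_eq_false hx,
    neg_iff_decide_pos_eq_false hy, neg_iff_decide_pos_eq_false hz, Bool.and_eq_true,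
    Bool.not_eq_true', decide_eq_true_eq, and_assoc]

theorem decide_mul_pos {x y : ℝ} (hx : x ≠ 0) (hy : y ≠ 0) :
    decide (0 < x * y) = (decide (0 < x) == decide (0 < y)) := by
  rcases lt_or_gt_of_ne hx with h | h <;> rcases lt_or_gt_of_ne hy with h' | h'
  · rw [decide_eq_true (mul_pos_of_neg_of_neg h h'), decide_eq_false h.not_gt,
      decide_eq_false h'.not_gt]; rfl
  · rw [decide_eq_false (mul_neg_of_neg_of_pos h h').not_gt, decide_eq_false h.not_gt,
      decide_eq_true h']; rfl
  · rw [decide_eq_false (mul_neg_of_pos_of_neg h h').not_gt, decide_eq_true h,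
      decide_eq_false h'.not_gt]; rfl
  · rw [decide_eq_true (mul_pos h h'), decide_eq_true h, decide_eq_true h']; rfl

theorem decide_neg_mul_pos {x y : ℝ} (hx : x ≠ 0) (hy : y ≠ 0) :
    decide (0 < -(x * y)) = (decide (0 < x) != decide (0 < y)) := by
  have h : decide (0 < -(x * y)) = !decide (0 < x * y) := by
    rcases lt_or_gt_of_ne (mul_ne_zero hx hy) with h | h
    · rw [decide_eq_true (neg_pos.2 h), decide_eq_false h.not_gt]; rfl
    · rw [decide_eq_false (neg_neg_of_pos h).not_gt, decide_eq_true h]; rfl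
  rw [h, decide_mul_pos hx hy]; rfl

theorem not_all_signs_eq_of_add_eq_zero {x y z : ℝ} (hx : x ≠ 0) (hy : y ≠ 0) (hz : z ≠ 0)
    (h : x + y + z = 0) : !(decide (0 < x) == decide (0 < y) && decide (0 < x) == decide (0 < z)) := by
  rcases lt_or_gt_of_ne hx with h1 | h1 <;> rcases lt_or_gt_of_ne hy with h2 | h2 <;>
    rcases lt_or_gt_of_ne hz with h3 | h3
  case inl.inl.inl => linarith
  case inr.inr.inr => linarith
  all_goals simp [h1, h2, h3, h1.le, h2.le, h3.le]

/-- A segment running from c to d in the plane crosses the boundary of a triangle once, with sign,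
each time it enters or leaves. The cᵢ and dᵢ are the barycentric coordinates of its endpoints, and
the yᵢ tell on which side of the segment's line the corners lie. -/
theorem triangle_identity {δ c₁ c₂ c₃ d₁ d₂ d₃ y₁ y₂ y₃ : ℝ} (hδ : δ ≠ 0)
    (hc₁ : c₁ ≠ 0) (hc₂ : c₂ ≠ 0) (hc₃ : c₃ ≠ 0) (hd₁ : d₁ ≠ 0) (hd₂ : d₂ ≠ 0) (hd₃ : d₃ ≠ 0)
    (hy₁ : y₁ ≠ 0) (hy₂ : y₂ ≠ 0) (hy₃ : y₃ ≠ 0)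
    (e₁ : δ * y₁ = c₂ * d₃ - c₃ * d₂) (e₂ : δ * y₂ = c₃ * d₁ - c₁ * d₃)
    (e₃ : δ * y₃ = c₁ * d₂ - c₂ * d₁) :
    signPattern c₃ d₃ y₁ y₂ + signPattern c₁ d₁ y₂ y₃ + signPattern c₂ d₂ y₃ y₁ =
      insideSign δ d₁ d₂ d₃ - insideSign δ c₁ c₂ c₃ := by
  -- The vector δ·y is the cross product of the vectors c and d, hence orthogonal to both.
  have ec : c₁ * y₁ + c₂ * y₂ + c₃ * y₃ = 0 := by
    refine (mul_eq_zero.1 (?_ : δ * _ = 0)).resolve_left hδ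
    linear_combination c₁ * e₁ + c₂ * e₂ + c₃ * e₃
  have ed : d₁ * y₁ + d₂ * y₂ + d₃ * y₃ = 0 := by
    refine (mul_eq_zero.1 (?_ : δ * _ = 0)).resolve_left hδ
    linear_combination d₁ * e₁ + d₂ * e₂ + d₃ * e₃
  have f₁ := not_all_signs_eq_of_add_eq_zero (mul_ne_zero hc₂ hd₃)
    (neg_ne_zero.2 (mul_ne_zero hc₃ hd₂)) (neg_ne_zero.2 (mul_ne_zero hδ hy₁)) (by linarith)
  have f₂ := not_all_signs_eq_of_add_eq_zero (mul_ne_zero hc₃ hd₁)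
    (neg_ne_zero.2 (mul_ne_zero hc₁ hd₃)) (neg_ne_zero.2 (mul_ne_zero hδ hy₂)) (by linarith)
  have f₃ := not_all_signs_eq_of_add_eq_zero (mul_ne_zero hc₁ hd₂)
    (neg_ne_zero.2 (mul_ne_zero hc₂ hd₁)) (neg_ne_zero.2 (mul_ne_zero hδ hy₃)) (by linarith)
  have fc := not_all_signs_eq_of_add_eq_zero (mul_ne_zero hc₁ hy₁) (mul_ne_zero hc₂ hy₂)
    (mul_ne_zero hc₃ hy₃) ec
  have fd := not_all_signs_eq_of_add_eq_zero (mul_ne_zero hd₁ hy₁) (mul_ne_zero hd₂ hy₂)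
    (mul_ne_zero hd₃ hy₃) ed
  rw [decide_mul_pos hc₂ hd₃, decide_neg_mul_pos hc₃ hd₂, decide_neg_mul_pos hδ hy₁] at f₁
  rw [decide_mul_pos hc₃ hd₁, decide_neg_mul_pos hc₁ hd₃, decide_neg_mul_pos hδ hy₂] at f₂
  rw [decide_mul_pos hc₁ hd₂, decide_neg_mul_pos hc₂ hd₁, decide_neg_mul_pos hδ hy₃] at f₃
  rw [decide_mul_pos hc₁ hy₁, decide_mul_pos hc₂ hy₂, decide_mul_pos hc₃ hy₃] at fc
  rw [decide_mul_pos hd₁ hy₁, decide_mul_pos hd₂ hy₂, decide_mul_pos hd₃ hy₃] at fd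
  rw [signPattern_eq_boolPattern hc₃ hd₃ hy₁ hy₂, signPattern_eq_boolPattern hc₁ hd₁ hy₂ hy₃,
    signPattern_eq_boolPattern hc₂ hd₂ hy₃ hy₁, insideSign_eq_boolInside hδ hd₁ hd₂ hd₃,
    insideSign_eq_boolInside hδ hc₁ hc₂ hc₃]
  exact bool_triangle_identity _ _ _ _ _ _ _ _ _ _ f₃ f₁ f₂ fc fd

/-- Plücker relations among the orientations of five points; these are the hypotheses `e₁`, `e₂`,
`e₃` of `triangle_identity` for the triangle p q x. -/
theorem orient_mul_orient₁ (v p q x c d : Space) :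
    orient v p q x * orient v c d p =
      orient v x p c * orient v p q d - orient v p q c * orient v x p d := by
  simp only [orient, det3, Pi.sub_apply]; ring

theorem orient_mul_orient₂ (v p q x c d : Space) :
    orient v p q x * orient v c d q =
      orient v p q c * orient v q x d - orient v q x c * orient v p q d := by
  simp only [orient, det3, Pi.sub_apply]; ring

theorem orient_mul_orient₃ (v p q x c d : Space) :
    orient v p q x * orient v c d x =
      orient v q x c * orient v x p d - orient v x p c * orient v q x d := by
  simp only [orient, det3, Pi.sub_apply]; ring

theorem orient_mul_vol (v p q x c d : Space) :
    orient v p q c * vol p q x d - orient v p q d * vol p q x c =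
      orient v p q x * vol p q c d := by
  simp only [orient, vol, det3, Pi.sub_apply]; ring

/-! ### Overcrossings of the boundary of a triangle over a segment in space. -/

theorem mul_neg_iff_of_pos_left' {x y : ℝ} (hx : 0 < x) : x * y < 0 ↔ y < 0 :=
  ⟨fun h => (pos_iff_neg_of_mul_neg h).1 hx, mul_neg_of_pos_of_neg hx⟩

/-- The contribution to `overcrossingSign` in terms of orientations and a volume. -/
noncomputable def overPattern (α β ξ η ν : ℝ) : ℤ := by
  classical exact
    if α < 0 ∧ 0 < β ∧ 0 < ξ ∧ η < 0 ∧ 0 < ν then 1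
    else if 0 < α ∧ β < 0 ∧ ξ < 0 ∧ 0 < η ∧ ν < 0 then -1 else 0

/-- `insideSign` for points below the plane of the triangle, `γ` being the volume spanned by the
triangle and the point. -/
noncomputable def belowSign (γ δ x y z : ℝ) : ℤ := by
  classical exact if γ * δ < 0 then insideSign δ x y z else 0

/-- The intersection number of a triangle and a segment whose endpoints span the volumes `γ`, `γ'`
with the triangle, while the segment spans the volumes `V₁`, `V₂`, `V₃` with the edges. -/
noncomputable def piercingSign (γ γ' V₁ V₂ V₃ : ℝ) : ℤ := by
  classical exact
    if γ < 0 ∧ 0 < γ' ∧ 0 < V₁ ∧ 0 < V₂ ∧ 0 < V₃ then 1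
    else if 0 < γ ∧ γ' < 0 ∧ V₁ < 0 ∧ V₂ < 0 ∧ V₃ < 0 then -1 else 0

theorem overPattern_neg (α β ξ η ν : ℝ) :
    overPattern (-α) (-β) η ξ (-ν) = -overPattern α β ξ η ν := by
  unfold overPattern
  simp only [Left.neg_neg_iff, Left.neg_pos_iff]
  split_ifs <;> first | rfl | (exfalso; grind)

theorem belowSign_neg (γ δ x y z : ℝ) :
    belowSign (-γ) (-δ) (-y) (-x) (-z) = -belowSign γ δ x y z := by
  unfold belowSign insideSign
  simp only [Left.neg_neg_iff, Left.neg_pos_iff, neg_mul_neg]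
  split_ifs <;> first | rfl | (exfalso; grind)

theorem piercingSign_neg (γ γ' V₁ V₂ V₃ : ℝ) :
    piercingSign (-γ) (-γ') (-V₂) (-V₁) (-V₃) = -piercingSign γ γ' V₁ V₂ V₃ := by
  unfold piercingSign
  simp only [Left.neg_neg_iff, Left.neg_pos_iff]
  split_ifs <;> first | rfl | (exfalso; grind)

section overPattern

variable {δ α β ξ η ν γ γ' : ℝ}

/-- When both endpoints of the segment are below the plane of the triangle, every plane crossing
with a side of the triangle is an overcrossing of that side. -/
theorem overPattern_of_below (hδ : 0 < δ) (e : δ * ν = α * γ' - β * γ) (hγ : γ < 0)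
    (hγ' : γ' < 0) : overPattern α β ξ η ν = signPattern α β ξ η := by
  have h1 : α < 0 → 0 < β → 0 < ν := fun h h' => by
    refine pos_of_mul_pos_right ?_ hδ.le
    nlinarith
  have h2 : 0 < α → β < 0 → ν < 0 := fun h h' => by
    refine (pos_iff_neg_of_mul_neg ?_).1 hδ
    nlinarith
  unfold overPattern signPattern
  split_ifs <;> first | rfl | (exfalso; grind)

theorem overPattern_of_above (hδ : 0 < δ) (e : δ * ν = α * γ' - β * γ) (hγ : 0 < γ)
    (hγ' : 0 < γ') : overPattern α β ξ η ν = 0 := by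
  have h1 : α < 0 → 0 < β → ν < 0 := fun h h' => by
    refine (pos_iff_neg_of_mul_neg ?_).1 hδ
    nlinarith
  have h2 : 0 < α → β < 0 → 0 < ν := fun h h' => by
    refine pos_of_mul_pos_right ?_ hδ.le
    nlinarith
  unfold overPattern
  split_ifs <;> first | rfl | (exfalso; grind)

/-- Only the part of the segment below the plane of the triangle matters, so the endpoint above it
may be replaced by the point where the segment pierces the plane. Up to positive factors, this turns
`β` into `δ * ν` and multiplies `ξ` and `η` by `-γ`. -/
theorem overPattern_of_below_above (hδ : 0 < δ) (e : δ * ν = α * γ' - β * γ) (hγ : γ < 0)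
    (hγ' : 0 < γ') :
    overPattern α β ξ η ν = signPattern α (δ * ν) (-γ * ξ) (-γ * η) := by
  have h1 : α < 0 → 0 < ν → 0 < β := fun h h' => by
    have := mul_pos hδ h'
    by_contra hb
    nlinarith
  have h2 : 0 < α → ν < 0 → β < 0 := fun h h' => by
    have := mul_neg_of_pos_of_neg hδ h'
    by_contra hb
    nlinarith
  have hγn : 0 < -γ := neg_pos.2 hγ
  unfold overPattern signPattern
  simp only [mul_pos_iff_of_pos_left hδ, mul_pos_iff_of_pos_left hγn, mul_neg_iff_of_pos_left' hδ,
    mul_neg_iff_of_pos_left' hγn]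
  split_ifs <;> first | rfl | (exfalso; grind)

theorem overPattern_of_above_below (hδ : 0 < δ) (e : δ * ν = α * γ' - β * γ) (hγ : 0 < γ)
    (hγ' : γ' < 0) :
    overPattern α β ξ η ν = signPattern (-(δ * ν)) β (-γ' * ξ) (-γ' * η) := by
  have h1 : 0 < β → 0 < ν → α < 0 := fun h h' => by
    have := mul_pos hδ h'
    by_contra hb
    nlinarith
  have h2 : β < 0 → ν < 0 → 0 < α := fun h h' => by
    have := mul_neg_of_pos_of_neg hδ h'
    by_contra hb
    nlinarith
  have hγn : 0 < -γ' := neg_pos.2 hγ'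
  unfold overPattern signPattern
  simp only [mul_pos_iff_of_pos_left hδ, mul_pos_iff_of_pos_left hγn, mul_neg_iff_of_pos_left' hδ,
    mul_neg_iff_of_pos_left' hγn, Left.neg_neg_iff, Left.neg_pos_iff]
  split_ifs <;> first | rfl | (exfalso; grind)

end overPattern

/-- Four cases, according to the sides of the plane on which the endpoints lie. Each reduces to
`triangle_identity` for the part of the segment below the plane; if the segment pierces the plane
inside the triangle, the piercing point supplies the extra term. -/
theorem triangle_over_identity_of_pos {δ c₁ c₂ c₃ d₁ d₂ d₃ y₁ y₂ y₃ γ γ' V₁ V₂ V₃ : ℝ}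
    (hδ : 0 < δ)
    (hc₁ : c₁ ≠ 0) (hc₂ : c₂ ≠ 0) (hc₃ : c₃ ≠ 0) (hd₁ : d₁ ≠ 0) (hd₂ : d₂ ≠ 0) (hd₃ : d₃ ≠ 0)
    (hy₁ : y₁ ≠ 0) (hy₂ : y₂ ≠ 0) (hy₃ : y₃ ≠ 0) (hγ : γ ≠ 0) (hγ' : γ' ≠ 0)
    (hV₁ : V₁ ≠ 0) (hV₂ : V₂ ≠ 0) (hV₃ : V₃ ≠ 0)
    (e₁ : δ * y₁ = c₂ * d₃ - c₃ * d₂) (e₂ : δ * y₂ = c₃ * d₁ - c₁ * d₃)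
    (e₃ : δ * y₃ = c₁ * d₂ - c₂ * d₁) (f₁ : δ * V₁ = c₁ * γ' - d₁ * γ)
    (f₂ : δ * V₂ = c₂ * γ' - d₂ * γ) (f₃ : δ * V₃ = c₃ * γ' - d₃ * γ) :
    overPattern c₃ d₃ y₁ y₂ V₃ + overPattern c₁ d₁ y₂ y₃ V₁ + overPattern c₂ d₂ y₃ y₁ V₂ =
      belowSign γ' δ d₁ d₂ d₃ - belowSign γ δ c₁ c₂ c₃ + piercingSign γ γ' V₁ V₂ V₃ := by
  have hδ0 := hδ.ne'
  rcases lt_or_gt_of_ne hγ with h | h <;> rcases lt_or_gt_of_ne hγ' with h' | h'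
  · rw [overPattern_of_below hδ f₁ h h', overPattern_of_below hδ f₂ h h',
      overPattern_of_below hδ f₃ h h',
      triangle_identity hδ0 hc₁ hc₂ hc₃ hd₁ hd₂ hd₃ hy₁ hy₂ hy₃ e₁ e₂ e₃]
    rw [belowSign, belowSign, if_pos (mul_neg_of_neg_of_pos h hδ),
      if_pos (mul_neg_of_neg_of_pos h' hδ), piercingSign, if_neg (fun k => h'.not_gt k.2.1),
      if_neg (fun k => h.not_gt k.1)]
    ring
  -- The piercing point has barycentric coordinates proportional to V₁, V₂, V₃ and takes the place
  -- of the endpoint d.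
  · rw [overPattern_of_below_above hδ f₁ h h', overPattern_of_below_above hδ f₂ h h',
      overPattern_of_below_above hδ f₃ h h',
      triangle_identity (δ := δ) (c₁ := c₁) (c₂ := c₂) (c₃ := c₃) (d₁ := δ * V₁) (d₂ := δ * V₂)
        (d₃ := δ * V₃) hδ0 hc₁ hc₂ hc₃ (mul_ne_zero hδ0 hV₁) (mul_ne_zero hδ0 hV₂)
        (mul_ne_zero hδ0 hV₃) (mul_ne_zero (neg_ne_zero.2 hγ) hy₁)
        (mul_ne_zero (neg_ne_zero.2 hγ) hy₂) (mul_ne_zero (neg_ne_zero.2 hγ) hy₃)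
        (by rw [f₃, f₂]; linear_combination -γ * e₁) (by rw [f₁, f₃]; linear_combination -γ * e₂)
        (by rw [f₁, f₂]; linear_combination -γ * e₃)]
    rw [belowSign, belowSign, if_neg (mul_pos h' hδ).not_gt, if_pos (mul_neg_of_neg_of_pos h hδ),
      piercingSign, insideSign]
    simp only [mul_pos_iff_of_pos_left hδ, hδ, h, h', h.not_gt, hδ.not_gt, true_and, false_and,
      if_false]
    ring
  · rw [overPattern_of_above_below hδ f₁ h h', overPattern_of_above_below hδ f₂ h h',
      overPattern_of_above_below hδ f₃ h h',
      triangle_identity (δ := δ) (d₁ := d₁) (d₂ := d₂) (d₃ := d₃) (c₁ := -(δ * V₁))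
        (c₂ := -(δ * V₂)) (c₃ := -(δ * V₃)) hδ0
        (neg_ne_zero.2 (mul_ne_zero hδ0 hV₁)) (neg_ne_zero.2 (mul_ne_zero hδ0 hV₂))
        (neg_ne_zero.2 (mul_ne_zero hδ0 hV₃)) hd₁ hd₂ hd₃ (mul_ne_zero (neg_ne_zero.2 hγ') hy₁)
        (mul_ne_zero (neg_ne_zero.2 hγ') hy₂) (mul_ne_zero (neg_ne_zero.2 hγ') hy₃)
        (by rw [f₃, f₂]; linear_combination -γ' * e₁) (by rw [f₁, f₃]; linear_combination -γ' * e₂)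
        (by rw [f₁, f₂]; linear_combination -γ' * e₃)]
    rw [belowSign, belowSign, if_neg (mul_pos h hδ).not_gt, if_pos (mul_neg_of_neg_of_pos h' hδ),
      piercingSign, insideSign, insideSign]
    simp only [mul_neg_iff_of_pos_left' hδ, hδ, h, h', h.not_gt, hδ.not_gt, true_and, false_and,
      if_false, Left.neg_pos_iff]
    split_ifs <;> rfl
  · rw [overPattern_of_above hδ f₁ h h', overPattern_of_above hδ f₂ h h',
      overPattern_of_above hδ f₃ h h', belowSign, belowSign, if_neg (mul_pos h hδ).not_gt,
      if_neg (mul_pos h' hδ).not_gt, piercingSign, if_neg (fun k => h.not_gt k.1),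
      if_neg (fun k => h'.not_gt k.2.1)]
    rfl

theorem triangle_over_identity {δ c₁ c₂ c₃ d₁ d₂ d₃ y₁ y₂ y₃ γ γ' V₁ V₂ V₃ : ℝ} (hδ : δ ≠ 0)
    (hc₁ : c₁ ≠ 0) (hc₂ : c₂ ≠ 0) (hc₃ : c₃ ≠ 0) (hd₁ : d₁ ≠ 0) (hd₂ : d₂ ≠ 0) (hd₃ : d₃ ≠ 0)
    (hy₁ : y₁ ≠ 0) (hy₂ : y₂ ≠ 0) (hy₃ : y₃ ≠ 0) (hγ : γ ≠ 0) (hγ' : γ' ≠ 0)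
    (hV₁ : V₁ ≠ 0) (hV₂ : V₂ ≠ 0) (hV₃ : V₃ ≠ 0)
    (e₁ : δ * y₁ = c₂ * d₃ - c₃ * d₂) (e₂ : δ * y₂ = c₃ * d₁ - c₁ * d₃)
    (e₃ : δ * y₃ = c₁ * d₂ - c₂ * d₁) (f₁ : δ * V₁ = c₁ * γ' - d₁ * γ)
    (f₂ : δ * V₂ = c₂ * γ' - d₂ * γ) (f₃ : δ * V₃ = c₃ * γ' - d₃ * γ) :
    overPattern c₃ d₃ y₁ y₂ V₃ + overPattern c₁ d₁ y₂ y₃ V₁ + overPattern c₂ d₂ y₃ y₁ V₂ =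
      belowSign γ' δ d₁ d₂ d₃ - belowSign γ δ c₁ c₂ c₃ + piercingSign γ γ' V₁ V₂ V₃ := by
  rcases lt_or_gt_of_ne hδ with h | h
  -- Exchanging the first two vertices of the triangle makes its orientation positive and negates
  -- both sides.
  · have key := triangle_over_identity_of_pos (δ := -δ) (c₁ := -c₂) (c₂ := -c₁) (c₃ := -c₃)
      (d₁ := -d₂) (d₂ := -d₁) (d₃ := -d₃) (y₁ := y₂) (y₂ := y₁) (y₃ := y₃) (γ := -γ) (γ' := -γ')
      (V₁ := -V₂) (V₂ := -V₁) (V₃ := -V₃) (neg_pos.2 h) (neg_ne_zero.2 hc₂) (neg_ne_zero.2 hc₁)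
      (neg_ne_zero.2 hc₃) (neg_ne_zero.2 hd₂) (neg_ne_zero.2 hd₁) (neg_ne_zero.2 hd₃) hy₂ hy₁ hy₃
      (neg_ne_zero.2 hγ) (neg_ne_zero.2 hγ') (neg_ne_zero.2 hV₂) (neg_ne_zero.2 hV₁)
      (neg_ne_zero.2 hV₃) (by linear_combination -e₂) (by linear_combination -e₁)
      (by linear_combination -e₃) (by linear_combination f₂) (by linear_combination f₁)
      (by linear_combination f₃)
    rw [overPattern_neg, overPattern_neg, overPattern_neg, belowSign_neg, belowSign_neg,
      piercingSign_neg] at key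
    linarith
  · exact triangle_over_identity_of_pos h hc₁ hc₂ hc₃ hd₁ hd₂ hd₃ hy₁ hy₂ hy₃ hγ hγ' hV₁ hV₂ hV₃
      e₁ e₂ e₃ f₁ f₂ f₃

/-! ### Generic configurations of points -/

/-- A family of points of `ℝ³` is generic for the projection along `v` if no three of the points
become collinear in the projection and no four of them are coplanar. -/
structure Generic {ι : Type*} (v : Space) (z : ι → Space) : Prop where
  orient_ne : ∀ i j k, i ≠ j → i ≠ k → j ≠ k → orient v (z i) (z j) (z k) ≠ 0
  vol_ne : ∀ i j k l, i ≠ j → i ≠ k → i ≠ l → j ≠ k → j ≠ l → k ≠ l →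
    vol (z i) (z j) (z k) (z l) ≠ 0

theorem overcrossingSign_eq_overPattern (v a b c d : Space) :
    overcrossingSign v a b c d = overPattern (orient v a b c) (orient v a b d) (orient v c d a)
      (orient v c d b) (vol a b c d) :=
  overcrossingSign_eq v a b c d

/-- The sign of the triangle `p q x` if the point `c` lies below it, and `0` otherwise. -/
noncomputable def shadowSign (v p q x c : Space) : ℤ :=
  belowSign (vol p q x c) (orient v p q x) (orient v q x c) (orient v x p c) (orient v p q c)

/-- The intersection number of the triangle `p q x` with the segment `c d`. -/
noncomputable def intersectionSign (p q x c d : Space) : ℤ :=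
  piercingSign (vol p q x c) (vol p q x d) (vol q x c d) (vol x p c d) (vol p q c d)

theorem vol_rotate (a b c d : Space) : vol b c a d = vol a b c d := by
  rw [vol_swap₂₃ b a c, vol_swap₁₂ a b c, neg_neg]

section Generic

variable {ι : Type*} {v w : Space} {z : ι → Space}

/-- Genericity supplies all nonvanishing conditions of `triangle_over_identity`. The shadow terms
are a difference over the ends of the segment, and the remaining term does not involve `v`. -/
theorem Generic.overcrossingSign_triangle (hz : Generic v z) {p q x c d : ι} (pq : p ≠ q)
    (px : p ≠ x) (qx : q ≠ x) (pc : p ≠ c) (pd : p ≠ d) (qc : q ≠ c) (qd : q ≠ d) (xc : x ≠ c)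
    (xd : x ≠ d) (cd : c ≠ d) :
    overcrossingSign v (z p) (z q) (z c) (z d) + overcrossingSign v (z q) (z x) (z c) (z d) +
        overcrossingSign v (z x) (z p) (z c) (z d) =
      shadowSign v (z p) (z q) (z x) (z d) - shadowSign v (z p) (z q) (z x) (z c) +
        intersectionSign (z p) (z q) (z x) (z c) (z d) := by
  simp only [overcrossingSign_eq_overPattern]
  have hO := hz.orient_ne
  have hV := hz.vol_ne
  refine triangle_over_identity (hO _ _ _ pq px qx) (hO _ _ _ qx qc xc) (hO _ _ _ px.symm xc pc)
    (hO _ _ _ pq pc qc) (hO _ _ _ qx qd xd) (hO _ _ _ px.symm xd pd) (hO _ _ _ pq pd qd)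
    (hO _ _ _ cd pc.symm pd.symm) (hO _ _ _ cd qc.symm qd.symm) (hO _ _ _ cd xc.symm xd.symm)
    (hV _ _ _ _ pq px pc qx qc xc) (hV _ _ _ _ pq px pd qx qd xd) (hV _ _ _ _ qx qc qd xc xd cd)
    (hV _ _ _ _ px.symm xc xd pc pd cd) (hV _ _ _ _ pq pc pd qc qd cd)
    (orient_mul_orient₁ ..) (orient_mul_orient₂ ..) (orient_mul_orient₃ ..) ?_ ?_
    (orient_mul_vol ..).symm
  · rw [← vol_rotate (z p) (z q) (z x) (z d), ← vol_rotate (z p) (z q) (z x) (z c),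
      ← orient_rotate v (z p) (z q) (z x)]
    exact (orient_mul_vol ..).symm
  · rw [vol_rotate (z x) (z p) (z q) (z d), vol_rotate (z x) (z p) (z q) (z c),
      orient_rotate v (z x) (z p) (z q)]
    exact (orient_mul_vol ..).symm

/-- For closed polygons in generic position the signed number of overcrossings is the intersection
number of one polygon with a cone over the other. -/
theorem Generic.sum_overcrossingSign (hz : Generic v z) {N M : ℕ} {A B : ℕ → ι} {x : ι}
    (hA : A N = A 0) (hB : B M = B 0) (hA' : ∀ i, A i ≠ A (i + 1)) (hB' : ∀ i, B i ≠ B (i + 1))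
    (hAB : ∀ i j, A i ≠ B j) (hxA : ∀ i, A i ≠ x) (hxB : ∀ i, x ≠ B i) :
    ∑ i ∈ Finset.range N, ∑ j ∈ Finset.range M,
        overcrossingSign v (z (A i)) (z (A (i + 1))) (z (B j)) (z (B (j + 1))) =
      ∑ i ∈ Finset.range N, ∑ j ∈ Finset.range M,
        intersectionSign (z (A i)) (z (A (i + 1))) (z x) (z (B j)) (z (B (j + 1))) := by
  -- Complete each edge of `A` to a triangle with apex `x`. The shadow terms telescope along the
  -- closed polygon `B`, and the sides through `x` telescope along `A`.
  have h1 : ∀ i j, overcrossingSign v (z (A i)) (z (A (i + 1))) (z (B j)) (z (B (j + 1))) =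
      intersectionSign (z (A i)) (z (A (i + 1))) (z x) (z (B j)) (z (B (j + 1))) +
      (shadowSign v (z (A i)) (z (A (i + 1))) (z x) (z (B (j + 1))) -
        shadowSign v (z (A i)) (z (A (i + 1))) (z x) (z (B j))) +
      (overcrossingSign v (z x) (z (A (i + 1))) (z (B j)) (z (B (j + 1))) -
        overcrossingSign v (z x) (z (A i)) (z (B j)) (z (B (j + 1)))) := fun i j => by
    have := hz.overcrossingSign_triangle (hA' i) (hxA i) (hxA (i + 1)) (hAB i j) (hAB i (j + 1))
      (hAB (i + 1) j) (hAB (i + 1) (j + 1)) (hxB j) (hxB (j + 1)) (hB' j)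
    rw [overcrossingSign_swap_left v (z x) (z (A (i + 1)))] at this
    linarith
  simp only [h1, Finset.sum_add_distrib]
  have h2 : ∑ i ∈ Finset.range N, ∑ j ∈ Finset.range M,
      (shadowSign v (z (A i)) (z (A (i + 1))) (z x) (z (B (j + 1))) -
        shadowSign v (z (A i)) (z (A (i + 1))) (z x) (z (B j))) = 0 :=
    Finset.sum_eq_zero fun i _ => by
      rw [Finset.sum_range_sub fun j => shadowSign v (z (A i)) (z (A (i + 1))) (z x) (z (B j)), hB,
        sub_self]
  have h3 : ∑ i ∈ Finset.range N, ∑ j ∈ Finset.range M,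
      (overcrossingSign v (z x) (z (A (i + 1))) (z (B j)) (z (B (j + 1))) -
        overcrossingSign v (z x) (z (A i)) (z (B j)) (z (B (j + 1)))) = 0 := by
    rw [Finset.sum_comm]
    refine Finset.sum_eq_zero fun j _ => ?_
    rw [Finset.sum_range_sub fun i => overcrossingSign v (z x) (z (A i)) (z (B j)) (z (B (j + 1))),
      hA, sub_self]
  rw [h2, h3, add_zero, add_zero]

theorem Generic.sum_overcrossingSign_eq (hv : Generic v z) (hw : Generic w z) {N M : ℕ}
    {A B : ℕ → ι} {x : ι}
    (hA : A N = A 0) (hB : B M = B 0) (hA' : ∀ i, A i ≠ A (i + 1)) (hB' : ∀ i, B i ≠ B (i + 1))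
    (hAB : ∀ i j, A i ≠ B j) (hxA : ∀ i, A i ≠ x) (hxB : ∀ i, x ≠ B i) :
    ∑ i ∈ Finset.range N, ∑ j ∈ Finset.range M,
        overcrossingSign v (z (A i)) (z (A (i + 1))) (z (B j)) (z (B (j + 1))) =
      ∑ i ∈ Finset.range N, ∑ j ∈ Finset.range M,
        overcrossingSign w (z (A i)) (z (A (i + 1))) (z (B j)) (z (B (j + 1))) := by
  rw [hv.sum_overcrossingSign hA hB hA' hB' hAB hxA hxB,
    hw.sum_overcrossingSign hA hB hA' hB' hAB hxA hxB]

theorem Generic.crossingSign_triangle (hz : Generic v z) {a b c d y : ι} (cd : c ≠ d)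
    (cy : c ≠ y) (dy : d ≠ y) (ca : c ≠ a) (cb : c ≠ b) (da : d ≠ a) (db : d ≠ b) (ya : y ≠ a)
    (yb : y ≠ b) (ab : a ≠ b) :
    crossingSign v (z a) (z b) (z c) (z d) + crossingSign v (z a) (z b) (z d) (z y) +
        crossingSign v (z a) (z b) (z y) (z c) =
      insideSign (orient v (z c) (z d) (z y)) (orient v (z d) (z y) (z a))
          (orient v (z y) (z c) (z a)) (orient v (z c) (z d) (z a)) -
        insideSign (orient v (z c) (z d) (z y)) (orient v (z d) (z y) (z b))
          (orient v (z y) (z c) (z b)) (orient v (z c) (z d) (z b)) := by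
  have hO := hz.orient_ne
  have := triangle_identity (hO _ _ _ cd cy dy) (hO _ _ _ dy da ya) (hO _ _ _ cy.symm ya ca)
    (hO _ _ _ cd ca da) (hO _ _ _ dy db yb) (hO _ _ _ cy.symm yb cb) (hO _ _ _ cd cb db)
    (hO _ _ _ ab ca.symm cb.symm) (hO _ _ _ ab da.symm db.symm) (hO _ _ _ ab ya.symm yb.symm)
    (orient_mul_orient₁ ..) (orient_mul_orient₂ ..) (orient_mul_orient₃ ..)
  rw [crossingSign_swap v (z c) (z d) (z a) (z b), crossingSign_swap v (z d) (z y) (z a) (z b),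
    crossingSign_swap v (z y) (z c) (z a) (z b)]
  simp only [crossingSign]
  linarith

/-- In the plane, a closed polygon and a triangle have intersection number zero. -/
theorem Generic.sum_crossingSign_triangle (hz : Generic v z) {N : ℕ} {A : ℕ → ι} {c d y : ι}
    (hA : A N = A 0) (hA' : ∀ i < N, A i ≠ A (i + 1)) (cd : c ≠ d) (cy : c ≠ y) (dy : d ≠ y)
    (hc : ∀ i, A i ≠ c) (hd : ∀ i, A i ≠ d) (hy : ∀ i, A i ≠ y) :
    ∑ i ∈ Finset.range N, crossingSign v (z (A i)) (z (A (i + 1))) (z c) (z d) =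
      ∑ i ∈ Finset.range N, crossingSign v (z (A i)) (z (A (i + 1))) (z c) (z y) -
        ∑ i ∈ Finset.range N, crossingSign v (z (A i)) (z (A (i + 1))) (z d) (z y) := by
  -- The triangle identity for one edge of `A` has the defect `f (i + 1) - f i`, which telescopes to
  -- zero around the closed polygon.
  set f : ℕ → ℤ := fun i => insideSign (orient v (z c) (z d) (z y)) (orient v (z d) (z y) (z (A i)))
          (orient v (z y) (z c) (z (A i))) (orient v (z c) (z d) (z (A i))) with hf
  have h1 : ∀ i ∈ Finset.range N, crossingSign v (z (A i)) (z (A (i + 1))) (z c) (z d) =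
      crossingSign v (z (A i)) (z (A (i + 1))) (z c) (z y) -
        crossingSign v (z (A i)) (z (A (i + 1))) (z d) (z y) - (f (i + 1) - f i) := fun i hi => by
    have := hz.crossingSign_triangle cd cy dy (hc i).symm (hc (i + 1)).symm (hd i).symm
      (hd (i + 1)).symm (hy i).symm (hy (i + 1)).symm (hA' i (Finset.mem_range.1 hi))
    rw [crossingSign_swap_right v _ _ (z c) (z y)] at this
    simp only [hf]
    linarith
  rw [Finset.sum_congr rfl h1, Finset.sum_sub_distrib, Finset.sum_sub_distrib, Finset.sum_range_sub,
    hf]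
  simp only [hA, sub_self, sub_zero]

/-- In the plane, the intersection number of a closed polygon with a path is the difference of the
winding numbers of the polygon around the endpoints of the path; these winding numbers are
counted along segments to `y`. -/
theorem Generic.sum_crossingSign_path (hz : Generic v z) {N M : ℕ} {A B : ℕ → ι} {y : ι}
    (hA : A N = A 0) (hA' : ∀ i < N, A i ≠ A (i + 1)) (hB' : ∀ i < M, B i ≠ B (i + 1))
    (hAB : ∀ i j, A i ≠ B j) (hyA : ∀ i, A i ≠ y) (hyB : ∀ i, B i ≠ y) :
    ∑ i ∈ Finset.range N, ∑ j ∈ Finset.range M,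
        crossingSign v (z (A i)) (z (A (i + 1))) (z (B j)) (z (B (j + 1))) =
      ∑ i ∈ Finset.range N, crossingSign v (z (A i)) (z (A (i + 1))) (z (B 0)) (z y) -
        ∑ i ∈ Finset.range N, crossingSign v (z (A i)) (z (A (i + 1))) (z (B M)) (z y) := by
  rw [Finset.sum_comm, ← Finset.sum_range_sub' (fun j =>
    ∑ i ∈ Finset.range N, crossingSign v (z (A i)) (z (A (i + 1))) (z (B j)) (z y))]
  exact Finset.sum_congr rfl fun j hj => hz.sum_crossingSign_triangle hA hA'
    (hB' j (Finset.mem_range.1 hj)) (hyB j) (hyB (j + 1)) (fun i => hAB i j)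
    (fun i => hAB i (j + 1)) hyA

end Generic

/-! ### Existence of generic perturbations -/

/-- The point with parameter `s` on the moment curve. -/
def momentPoint (s : ℝ) : Space := ![s, s ^ 2, s ^ 3]

/-- The third coordinate direction. -/
def vertical : Space := ![0, 0, 1]

theorem eventually_cubic_ne_zero (c₀ c₁ c₂ : ℝ) {c₃ : ℝ} (h : c₃ ≠ 0) :
    ∀ᶠ t in 𝓝[≠] (0 : ℝ), c₀ + c₁ * t + c₂ * t ^ 2 + c₃ * t ^ 3 ≠ 0 := by
  open Polynomial in
  set p : ℝ[X] := C c₀ + C c₁ * X + C c₂ * X ^ 2 + C c₃ * X ^ 3 with hp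
  have hp0 : p ≠ 0 := by
    intro h0
    apply h
    have := congrArg (fun q => Polynomial.coeff q 3) h0
    simpa [hp, Polynomial.coeff_X, Polynomial.coeff_C] using this
  have hfin : {t | p.IsRoot t}.Finite := Polynomial.finite_setOfPred_isRoot hp0
  refine nhdsNE_le_cofinite 0 ?_
  rw [mem_cofinite]
  refine hfin.subset fun t ht => ?_
  simpa [hp, Polynomial.IsRoot] using ht

/-- The determinant is a cubic polynomial in `t` with leading coefficient `det3 x' y' w'`, so it has
finitely many zeros. -/
theorem eventually_det3_ne_zero (x y w x' y' w' : Space) (h : det3 x' y' w' ≠ 0) :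
    ∀ᶠ t in 𝓝[≠] (0 : ℝ), det3 (x + t • x') (y + t • y') (w + t • w') ≠ 0 := by
  refine (eventually_cubic_ne_zero (det3 x y w) (det3 x' y w + det3 x y' w + det3 x y w')
    (det3 x y' w' + det3 x' y w' + det3 x' y' w) h).mono fun t ht => ?_
  convert ht using 1
  simp only [det3, Pi.add_apply, Pi.smul_apply, smul_eq_mul]
  ring

/-- A Vandermonde determinant, as is the volume below; neither vanishes for distinct parameters,
which makes the moment curve a suitable direction of perturbation. -/
theorem orient_momentPoint (a b c : ℝ) :
    orient vertical (momentPoint a) (momentPoint b) (momentPoint c) =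
      (b - a) * (c - a) * (c - b) := by
  simp [orient, det3, vertical, momentPoint]; ring

theorem vol_momentPoint (a b c d : ℝ) :
    vol (momentPoint a) (momentPoint b) (momentPoint c) (momentPoint d) =
      (b - a) * (c - a) * (c - b) * (d - a) * (d - b) * (d - c) := by
  simp [vol, det3, momentPoint]; ring

/-- There are finitely many genericity conditions, and each is the nonvanishing of a cubic in `t`
with Vandermonde leading coefficient. Since the direction is perturbed as well, `v` may be
arbitrary, even zero. -/
theorem eventually_generic {ι : Type*} [Finite ι] (v : Space) (z : ι → Space) {s : ι → ℝ}
    (hs : Function.Injective s) :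
    ∀ᶠ t in 𝓝[≠] (0 : ℝ), Generic (v + t • vertical) fun i => z i + t • momentPoint (s i) := by
  have sub_ne {i j : ι} (h : i ≠ j) : s j - s i ≠ 0 := sub_ne_zero.2 fun h' => h (hs h').symm
  have e (t : ℝ) (i j : ι) : z j + t • momentPoint (s j) - (z i + t • momentPoint (s i)) =
      (z j - z i) + t • (momentPoint (s j) - momentPoint (s i)) := by
    rw [smul_sub]; abel
  have h1 : ∀ᶠ t in 𝓝[≠] (0 : ℝ), ∀ i j k : ι, i ≠ j → i ≠ k → j ≠ k →
      orient (v + t • vertical) (z i + t • momentPoint (s i)) (z j + t • momentPoint (s j))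
        (z k + t • momentPoint (s k)) ≠ 0 := by
    simp only [eventually_all]
    intro i j k hij hik hjk
    simp only [orient, e]
    apply eventually_det3_ne_zero
    have := orient_momentPoint (s i) (s j) (s k)
    rw [orient] at this
    rw [this]
    exact mul_ne_zero (mul_ne_zero (sub_ne hij) (sub_ne hik)) (sub_ne hjk)
  have h2 : ∀ᶠ t in 𝓝[≠] (0 : ℝ), ∀ i j k l : ι, i ≠ j → i ≠ k → i ≠ l → j ≠ k → j ≠ l → k ≠ l →
      vol (z i + t • momentPoint (s i)) (z j + t • momentPoint (s j))
        (z k + t • momentPoint (s k)) (z l + t • momentPoint (s l)) ≠ 0 := by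
    simp only [eventually_all]
    intro i j k l hij hik hil hjk hjl hkl
    simp only [vol, e]
    apply eventually_det3_ne_zero
    have := vol_momentPoint (s i) (s j) (s k) (s l)
    rw [vol] at this
    rw [this]
    have := sub_ne hij; have := sub_ne hik; have := sub_ne hil
    have := sub_ne hjk; have := sub_ne hjl; have := sub_ne hkl
    positivity
  filter_upwards [h1, h2] with t a b using ⟨a, b⟩

/-! ### Stability of crossings -/

theorem exists_exit_square {s t κ μ : ℝ} (hs : s ∈ Ioo (0 : ℝ) 1) (ht : t ∈ Ioo (0 : ℝ) 1)
    (h : κ ≠ 0 ∨ μ ≠ 0) : ∃ u, s + u * κ ∈ Icc (0 : ℝ) 1 ∧ t + u * μ ∈ Icc (0 : ℝ) 1 ∧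
      (s + u * κ = 0 ∨ s + u * κ = 1 ∨ t + u * μ = 0 ∨ t + u * μ = 1) := by
  have key : ∀ {s t κ μ : ℝ}, s ∈ Ioo (0 : ℝ) 1 → t ∈ Ioo (0 : ℝ) 1 → κ ≠ 0 →
      ∃ u, s + u * κ ∈ Icc (0 : ℝ) 1 ∧ t + u * μ ∈ Icc (0 : ℝ) 1 ∧
      (s + u * κ = 0 ∨ s + u * κ = 1 ∨ t + u * μ = 0 ∨ t + u * μ = 1) := by
    intro s t κ μ hs ht hκ
    -- Move until the first coordinate reaches 1. If the second coordinate has left the unit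
    -- interval by then, scale the displacement by `θ` so as to stop where it hits 0 or 1.
    have e1 : s + (1 - s) / κ * κ = 1 := by field_simp; ring
    rcases lt_trichotomy (t + (1 - s) / κ * μ) 0 with h0 | h0 | h0
    · have hne : t - (t + (1 - s) / κ * μ) ≠ 0 := by linarith [ht.1]
      have hpos : 0 < t - (t + (1 - s) / κ * μ) := by linarith [ht.1]
      set θ := t / (t - (t + (1 - s) / κ * μ)) with hθ
      have hθ0 : 0 ≤ θ := div_nonneg ht.1.le hpos.le
      have hθ1 : θ ≤ 1 := (div_le_one hpos).2 (by linarith)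
      have e2 : t + θ * ((1 - s) / κ) * μ = 0 := by
        have : θ * (t - (t + (1 - s) / κ * μ)) = t := div_mul_cancel₀ _ hne
        linarith
      have e3 : s + θ * ((1 - s) / κ) * κ = s + θ * (1 - s) := by
        rw [mul_assoc, div_mul_cancel₀ _ hκ]
      refine ⟨θ * ((1 - s) / κ), ?_, by rw [e2]; simp, Or.inr (Or.inr (Or.inl e2))⟩
      rw [e3]
      constructor <;> nlinarith [hs.1, hs.2]
    · exact ⟨(1 - s) / κ, by rw [e1]; simp, by rw [h0]; simp, Or.inr (Or.inl e1)⟩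
    · by_cases h1 : t + (1 - s) / κ * μ ≤ 1
      · exact ⟨(1 - s) / κ, by rw [e1]; simp, ⟨h0.le, h1⟩, Or.inr (Or.inl e1)⟩
      · rw [not_le] at h1
        have hne : (t + (1 - s) / κ * μ) - t ≠ 0 := by linarith [ht.2]
        have hpos : 0 < (t + (1 - s) / κ * μ) - t := by linarith [ht.2]
        set θ := (1 - t) / ((t + (1 - s) / κ * μ) - t) with hθ
        have hθ0 : 0 ≤ θ := div_nonneg (by linarith [ht.2]) hpos.le
        have hθ1 : θ ≤ 1 := (div_le_one hpos).2 (by linarith)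
        have e2 : t + θ * ((1 - s) / κ) * μ = 1 := by
          have : θ * ((t + (1 - s) / κ * μ) - t) = 1 - t := div_mul_cancel₀ _ hne
          linarith
        have e3 : s + θ * ((1 - s) / κ) * κ = s + θ * (1 - s) := by
          rw [mul_assoc, div_mul_cancel₀ _ hκ]
        refine ⟨θ * ((1 - s) / κ), ?_, by rw [e2]; simp, Or.inr (Or.inr (Or.inr e2))⟩
        rw [e3]
        constructor <;> nlinarith [hs.1, hs.2]
  rcases h with h | h
  · exact key hs ht h
  · obtain ⟨u, h1, h2, h3⟩ := key (μ := κ) ht hs h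
    exact ⟨u, h2, h1, by tauto⟩

/-- If two parallel segments overlap in the projection, an endpoint of one of them lies over the
other. -/
theorem exists_vertex_over_edge {v a b c d : Space} {s t h : ℝ} (hv : v ≠ 0)
    (hΔ : det3 (b - a) (d - c) v = 0) (hs : s ∈ Ioo (0 : ℝ) 1) (ht : t ∈ Ioo (0 : ℝ) 1)
    (e : AffineMap.lineMap a b s = AffineMap.lineMap c d t + h • v) :
    ∃ r ∈ Icc (0 : ℝ) 1, ∃ k : ℝ,
      a = AffineMap.lineMap c d r + k • v ∨ b = AffineMap.lineMap c d r + k • v ∨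
      c = AffineMap.lineMap a b r + k • v ∨ d = AffineMap.lineMap a b r + k • v := by
  rw [← det_of_eq_det3] at hΔ
  -- A linear relation between `b - a`, `d - c` and `v` lets the two parameters slide together while
  -- the points stay aligned along `v`; since `v ≠ 0` the motion is not trivial, and it is continued
  -- until an endpoint is reached.
  obtain ⟨w, hw0, hw⟩ := Matrix.exists_vecMul_eq_zero_iff.2 hΔ
  have hw' (i : Fin 3) : w 0 * (b i - a i) + w 1 * (d i - c i) + w 2 * v i = 0 := by
    have := congrFun hw i
    simpa [Matrix.vecMul, dotProduct, Fin.sum_univ_three] using this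
  have hne : w 0 ≠ 0 ∨ -w 1 ≠ 0 := by
    by_contra! hcon
    have h1 : w 1 = 0 := neg_eq_zero.1 hcon.2
    have h2 : w 2 ≠ 0 := fun h2 => hw0 (by
      ext i; fin_cases i <;> simp [hcon.1, h1, h2])
    apply hv
    ext i
    have := hw' i
    rw [hcon.1, h1] at this
    simpa [h2] using this
  obtain ⟨u, h1, h2, h3⟩ := exists_exit_square hs ht hne
  have key : (AffineMap.lineMap a b (s + u * w 0) : Space) =
      AffineMap.lineMap c d (t + u * -w 1) + (h - u * w 2) • v := by
    ext i
    have e1 := coord_of_crossing e i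
    have e2 := hw' i
    simp only [AffineMap.lineMap_apply, vsub_eq_sub, vadd_eq_add, Pi.add_apply, Pi.smul_apply,
      Pi.sub_apply, smul_eq_mul]
    linear_combination e1 + u * e2
  have key' : (AffineMap.lineMap c d (t + u * -w 1) : Space) =
      AffineMap.lineMap a b (s + u * w 0) + (-(h - u * w 2)) • v := by
    rw [key, neg_smul]; abel
  rcases h3 with h3 | h3 | h3 | h3
  · rw [h3, AffineMap.lineMap_apply_zero] at key
    exact ⟨_, h2, _, Or.inl key⟩
  · rw [h3, AffineMap.lineMap_apply_one] at key
    exact ⟨_, h2, _, Or.inr (Or.inl key)⟩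
  · rw [h3, AffineMap.lineMap_apply_zero] at key'
    exact ⟨_, h1, _, Or.inr (Or.inr (Or.inl key'))⟩
  · rw [h3, AffineMap.lineMap_apply_one] at key'
    exact ⟨_, h1, _, Or.inr (Or.inr (Or.inr key'))⟩

theorem eq_smul_of_cross_eq_zero {w v : Space} (hv : v ≠ 0) (h01 : w 0 * v 1 - w 1 * v 0 = 0)
    (h12 : w 1 * v 2 - w 2 * v 1 = 0) (h02 : w 0 * v 2 - w 2 * v 0 = 0) :
    w = ((w ⬝ᵥ v) / (v ⬝ᵥ v)) • v := by
  have hvv : v ⬝ᵥ v ≠ 0 := fun h => hv (dotProduct_self_eq_zero.1 h)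
  ext i
  rw [Pi.smul_apply, smul_eq_mul]
  field_simp
  simp only [dotProduct, Fin.sum_univ_three]
  fin_cases i <;> simp only [Fin.zero_eta, Fin.mk_one, Fin.reduceFinMk]
  · linear_combination v 1 * h01 + v 2 * h02
  · linear_combination -v 0 * h01 + v 2 * h12
  · linear_combination -v 1 * h12 - v 0 * h02

section Stability

variable {X : Type*} [TopologicalSpace X] {x₀ : X}

/-- Some 2 × 2 minor of `w` and `v` is nonzero at `x₀`; this open condition excludes all the
unboundedly many `k` at once. -/
theorem eventually_ne_smul {w v : X → Space} (hw : ContinuousAt w x₀) (hv : ContinuousAt v x₀)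
    (hv0 : v x₀ ≠ 0) (h : ∀ k : ℝ, w x₀ ≠ k • v x₀) :
    ∀ᶠ x in 𝓝 x₀, ∀ k : ℝ, w x ≠ k • v x := by
  have cw (i : Fin 3) : ContinuousAt (fun x => w x i) x₀ := (continuous_apply i).continuousAt.comp hw
  have cv (i : Fin 3) : ContinuousAt (fun x => v x i) x₀ := (continuous_apply i).continuousAt.comp hv
  have c (i j : Fin 3) : ContinuousAt (fun x => w x i * v x j - w x j * v x i) x₀ :=
    ((cw i).mul (cv j)).sub ((cw j).mul (cv i))
  have main : ∃ i j : Fin 3, w x₀ i * v x₀ j - w x₀ j * v x₀ i ≠ 0 := by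
    by_contra! hcon
    exact h _ (eq_smul_of_cross_eq_zero hv0 (hcon 0 1) (hcon 1 2) (hcon 0 2))
  obtain ⟨i, j, hij⟩ := main
  filter_upwards [(c i j).eventually_ne hij] with x hx k hk
  apply hx
  rw [hk]
  simp only [Pi.smul_apply, smul_eq_mul]
  ring

/-- If the vectors are proportional at `x₀`, the factor is negative, and the open condition is that
their dot product is negative. -/
theorem eventually_ne_nonneg_smul {w v : X → Space} (hw : ContinuousAt w x₀)
    (hv : ContinuousAt v x₀) (hv0 : v x₀ ≠ 0) (h : ∀ k : ℝ, 0 ≤ k → w x₀ ≠ k • v x₀) :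
    ∀ᶠ x in 𝓝 x₀, ∀ k : ℝ, 0 ≤ k → w x ≠ k • v x := by
  by_cases hl : ∀ k : ℝ, w x₀ ≠ k • v x₀
  · exact (eventually_ne_smul hw hv hv0 hl).mono fun x hx k _ => hx k
  · push Not at hl
    obtain ⟨k, hk⟩ := hl
    have hk0 : k < 0 := by
      by_contra hk0
      exact h k (not_lt.1 hk0) hk
    have hvv : 0 < v x₀ ⬝ᵥ v x₀ :=
      lt_of_le_of_ne (Finset.sum_nonneg fun i _ => mul_self_nonneg _)
        (fun h => hv0 (dotProduct_self_eq_zero.1 h.symm))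
    have hneg : w x₀ ⬝ᵥ v x₀ < 0 := by
      rw [hk, smul_dotProduct, smul_eq_mul]
      exact mul_neg_of_neg_of_pos hk0 hvv
    have c : ContinuousAt (fun x => w x ⬝ᵥ v x) x₀ := by
      simp only [dotProduct]
      exact tendsto_finsetSum _ fun i _ => ((continuous_apply i).continuousAt.comp hw).mul
        ((continuous_apply i).continuousAt.comp hv)
    filter_upwards [c.eventually_lt continuousAt_const hneg] with x hx k hk0 hk
    rw [hk, smul_dotProduct, smul_eq_mul] at hx
    exact hx.not_ge (mul_nonneg hk0 (Finset.sum_nonneg fun i _ => mul_self_nonneg _))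

theorem continuousAt_lineMap_prod {a b : X → Space} (ha : ContinuousAt a x₀)
    (hb : ContinuousAt b x₀) (s : ℝ) :
    ContinuousAt (fun p : X × ℝ => (AffineMap.lineMap (a p.1) (b p.1) p.2 : Space)) (x₀, s) := by
  have ha' : ContinuousAt (fun p : X × ℝ => a p.1) (x₀, s) := ha.comp continuousAt_fst
  have hb' : ContinuousAt (fun p : X × ℝ => b p.1) (x₀, s) := hb.comp continuousAt_fst
  simp only [AffineMap.lineMap_apply, vsub_eq_sub, vadd_eq_add]
  exact (continuousAt_snd.smul (hb'.sub ha')).add ha'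

theorem continuousAt_lineMap_sub_lineMap {a b c d : X → Space} (ha : ContinuousAt a x₀)
    (hb : ContinuousAt b x₀) (hc : ContinuousAt c x₀) (hd : ContinuousAt d x₀) (y : ℝ × ℝ) :
    ContinuousAt (fun p : X × ℝ × ℝ => (AffineMap.lineMap (a p.1) (b p.1) p.2.1 : Space) -
      AffineMap.lineMap (c p.1) (d p.1) p.2.2) (x₀, y) := by
  have h1 : ContinuousAt (fun p : X × ℝ × ℝ => (p.1, p.2.1)) (x₀, y) := by fun_prop
  have h2 : ContinuousAt (fun p : X × ℝ × ℝ => (p.1, p.2.2)) (x₀, y) := by fun_prop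
  exact (ContinuousAt.comp (f := fun p : X × ℝ × ℝ => (p.1, p.2.1)) (x := (x₀, y))
      (continuousAt_lineMap_prod ha hb y.1) h1).sub
    (ContinuousAt.comp (f := fun p : X × ℝ × ℝ => (p.1, p.2.2)) (x := (x₀, y))
      (continuousAt_lineMap_prod hc hd y.2) h2)

theorem eventually_segments_disjoint {a b c d : X → Space} (ha : ContinuousAt a x₀)
    (hb : ContinuousAt b x₀) (hc : ContinuousAt c x₀) (hd : ContinuousAt d x₀)
    (h : ∀ s ∈ Icc (0 : ℝ) 1, ∀ t ∈ Icc (0 : ℝ) 1,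
      (AffineMap.lineMap (a x₀) (b x₀) s : Space) ≠ AffineMap.lineMap (c x₀) (d x₀) t) :
    ∀ᶠ x in 𝓝 x₀, ∀ s ∈ Icc (0 : ℝ) 1, ∀ t ∈ Icc (0 : ℝ) 1,
      (AffineMap.lineMap (a x) (b x) s : Space) ≠ AffineMap.lineMap (c x) (d x) t := by
  have := (isCompact_Icc.prod isCompact_Icc).eventually_forall_of_forall_eventually (x₀ := x₀)
    (K := Icc (0 : ℝ) 1 ×ˢ Icc (0 : ℝ) 1)
    (P := fun x y => (AffineMap.lineMap (a x) (b x) y.1 : Space) -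
      AffineMap.lineMap (c x) (d x) y.2 ≠ 0) (fun y hy =>
        (continuousAt_lineMap_sub_lineMap ha hb hc hd y).eventually_ne
          (sub_ne_zero.2 (h _ hy.1 _ hy.2)))
  exact this.mono fun x hx s hs t ht => sub_ne_zero.1 (hx (s, t) ⟨hs, ht⟩)

theorem eventually_vertex_not_over_edge {a c d v : X → Space} (ha : ContinuousAt a x₀)
    (hc : ContinuousAt c x₀) (hd : ContinuousAt d x₀) (hv : ContinuousAt v x₀) (hv0 : v x₀ ≠ 0)
    (h : ∀ t ∈ Icc (0 : ℝ) 1, ∀ k : ℝ, a x₀ ≠ AffineMap.lineMap (c x₀) (d x₀) t + k • v x₀) :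
    ∀ᶠ x in 𝓝 x₀, ∀ t ∈ Icc (0 : ℝ) 1, ∀ k : ℝ,
      a x ≠ AffineMap.lineMap (c x) (d x) t + k • v x := by
  have := isCompact_Icc.eventually_forall_of_forall_eventually (x₀ := x₀)
    (K := Icc (0 : ℝ) 1)
    (P := fun x t => ∀ k : ℝ, a x - AffineMap.lineMap (c x) (d x) t ≠ k • v x) (fun t ht => by
      refine eventually_ne_smul (w := fun p : X × ℝ =>
        a p.1 - AffineMap.lineMap (c p.1) (d p.1) p.2) (v := fun p : X × ℝ => v p.1)
        (x₀ := (x₀, t)) ?_ ?_ hv0 ?_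
      · exact (ha.comp (f := Prod.fst) (x := (x₀, t)) continuousAt_fst).sub
          (continuousAt_lineMap_prod hc hd t)
      · exact hv.comp (f := Prod.fst) (x := (x₀, t)) continuousAt_fst
      · intro k hk
        exact h t ht k (by rw [← hk]; abel))
  exact this.mono fun x hx t ht k hk => hx t ht k (by rw [hk]; abel)

theorem continuousAt_det3 {x y w : X → Space} (hx : ContinuousAt x x₀) (hy : ContinuousAt y x₀)
    (hw : ContinuousAt w x₀) : ContinuousAt (fun p => det3 (x p) (y p) (w p)) x₀ := by
  have cx (i : Fin 3) : ContinuousAt (fun p => x p i) x₀ := (continuous_apply i).continuousAt.comp hx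
  have cy (i : Fin 3) : ContinuousAt (fun p => y p i) x₀ := (continuous_apply i).continuousAt.comp hy
  have cw (i : Fin 3) : ContinuousAt (fun p => w p i) x₀ := (continuous_apply i).continuousAt.comp hw
  unfold det3
  exact (((cx 0).mul (((cy 1).mul (cw 2)).sub ((cy 2).mul (cw 1)))).sub
    ((cx 1).mul (((cy 0).mul (cw 2)).sub ((cy 2).mul (cw 0))))).add
    ((cx 2).mul (((cy 0).mul (cw 1)).sub ((cy 1).mul (cw 0))))

/-- The overcrossing sign is locally constant as long as the segments are disjoint and no endpoint
of one of them projects to the other. -/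
theorem eventually_overcrossingSign_eq {a b c d v : X → Space} (ha : ContinuousAt a x₀)
    (hb : ContinuousAt b x₀) (hc : ContinuousAt c x₀) (hd : ContinuousAt d x₀)
    (hv : ContinuousAt v x₀) (hv0 : v x₀ ≠ 0)
    (hdisj : ∀ s ∈ Icc (0 : ℝ) 1, ∀ t ∈ Icc (0 : ℝ) 1,
      (AffineMap.lineMap (a x₀) (b x₀) s : Space) ≠ AffineMap.lineMap (c x₀) (d x₀) t)
    (ra : ∀ t ∈ Icc (0 : ℝ) 1, ∀ k : ℝ, a x₀ ≠ AffineMap.lineMap (c x₀) (d x₀) t + k • v x₀)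
    (rb : ∀ t ∈ Icc (0 : ℝ) 1, ∀ k : ℝ, b x₀ ≠ AffineMap.lineMap (c x₀) (d x₀) t + k • v x₀)
    (rc : ∀ t ∈ Icc (0 : ℝ) 1, ∀ k : ℝ, c x₀ ≠ AffineMap.lineMap (a x₀) (b x₀) t + k • v x₀)
    (rd : ∀ t ∈ Icc (0 : ℝ) 1, ∀ k : ℝ, d x₀ ≠ AffineMap.lineMap (a x₀) (b x₀) t + k • v x₀) :
    ∀ᶠ x in 𝓝 x₀, overcrossingSign (v x) (a x) (b x) (c x) (d x) =
      overcrossingSign (v x₀) (a x₀) (b x₀) (c x₀) (d x₀) := by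
  have o1 : ContinuousAt (fun x => orient (v x) (a x) (b x) (c x)) x₀ :=
    continuousAt_det3 (hb.sub ha) (hc.sub ha) hv
  have o2 : ContinuousAt (fun x => orient (v x) (a x) (b x) (d x)) x₀ :=
    continuousAt_det3 (hb.sub ha) (hd.sub ha) hv
  have o3 : ContinuousAt (fun x => orient (v x) (c x) (d x) (a x)) x₀ :=
    continuousAt_det3 (hd.sub hc) (ha.sub hc) hv
  have o4 : ContinuousAt (fun x => orient (v x) (c x) (d x) (b x)) x₀ :=
    continuousAt_det3 (hd.sub hc) (hb.sub hc) hv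
  have o5 : ContinuousAt (fun x => vol (a x) (b x) (c x) (d x)) x₀ :=
    continuousAt_det3 (hb.sub ha) (hc.sub ha) (hd.sub ha)
  have k0 : ContinuousAt (fun _ : X => (0 : ℝ)) x₀ := continuousAt_const
  -- A nonzero sign is given by five strict inequalities between continuous functions. The value 0
  -- needs the separate argument below, since a determinant may vanish there.
  by_cases hpos : orient (v x₀) (a x₀) (b x₀) (c x₀) < 0 ∧ 0 < orient (v x₀) (a x₀) (b x₀) (d x₀) ∧
      0 < orient (v x₀) (c x₀) (d x₀) (a x₀) ∧ orient (v x₀) (c x₀) (d x₀) (b x₀) < 0 ∧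
        0 < vol (a x₀) (b x₀) (c x₀) (d x₀)
  · filter_upwards [o1.eventually_lt k0 hpos.1, k0.eventually_lt o2 hpos.2.1,
      k0.eventually_lt o3 hpos.2.2.1, o4.eventually_lt k0 hpos.2.2.2.1,
      k0.eventually_lt o5 hpos.2.2.2.2] with x h1 h2 h3 h4 h5
    rw [overcrossingSign_eq, overcrossingSign_eq, if_pos hpos, if_pos ⟨h1, h2, h3, h4, h5⟩]
  by_cases hneg : 0 < orient (v x₀) (a x₀) (b x₀) (c x₀) ∧ orient (v x₀) (a x₀) (b x₀) (d x₀) < 0 ∧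
      orient (v x₀) (c x₀) (d x₀) (a x₀) < 0 ∧ 0 < orient (v x₀) (c x₀) (d x₀) (b x₀) ∧
        vol (a x₀) (b x₀) (c x₀) (d x₀) < 0
  · filter_upwards [k0.eventually_lt o1 hneg.1, o2.eventually_lt k0 hneg.2.1,
      o3.eventually_lt k0 hneg.2.2.1, k0.eventually_lt o4 hneg.2.2.2.1,
      o5.eventually_lt k0 hneg.2.2.2.2] with x h1 h2 h3 h4 h5
    rw [overcrossingSign_eq, overcrossingSign_eq, if_neg hpos, if_pos hneg,
      if_neg (fun k => h1.not_gt k.1), if_pos ⟨h1, h2, h3, h4, h5⟩]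
  have hzero : overcrossingSign (v x₀) (a x₀) (b x₀) (c x₀) (d x₀) = 0 := by
    rw [overcrossingSign_eq, if_neg hpos, if_neg hneg]
  -- No point of the first closed segment lies on or above the second one: height 0 contradicts
  -- disjointness, endpoints contradict regularity, and an interior overcrossing with sign 0 would
  -- be parallel, which again puts an endpoint over a segment. By compactness this persists near
  -- `x₀`.
  have noray : ∀ y ∈ Icc (0 : ℝ) 1 ×ˢ Icc (0 : ℝ) 1, ∀ k : ℝ, 0 ≤ k →
      (AffineMap.lineMap (a x₀) (b x₀) y.1 : Space) - AffineMap.lineMap (c x₀) (d x₀) y.2 ≠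
        k • v x₀ := by
    rintro ⟨s, t⟩ ⟨hs, ht⟩ k hk e
    simp only at e hs ht
    have e' := sub_eq_iff_eq_add'.1 e
    have e'' : (AffineMap.lineMap (c x₀) (d x₀) t : Space) =
        AffineMap.lineMap (a x₀) (b x₀) s + (-k) • v x₀ := by rw [e', neg_smul]; abel
    rcases hk.eq_or_lt with rfl | hk
    · exact hdisj s hs t ht (by simpa using e')
    rcases hs.1.eq_or_lt with rfl | hs0
    · exact ra t ht k (by simpa using e')
    rcases hs.2.eq_or_lt with rfl | hs1
    · exact rb t ht k (by simpa using e')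
    rcases ht.1.eq_or_lt with rfl | ht0
    · exact rc s hs (-k) (by simpa using e'')
    rcases ht.2.eq_or_lt with rfl | ht1
    · exact rd s hs (-k) (by simpa using e'')
    unfold overcrossingSign at hzero
    rw [if_pos ⟨s, ⟨hs0, hs1⟩, t, ⟨ht0, ht1⟩, k, hk, e'⟩, det_of_eq_det3] at hzero
    have hΔ : det3 (b x₀ - a x₀) (d x₀ - c x₀) (v x₀) = 0 := by
      rcases lt_trichotomy (det3 (b x₀ - a x₀) (d x₀ - c x₀) (v x₀)) 0 with h | h | h
      · rw [sign_neg h] at hzero; simp at hzero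
      · exact h
      · rw [sign_pos h] at hzero; simp at hzero
    obtain ⟨r, hr, k, h | h | h | h⟩ := exists_vertex_over_edge hv0 hΔ ⟨hs0, hs1⟩ ⟨ht0, ht1⟩ e'
    exacts [ra r hr k h, rb r hr k h, rc r hr k h, rd r hr k h]
  have := (isCompact_Icc.prod isCompact_Icc).eventually_forall_of_forall_eventually (x₀ := x₀)
    (K := Icc (0 : ℝ) 1 ×ˢ Icc (0 : ℝ) 1)
    (P := fun x y => ∀ k : ℝ, 0 ≤ k → (AffineMap.lineMap (a x) (b x) y.1 : Space) -
      AffineMap.lineMap (c x) (d x) y.2 ≠ k • v x) (fun y hy =>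
        eventually_ne_nonneg_smul (v := fun p : X × ℝ × ℝ => v p.1)
          (continuousAt_lineMap_sub_lineMap ha hb hc hd y)
          (hv.comp (f := Prod.fst) (x := (x₀, y)) continuousAt_fst) hv0 (noray y hy))
  filter_upwards [this] with x hx
  rw [hzero]
  unfold overcrossingSign
  rw [if_neg]
  rintro ⟨s, hs, t, ht, h, hh, e⟩
  exact hx (s, t) ⟨Ioo_subset_Icc_self hs, Ioo_subset_Icc_self ht⟩ h hh.le
    (by simp only [e]; abel)

end Stability

/-! ### Linking numbers of polygons -/

/-- The closed polygons `P` and `Q` with `N` edges each are disjoint. -/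
def PolygonsDisjoint (N : ℕ) (P Q : ℕ → Space) : Prop :=
  ∀ i < N, ∀ j < N, ∀ s ∈ Icc (0 : ℝ) 1, ∀ t ∈ Icc (0 : ℝ) 1,
    (AffineMap.lineMap (P i) (P (i + 1)) s : Space) ≠ AffineMap.lineMap (Q j) (Q (j + 1)) t

section congr

variable {N : ℕ} {P P' Q Q' : ℕ → Space} {v : Space}

theorem PolygonsDisjoint.congr (hP : ∀ i ≤ N, P i = P' i) (hQ : ∀ i ≤ N, Q i = Q' i)
    (h : PolygonsDisjoint N P Q) : PolygonsDisjoint N P' Q' := by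
  intro i hi j hj
  rw [← hP i hi.le, ← hP (i + 1) hi, ← hQ j hj.le, ← hQ (j + 1) hj]
  exact h i hi j hj

theorem IsRegularDirection.congr (hP : ∀ i ≤ N, P i = P' i) (hQ : ∀ i ≤ N, Q i = Q' i)
    (h : IsRegularDirection N P Q v) : IsRegularDirection N P' Q' v := by
  refine ⟨h.1, fun i hi j hj => ?_⟩
  rw [← hP i hi.le, ← hP j hj.le, ← hP (j + 1) hj, ← hQ i hi.le, ← hQ j hj.le, ← hQ (j + 1) hj]
  exact h.2 i hi j hj

theorem overcrossingCount_congr (hP : ∀ i ≤ N, P i = P' i) (hQ : ∀ i ≤ N, Q i = Q' i) :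
    overcrossingCount N P Q v = overcrossingCount N P' Q' v := by
  refine Finset.sum_congr rfl fun i hi => Finset.sum_congr rfl fun j hj => ?_
  have hi := Finset.mem_range.1 hi
  have hj := Finset.mem_range.1 hj
  rw [hP i hi.le, hP (i + 1) hi, hQ j hj.le, hQ (j + 1) hj]

end congr

theorem IsRegularDirection.not_over_of_le {N : ℕ} {P Q : ℕ → Space} {v : Space}
    (h : IsRegularDirection N P Q v) (hP : P N = P 0) (hQ : Q N = Q 0) {i j : ℕ} (hi : i ≤ N)
    (hj : j < N) : ∀ t ∈ Icc (0 : ℝ) 1, ∀ k : ℝ,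
      P i ≠ AffineMap.lineMap (Q j) (Q (j + 1)) t + k • v ∧
      Q i ≠ AffineMap.lineMap (P j) (P (j + 1)) t + k • v := by
  rcases hi.eq_or_lt with rfl | hi
  · rw [hP, hQ]; exact h.2 0 (by omega) j hj
  · exact h.2 i hi j hj

section Stability

variable {X : Type*} [TopologicalSpace X] {x₀ : X} {N : ℕ} {P Q : X → ℕ → Space} {v : X → Space}

theorem eventually_polygonsDisjoint (hP : ∀ i, ContinuousAt (fun x => P x i) x₀)
    (hQ : ∀ i, ContinuousAt (fun x => Q x i) x₀) (h : PolygonsDisjoint N (P x₀) (Q x₀)) :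
    ∀ᶠ x in 𝓝 x₀, PolygonsDisjoint N (P x) (Q x) := by
  have : ∀ᶠ x in 𝓝 x₀, ∀ i ∈ Finset.range N, ∀ j ∈ Finset.range N, ∀ s ∈ Icc (0 : ℝ) 1,
      ∀ t ∈ Icc (0 : ℝ) 1, (AffineMap.lineMap (P x i) (P x (i + 1)) s : Space) ≠
        AffineMap.lineMap (Q x j) (Q x (j + 1)) t := by
    rw [Filter.eventually_all_finset]
    intro i hi
    rw [Filter.eventually_all_finset]
    intro j hj
    exact eventually_segments_disjoint (hP i) (hP (i + 1)) (hQ j) (hQ (j + 1))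
      (h i (Finset.mem_range.1 hi) j (Finset.mem_range.1 hj))
  exact this.mono fun x hx i hi j hj => hx i (Finset.mem_range.2 hi) j (Finset.mem_range.2 hj)

theorem eventually_isRegularDirection (hP : ∀ i, ContinuousAt (fun x => P x i) x₀)
    (hQ : ∀ i, ContinuousAt (fun x => Q x i) x₀) (hv : ContinuousAt v x₀)
    (h : IsRegularDirection N (P x₀) (Q x₀) (v x₀)) :
    ∀ᶠ x in 𝓝 x₀, IsRegularDirection N (P x) (Q x) (v x) := by
  have : ∀ᶠ x in 𝓝 x₀, ∀ i ∈ Finset.range N, ∀ j ∈ Finset.range N,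
      (∀ t ∈ Icc (0 : ℝ) 1, ∀ k : ℝ,
        P x i ≠ AffineMap.lineMap (Q x j) (Q x (j + 1)) t + k • v x) ∧
      (∀ t ∈ Icc (0 : ℝ) 1, ∀ k : ℝ,
        Q x i ≠ AffineMap.lineMap (P x j) (P x (j + 1)) t + k • v x) := by
    rw [Filter.eventually_all_finset]
    intro i hi
    rw [Filter.eventually_all_finset]
    intro j hj
    have h' := h.2 i (Finset.mem_range.1 hi) j (Finset.mem_range.1 hj)
    exact (eventually_vertex_not_over_edge (hP i) (hQ j) (hQ (j + 1)) hv h.1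
      fun t ht k => (h' t ht k).1).and (eventually_vertex_not_over_edge (hQ i) (hP j) (hP (j + 1))
        hv h.1 fun t ht k => (h' t ht k).2)
  filter_upwards [this, hv.eventually_ne h.1] with x hx hx0
  refine ⟨hx0, fun i hi j hj t ht k => ?_⟩
  have := hx i (Finset.mem_range.2 hi) j (Finset.mem_range.2 hj)
  exact ⟨this.1 t ht k, this.2 t ht k⟩

theorem eventually_overcrossingCount_eq (hP : ∀ i, ContinuousAt (fun x => P x i) x₀)
    (hQ : ∀ i, ContinuousAt (fun x => Q x i) x₀) (hv : ContinuousAt v x₀)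
    (hPc : P x₀ N = P x₀ 0) (hQc : Q x₀ N = Q x₀ 0)
    (hdisj : PolygonsDisjoint N (P x₀) (Q x₀))
    (h : IsRegularDirection N (P x₀) (Q x₀) (v x₀)) :
    ∀ᶠ x in 𝓝 x₀, overcrossingCount N (P x) (Q x) (v x) =
      overcrossingCount N (P x₀) (Q x₀) (v x₀) := by
  have : ∀ᶠ x in 𝓝 x₀, ∀ i ∈ Finset.range N, ∀ j ∈ Finset.range N,
      overcrossingSign (v x) (P x i) (P x (i + 1)) (Q x j) (Q x (j + 1)) =
        overcrossingSign (v x₀) (P x₀ i) (P x₀ (i + 1)) (Q x₀ j) (Q x₀ (j + 1)) := by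
    rw [Filter.eventually_all_finset]
    intro i hi
    rw [Filter.eventually_all_finset]
    intro j hj
    have hi := Finset.mem_range.1 hi
    have hj := Finset.mem_range.1 hj
    exact eventually_overcrossingSign_eq (hP i) (hP (i + 1)) (hQ j) (hQ (j + 1)) hv h.1
      (hdisj i hi j hj)
      (fun t ht k => (h.not_over_of_le hPc hQc hi.le hj t ht k).1)
      (fun t ht k => (h.not_over_of_le hPc hQc (Nat.succ_le_of_lt hi) hj t ht k).1)
      (fun t ht k => (h.not_over_of_le hPc hQc hj.le hi t ht k).2)
      (fun t ht k => (h.not_over_of_le hPc hQc (Nat.succ_le_of_lt hj) hi t ht k).2)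
  filter_upwards [this] with x hx
  exact Finset.sum_congr rfl fun i hi => Finset.sum_congr rfl fun j hj => hx i hi j hj

end Stability

/-- For disjoint polygons a nonzero irregular direction lies in the span of a vertex minus the two
ends of an edge. These are finitely many proper subspaces, which do not cover the space. -/
theorem exists_isRegularDirection {N : ℕ} {P Q : ℕ → Space} (hN : 0 < N)
    (hdisj : PolygonsDisjoint N P Q) : ∃ v, IsRegularDirection N P Q v := by
  classical
  let S : Finset (Subspace ℝ Space) :=
    (Finset.range N ×ˢ Finset.range N).image
        (fun x => Submodule.span ℝ {P x.1 - Q x.2, P x.1 - Q (x.2 + 1)}) ∪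
      (Finset.range N ×ˢ Finset.range N).image
        (fun x => Submodule.span ℝ {Q x.1 - P x.2, Q x.1 - P (x.2 + 1)})
  have small (x y : Space) : Submodule.span ℝ {x, y} ≠ ⊤ := by
    intro h
    have h1 : Module.finrank ℝ (Submodule.span ℝ ({x, y} : Set Space)) ≤ 2 := by
      have := finrank_span_finset_le_card (R := ℝ) ({x, y} : Finset Space)
      refine le_trans (le_of_eq ?_) (this.trans Finset.card_le_two)
      rw [Set.finrank, Finset.coe_pair]
    rw [h, finrank_top] at h1
    simp at h1
  have hS : ⊤ ∉ S := by
    simp only [S, Finset.mem_union, Finset.mem_image, not_or, not_exists, not_and]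
    exact ⟨fun x _ => small _ _, fun x _ => small _ _⟩
  obtain ⟨v, hv⟩ := (Set.ne_univ_iff_exists_notMem _).1 (Subspace.biUnion_ne_univ_of_top_notMem hS)
  simp only [Set.mem_iUnion, not_exists] at hv
  have hv1 : ∀ i < N, ∀ j < N, v ∉ Submodule.span ℝ {P i - Q j, P i - Q (j + 1)} :=
    fun i hi j hj => hv _ (Finset.mem_union_left _ (Finset.mem_image.2
      ⟨(i, j), by simp [hi, hj], rfl⟩))
  have hv2 : ∀ i < N, ∀ j < N, v ∉ Submodule.span ℝ {Q i - P j, Q i - P (j + 1)} :=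
    fun i hi j hj => hv _ (Finset.mem_union_right _ (Finset.mem_image.2
      ⟨(i, j), by simp [hi, hj], rfl⟩))
  have key : ∀ {a c d : Space} {t k : ℝ}, v ∉ Submodule.span ℝ {a - c, a - d} →
      a ≠ AffineMap.lineMap c d t → a ≠ AffineMap.lineMap c d t + k • v := by
    intro a c d t k hv hne h
    have hk : k ≠ 0 := fun hk => hne (by rw [h, hk]; simp)
    apply hv
    have h1 : v = k⁻¹ • ((1 - t) • (a - c) + t • (a - d)) := by
      rw [eq_inv_smul_iff₀ hk]
      have : k • v = a - AffineMap.lineMap c d t := by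
        nth_rewrite 1 [h]; abel
      rw [this, AffineMap.lineMap_apply_module]
      module
    rw [h1]
    refine Submodule.smul_mem _ _ (Submodule.add_mem _ (Submodule.smul_mem _ _ ?_)
      (Submodule.smul_mem _ _ ?_)) <;> exact Submodule.subset_span (by simp)
  refine ⟨v, ?_, fun i hi j hj t ht k => ⟨key (hv1 i hi j hj) ?_, key (hv2 i hi j hj) ?_⟩⟩
  · rintro rfl
    exact hv1 0 hN 0 hN (Submodule.zero_mem _)
  · have := hdisj i hi j hj 0 (by simp) t ht
    rwa [AffineMap.lineMap_apply_zero] at this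
  · have := hdisj j hj i hi t ht 0 (by simp)
    rw [AffineMap.lineMap_apply_zero] at this
    exact this.symm

/-- The overcrossing count does not depend on the regular direction. -/
theorem overcrossingCount_eq_of_isRegularDirection {N : ℕ} {P Q : ℕ → Space} {v w : Space}
    (hN : 2 ≤ N) (hP : P N = P 0) (hQ : Q N = Q 0) (hdisj : PolygonsDisjoint N P Q)
    (hv : IsRegularDirection N P Q v) (hw : IsRegularDirection N P Q w) :
    overcrossingCount N P Q v = overcrossingCount N P Q w := by
  have hN0 : 0 < N := by omega
  -- The extra index `none` is the apex of the cone; its position before the perturbation is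
  -- irrelevant.
  let ι := Option (Fin N ⊕ Fin N)
  let A : ℕ → ι := fun i => some (Sum.inl ⟨i % N, Nat.mod_lt _ hN0⟩)
  let B : ℕ → ι := fun i => some (Sum.inr ⟨i % N, Nat.mod_lt _ hN0⟩)
  let z : ι → Space := fun x => x.elim 0 (Sum.elim (fun i => P i) (fun i => Q i))
  obtain ⟨e, he⟩ := exists_injective_nat ι
  have hs : Function.Injective (fun i : ι => (e i : ℝ)) := Nat.cast_injective.comp he
  have succ_ne (i : ℕ) : i % N ≠ (i + 1) % N := by
    intro h
    have h1 : i ≡ i + 1 [MOD N] := h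
    have h2 : N ∣ 1 := by simpa using (Nat.modEq_iff_dvd' (Nat.le_succ i)).1 h1
    have := Nat.le_of_dvd one_pos h2
    omega
  let P' : ℝ → ℕ → Space := fun t i => z (A i) + t • momentPoint (e (A i))
  let Q' : ℝ → ℕ → Space := fun t i => z (B i) + t • momentPoint (e (B i))
  have mod_eq {R : ℕ → Space} (hR : R N = R 0) (i : ℕ) (hi : i ≤ N) : R i = R (i % N) := by
    rcases hi.eq_or_lt with rfl | hi
    · rw [Nat.mod_self, hR]
    · rw [Nat.mod_eq_of_lt hi]
  have hP0 (i : ℕ) (hi : i ≤ N) : P i = P' 0 i := by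
    simpa [P', A, z] using mod_eq hP i hi
  have hQ0 (i : ℕ) (hi : i ≤ N) : Q i = Q' 0 i := by
    simpa [Q', B, z] using mod_eq hQ i hi
  have hP'c (i : ℕ) : ContinuousAt (fun t => P' t i) 0 := by simp only [P']; fun_prop
  have hQ'c (i : ℕ) : ContinuousAt (fun t => Q' t i) 0 := by simp only [Q']; fun_prop
  have hPN : P' 0 N = P' 0 0 := by simp [P', A]
  have hQN : Q' 0 N = Q' 0 0 := by simp [Q', B]
  have local_eq (u : Space) (hu : IsRegularDirection N P Q u) :
      ∀ᶠ t in 𝓝[≠] (0 : ℝ), overcrossingCount N (P' t) (Q' t) (u + t • vertical) =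
        overcrossingCount N P Q u := by
    have hc : ContinuousAt (fun t : ℝ => u + t • vertical) 0 := by fun_prop
    have := eventually_overcrossingCount_eq hP'c hQ'c hc hPN hQN (hdisj.congr hP0 hQ0)
      (by simpa using hu.congr hP0 hQ0)
    rw [overcrossingCount_congr (v := u) hP0 hQ0]
    simpa using this.filter_mono nhdsWithin_le_nhds
  -- One small `t` makes the points generic for both perturbed directions without changing either
  -- count.
  obtain ⟨t, h1, h2, h3, h4⟩ := ((local_eq v hv).and ((local_eq w hw).and
    ((eventually_generic v z hs).and (eventually_generic w z hs)))).exists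
  rw [← h1, ← h2]
  exact h3.sum_overcrossingSign_eq (A := A) (B := B) (x := none) h4 (by simp [A]) (by simp [B])
    (fun i h => succ_ne i (congrArg Fin.val (Sum.inl.inj (Option.some.inj h))))
    (fun i h => succ_ne i (congrArg Fin.val (Sum.inr.inj (Option.some.inj h))))
    (fun i j h => Sum.inl_ne_inr (Option.some.inj h)) (fun i => by simp [A]) (fun i => by simp [B])

theorem exists_hasPolygonalLinkingNumber {N : ℕ} {P Q : ℕ → Space} (hN : 2 ≤ N) (hP : P N = P 0)
    (hQ : Q N = Q 0) (hdisj : PolygonsDisjoint N P Q) :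
    ∃ k, HasPolygonalLinkingNumber N P Q k := by
  obtain ⟨v, hv⟩ := exists_isRegularDirection (by omega) hdisj
  exact ⟨_, ⟨v, hv⟩, fun w hw =>
    overcrossingCount_eq_of_isRegularDirection hN hP hQ hdisj hw hv⟩

theorem HasPolygonalLinkingNumber.unique {N : ℕ} {P Q : ℕ → Space} {k l : ℤ}
    (hk : HasPolygonalLinkingNumber N P Q k) (hl : HasPolygonalLinkingNumber N P Q l) : k = l := by
  obtain ⟨v, hv⟩ := hk.1
  exact (hk.2 v hv).symm.trans (hl.2 v hv)

theorem HasPolygonalLinkingNumber.symm {N : ℕ} {P Q : ℕ → Space} {k : ℤ}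
    (h : HasPolygonalLinkingNumber N P Q k) : HasPolygonalLinkingNumber N Q P k := by
  have neg {P Q : ℕ → Space} {v : Space} (hv : IsRegularDirection N P Q v) :
      IsRegularDirection N Q P (-v) :=
    ⟨neg_ne_zero.2 hv.1, fun i hi j hj t ht k => by
      have := hv.2 i hi j hj t ht (-k)
      simp only [smul_neg, neg_smul] at this ⊢
      exact ⟨this.2, this.1⟩⟩
  obtain ⟨⟨v, hv⟩, h⟩ := h
  refine ⟨⟨-v, neg hv⟩, fun w hw => ?_⟩
  rw [← h (-w) (neg hw)]
  unfold overcrossingCount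
  rw [Finset.sum_comm]
  refine Finset.sum_congr rfl fun i _ => Finset.sum_congr rfl fun j _ => ?_
  exact (overcrossingSign_neg w _ _ _ _).symm

section Homotopy

variable {X : Type*} [TopologicalSpace X] {N : ℕ} {P Q : X → ℕ → Space}

/-- A fixed regular direction stays regular with the same count nearby, and a single direction
determines the linking number. -/
theorem HasPolygonalLinkingNumber.eventually {x₀ : X} {k : ℤ} (hN : 2 ≤ N)
    (hP : ∀ i, ContinuousAt (fun x => P x i) x₀) (hQ : ∀ i, ContinuousAt (fun x => Q x i) x₀)
    (hPc : ∀ x, P x N = P x 0) (hQc : ∀ x, Q x N = Q x 0)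
    (hdisj : PolygonsDisjoint N (P x₀) (Q x₀))
    (h : HasPolygonalLinkingNumber N (P x₀) (Q x₀) k) :
    ∀ᶠ x in 𝓝 x₀, HasPolygonalLinkingNumber N (P x) (Q x) k := by
  obtain ⟨⟨v, hv⟩, h⟩ := h
  have hc : ContinuousAt (fun _ : X => v) x₀ := continuousAt_const
  filter_upwards [eventually_polygonsDisjoint hP hQ hdisj, eventually_isRegularDirection hP hQ hc hv,
    eventually_overcrossingCount_eq hP hQ hc (hPc _) (hQc _) hdisj hv] with x h1 h2 h3
  refine ⟨⟨v, h2⟩, fun w hw => ?_⟩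
  rw [overcrossingCount_eq_of_isRegularDirection hN (hPc x) (hQc x) h1 hw h2, h3, h v hv]

/-- The linking number is invariant under homotopies through disjoint polygons. -/
theorem HasPolygonalLinkingNumber.homotopy [PreconnectedSpace X] {k : ℤ} (hN : 2 ≤ N)
    (hP : ∀ i, Continuous (fun x => P x i)) (hQ : ∀ i, Continuous (fun x => Q x i))
    (hPc : ∀ x, P x N = P x 0) (hQc : ∀ x, Q x N = Q x 0)
    (hdisj : ∀ x, PolygonsDisjoint N (P x) (Q x)) {x : X}
    (h : HasPolygonalLinkingNumber N (P x) (Q x) k) (y : X) :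
    HasPolygonalLinkingNumber N (P y) (Q y) k := by
  have op : ∀ l, IsOpen {x | HasPolygonalLinkingNumber N (P x) (Q x) l} := fun l =>
    isOpen_iff_mem_nhds.2 fun x hx => HasPolygonalLinkingNumber.eventually hN
      (fun i => (hP i).continuousAt) (fun i => (hQ i).continuousAt) hPc hQc (hdisj x) hx
  have clopen : IsClopen {x | HasPolygonalLinkingNumber N (P x) (Q x) k} := by
    refine ⟨⟨?_⟩, op k⟩
    -- Every pair in the family has some linking number, so the complement of one open level set is
    -- the union of the others.
    have : {x | HasPolygonalLinkingNumber N (P x) (Q x) k}ᶜ =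
        ⋃ l ∈ ({k}ᶜ : Set ℤ), {x | HasPolygonalLinkingNumber N (P x) (Q x) l} := by
      ext x
      simp only [mem_compl_iff, mem_ofPred_eq, mem_iUnion, mem_singleton_iff, exists_prop]
      constructor
      · intro hx
        obtain ⟨l, hl⟩ := exists_hasPolygonalLinkingNumber hN (hPc x) (hQc x) (hdisj x)
        exact ⟨l, fun h => hx (h ▸ hl), hl⟩
      · rintro ⟨l, hl, hx⟩ hk
        exact hl (hx.unique hk)
    rw [this]
    exact isOpen_biUnion fun l _ => op l
  have := clopen.eq_univ ⟨x, h⟩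
  exact this.ge (mem_univ y)

end Homotopy

/-! ### Linking numbers of loops -/

theorem inscribedPolygon_self (γ : C(UnitAddCircle, Space)) {N : ℕ} (hN : 0 < N) :
    inscribedPolygon γ N N = inscribedPolygon γ N 0 := by
  unfold inscribedPolygon
  rw [div_self (by positivity)]
  simp [AddCircle.coe_period]

/-- Balls are convex, so each edge stays in the thickening of its own set. -/
theorem polygonsDisjoint_of_ball {N : ℕ} {P Q : ℕ → Space} {η : ℝ} {K K' : Set Space}
    (hK : Disjoint (Metric.thickening η K) (Metric.thickening η K'))
    (hP : ∀ i < N, ∃ x ∈ K, P i ∈ Metric.ball x η ∧ P (i + 1) ∈ Metric.ball x η)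
    (hQ : ∀ i < N, ∃ x ∈ K', Q i ∈ Metric.ball x η ∧ Q (i + 1) ∈ Metric.ball x η) :
    PolygonsDisjoint N P Q := by
  intro i hi j hj s hs t ht e
  obtain ⟨x, hx, h1, h2⟩ := hP i hi
  obtain ⟨y, hy, h3, h4⟩ := hQ j hj
  have m1 := (convex_ball x η).lineMap_mem h1 h2 hs
  have m2 := (convex_ball y η).lineMap_mem h3 h4 ht
  rw [e] at m1
  exact hK.le_bot ⟨Metric.mem_thickening_iff.2 ⟨x, hx, m1⟩, Metric.mem_thickening_iff.2 ⟨y, hy, m2⟩⟩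

theorem exists_modulus (γ : C(UnitAddCircle, Space)) {η : ℝ} (hη : 0 < η) :
    ∃ ρ > 0, ∀ x y : ℝ, |x - y| < ρ → γ (x : UnitAddCircle) ∈ Metric.ball (γ (y : UnitAddCircle)) η := by
  obtain ⟨ρ, hρ, h⟩ := Metric.uniformContinuous_iff.1
    (CompactSpace.uniformContinuous_of_continuous γ.continuous) η hη
  refine ⟨ρ, hρ, fun x y hxy => h ?_⟩
  rw [dist_eq_norm, ← AddCircle.coe_sub]
  refine lt_of_le_of_lt ?_ hxy
  rw [UnitAddCircle.norm_eq]
  simpa using round_le (x - y) 0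

/-- Interpolates between the polygon with `N` edges inscribed in `γ`, its last vertex being
repeated, and the inscribed polygon with `N + 1` edges. -/
noncomputable def interpolatedPolygon (γ : C(UnitAddCircle, Space)) (N : ℕ) (τ : unitInterval)
    (i : ℕ) : Space :=
  AffineMap.lineMap (inscribedPolygon γ N (min i N)) (inscribedPolygon γ (N + 1) i) (τ : ℝ)

theorem exists_ball_inscribedPolygon (γ : C(UnitAddCircle, Space)) {η ρ : ℝ}
    (h : ∀ x y : ℝ, |x - y| < ρ → γ (x : UnitAddCircle) ∈ Metric.ball (γ (y : UnitAddCircle)) η)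
    {N : ℕ} (hN : 0 < N) (hρ : 2 / (N : ℝ) < ρ) (i : ℕ) :
    ∃ x ∈ range γ, inscribedPolygon γ N i ∈ Metric.ball x η ∧
      inscribedPolygon γ N (i + 1) ∈ Metric.ball x η := by
  have hN' : (0 : ℝ) < N := by exact_mod_cast hN
  have h2 : 0 < 2 / (N : ℝ) := by positivity
  refine ⟨_, mem_range_self (((i : ℝ) / N : ℝ) : UnitAddCircle), h _ _ ?_, h _ _ ?_⟩
  · rw [sub_self, abs_zero]; linarith
  · rw [← sub_div]
    push_cast
    rw [add_sub_cancel_left, abs_of_pos (by positivity)]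
    refine lt_of_le_of_lt ?_ hρ
    gcongr
    norm_num

theorem exists_ball_interpolatedPolygon (γ : C(UnitAddCircle, Space)) {η ρ : ℝ}
    (h : ∀ x y : ℝ, |x - y| < ρ → γ (x : UnitAddCircle) ∈ Metric.ball (γ (y : UnitAddCircle)) η)
    {N : ℕ} (hN : 0 < N) (hρ : 2 / (N : ℝ) < ρ) (τ : unitInterval) {i : ℕ} (hi : i < N + 1) :
    ∃ x ∈ range γ, interpolatedPolygon γ N τ i ∈ Metric.ball x η ∧
      interpolatedPolygon γ N τ (i + 1) ∈ Metric.ball x η := by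
  have hN' : (0 : ℝ) < N := by exact_mod_cast hN
  have hN1 : (0 : ℝ) < (N : ℝ) + 1 := by positivity
  have hinv : 1 / ((N : ℝ) + 1) ≤ 1 / (N : ℝ) := one_div_le_one_div_of_le hN' (by linarith)
  have e2 : 2 / (N : ℝ) = 1 / N + 1 / N := by ring
  have hpos : 0 < 1 / (N : ℝ) := by positivity
  -- The parameters in the subdivisions into `N` and `N + 1` parts differ by at most `1 / N`, and
  -- one step adds at most `1 / N` more; hence the bound `2 / N`.
  have near (j : ℕ) (hj : j ≤ N + 1) :
      |((min j N : ℕ) : ℝ) / N - (j : ℝ) / ((N + 1 : ℕ) : ℝ)| ≤ 1 / N := by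
    push_cast
    have hj' : (j : ℝ) ≤ N + 1 := by exact_mod_cast hj
    rcases Nat.lt_or_ge N j with hjN | hjN
    · have : j = N + 1 := by omega
      subst this
      push_cast
      rw [min_eq_right (by linarith), div_self hN'.ne', div_self hN1.ne', sub_self, abs_zero]
      exact hpos.le
    · have hjN' : (j : ℝ) ≤ N := by exact_mod_cast hjN
      rw [min_eq_left hjN']
      have e : (j : ℝ) / N - j / (N + 1) = (j / (N + 1)) * (1 / N) := by field_simp; ring
      rw [e, abs_of_nonneg (by positivity)]
      refine mul_le_of_le_one_left hpos.le ((div_le_one hN1).2 hj')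
  have step : |((i + 1 : ℕ) : ℝ) / ((N + 1 : ℕ) : ℝ) - (i : ℝ) / ((N + 1 : ℕ) : ℝ)| ≤ 1 / N := by
    push_cast
    rw [← sub_div, add_sub_cancel_left, abs_of_pos (by positivity)]
    exact hinv
  refine ⟨_, mem_range_self (((i : ℝ) / ((N + 1 : ℕ) : ℝ) : ℝ) : UnitAddCircle),
    (convex_ball _ _).lineMap_mem (h _ _ ?_) (h _ _ ?_) τ.2,
    (convex_ball _ _).lineMap_mem (h _ _ ?_) (h _ _ ?_) τ.2⟩
  · have := near i hi.le; linarith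
  · rw [sub_self, abs_zero]; linarith
  · refine lt_of_le_of_lt (abs_sub_le _ (((i + 1 : ℕ) : ℝ) / ((N + 1 : ℕ) : ℝ)) _) ?_
    have := near (i + 1) hi
    linarith
  · linarith

/-- Repeating the last vertex adds a degenerate edge, which has no crossings. Both polygons then
have `N + 1` edges and can be deformed to the next inscribed polygons. -/
theorem hasPolygonalLinkingNumber_succ {N : ℕ} {P Q : ℕ → Space} {k : ℤ} (hN : 2 ≤ N)
    (hP : P N = P 0) (hQ : Q N = Q 0)
    (hdisj : PolygonsDisjoint (N + 1) (fun i => P (min i N)) fun i => Q (min i N))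
    (h : HasPolygonalLinkingNumber N P Q k) :
    HasPolygonalLinkingNumber (N + 1) (fun i => P (min i N)) (fun i => Q (min i N)) k := by
  obtain ⟨l, hl⟩ := exists_hasPolygonalLinkingNumber (by omega) (by simpa using hP)
    (by simpa using hQ) hdisj
  obtain ⟨v, hv⟩ := hl.1
  have hP' : ∀ i ≤ N, P (min i N) = P i := fun i hi => by rw [min_eq_left hi]
  have hQ' : ∀ i ≤ N, Q (min i N) = Q i := fun i hi => by rw [min_eq_left hi]
  have hv' : IsRegularDirection N P Q v := IsRegularDirection.congr hP' hQ'
    ⟨hv.1, fun i hi j hj => hv.2 i (by omega) j (by omega)⟩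
  have e : overcrossingCount (N + 1) (fun i => P (min i N)) (fun i => Q (min i N)) v =
      overcrossingCount N P Q v := by
    rw [← overcrossingCount_congr hP' hQ']
    unfold overcrossingCount
    have hself {R : ℕ → Space} : R (min N N) = R (min (N + 1) N) := by simp
    rw [Finset.sum_range_succ]
    simp only [Finset.sum_range_succ _ N, ← hself (R := P), ← hself (R := Q),
      overcrossingSign_self_left, overcrossingSign_self_right, Finset.sum_const_zero, add_zero]
  rw [hl.2 v hv, h.2 v hv'] at e
  exact e ▸ hl

/-- Disjoint loops have a linking number. -/
theorem exists_linkingNumber {γ δ : C(UnitAddCircle, Space)} (hγδ : Disjoint (range γ) (range δ)) :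
    ∃ k, ∀ᶠ N : ℕ in atTop, PolygonsDisjoint N (inscribedPolygon γ N) (inscribedPolygon δ N) ∧
      HasPolygonalLinkingNumber N (inscribedPolygon γ N) (inscribedPolygon δ N) k := by
  obtain ⟨η, hη, hth⟩ := hγδ.exists_thickenings (isCompact_range γ.continuous)
    (isCompact_range δ.continuous).isClosed
  obtain ⟨ρ₁, hρ₁, h₁⟩ := exists_modulus γ hη
  obtain ⟨ρ₂, hρ₂, h₂⟩ := exists_modulus δ hη
  have hlim : Tendsto (fun N : ℕ => 2 / (N : ℝ)) atTop (𝓝 0) :=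
    tendsto_const_div_atTop_nhds_zero_nat 2
  obtain ⟨N₀, hN₀⟩ := eventually_atTop.1 ((hlim.eventually_lt_const hρ₁).and
    ((hlim.eventually_lt_const hρ₂).and (eventually_ge_atTop 2)))
  have hdisj (N : ℕ) (hN : N₀ ≤ N) :
      PolygonsDisjoint N (inscribedPolygon γ N) (inscribedPolygon δ N) := by
    obtain ⟨a, b, c⟩ := hN₀ N hN
    exact polygonsDisjoint_of_ball hth
      (fun i _ => exists_ball_inscribedPolygon γ h₁ (by omega) a i)
      (fun i _ => exists_ball_inscribedPolygon δ h₂ (by omega) b i)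
  have h2 := (hN₀ N₀ le_rfl).2.2
  obtain ⟨k, hk⟩ := exists_hasPolygonalLinkingNumber h2 (inscribedPolygon_self γ (by omega))
    (inscribedPolygon_self δ (by omega)) (hdisj N₀ le_rfl)
  refine ⟨k, eventually_atTop.2 ⟨N₀, fun N hN => ⟨hdisj N hN, ?_⟩⟩⟩
  induction N, hN using Nat.le_induction with
  | base => exact hk
  | succ N hN ih =>
    obtain ⟨a, b, c⟩ := hN₀ N hN
    have hN0 : 0 < N := by omega
    -- The interpolation between consecutive inscribed polygons stays in disjoint thickenings of the
    -- two curves, so homotopy invariance applies.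
    have hd (τ : unitInterval) : PolygonsDisjoint (N + 1) (interpolatedPolygon γ N τ)
        (interpolatedPolygon δ N τ) :=
      polygonsDisjoint_of_ball hth
        (fun i hi => exists_ball_interpolatedPolygon γ h₁ hN0 a τ hi)
        (fun i hi => exists_ball_interpolatedPolygon δ h₂ hN0 b τ hi)
    have zero (γ : C(UnitAddCircle, Space)) : interpolatedPolygon γ N 0 =
        fun i => inscribedPolygon γ N (min i N) := by
      funext i; simp [interpolatedPolygon]
    have one (γ : C(UnitAddCircle, Space)) : interpolatedPolygon γ N 1 =
        inscribedPolygon γ (N + 1) := by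
      funext i; simp [interpolatedPolygon]
    have cont (γ : C(UnitAddCircle, Space)) (i : ℕ) :
        Continuous fun τ => interpolatedPolygon γ N τ i := by
      unfold interpolatedPolygon
      exact AffineMap.lineMap_continuous.comp continuous_subtype_val
    have closed (γ : C(UnitAddCircle, Space)) (τ : unitInterval) :
        interpolatedPolygon γ N τ (N + 1) = interpolatedPolygon γ N τ 0 := by
      unfold interpolatedPolygon
      rw [inscribedPolygon_self γ (Nat.succ_pos N), min_eq_right (Nat.le_succ N),
        inscribedPolygon_self γ hN0, Nat.zero_min]
    have start := hasPolygonalLinkingNumber_succ c (inscribedPolygon_self γ hN0)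
      (inscribedPolygon_self δ hN0) (by rw [← zero γ, ← zero δ]; exact hd 0) ih
    rw [← zero γ, ← zero δ] at start
    have := start.homotopy (by omega) (cont γ) (cont δ) (closed γ) (closed δ) hd 1
    rwa [one γ, one δ] at this

/-! ### Ramsey's theorem for uniform hypergraphs -/

/-- Peel off the least element x, colour the k-sets U of the rest by the colour of U with x added,
pass to a homogeneous set for this colouring, and repeat inside it. The colour of a (k+1)-set then
depends only on its least element. -/
theorem exists_min_homogeneous {κ : Type*} {k : ℕ}
    (ih : ∀ m : ℕ, ∃ r : ℕ, ∀ (α : Type) [LinearOrder α] (S : Finset α), r ≤ S.card →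
      ∀ col : Finset α → κ, ∃ T ⊆ S, T.card = m ∧ ∃ c, ∀ U ⊆ T, U.card = k → col U = c) (p : ℕ) :
    ∃ r : ℕ, ∀ (α : Type) [LinearOrder α] (S : Finset α), r ≤ S.card → ∀ col : Finset α → κ,
      ∃ T ⊆ S, T.card = p ∧ ∃ g : α → κ, ∀ x ∈ T, ∀ U ⊆ T, (∀ y ∈ U, x < y) → U.card = k →
        col (insert x U) = g x := by
  induction p with
  | zero =>
    exact ⟨0, fun α _ S _ col => ⟨∅, by simp, by simp, fun _ => col ∅, by simp⟩⟩
  | succ p hp =>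
    obtain ⟨r, hr⟩ := hp
    obtain ⟨r', hr'⟩ := ih r
    refine ⟨r' + 1, fun α _ S hS col => ?_⟩
    have hne : S.Nonempty := Finset.card_pos.1 (by omega)
    set x := S.min' hne with hx
    obtain ⟨T₀, hT₀, hc₀, c, hc⟩ := hr' α (S.erase x)
      (by rw [Finset.card_erase_of_mem (S.min'_mem hne)]; omega) fun U => col (insert x U)
    obtain ⟨T, hT, hTc, g, hg⟩ := hr α T₀ hc₀.ge col
    have hxT (y : α) (hy : y ∈ T) : x < y :=
      Finset.min'_lt_of_mem_erase_min' _ hne (hT₀ (hT hy))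
    have hxT' : x ∉ T := fun h => lt_irrefl _ (hxT x h)
    refine ⟨insert x T, Finset.insert_subset (S.min'_mem hne)
      ((hT.trans hT₀).trans (Finset.erase_subset _ _)), by rw [Finset.card_insert_of_notMem hxT', hTc],
      Function.update g x c, fun y hy U hU hlt hUk => ?_⟩
    have hUT : U ⊆ T := fun u hu => by
      rcases Finset.mem_insert.1 (hU hu) with rfl | h
      · have h1 := hlt _ hu
        rcases Finset.mem_insert.1 hy with rfl | h
        · exact absurd h1 (lt_irrefl _)
        · exact absurd h1 (hxT y h).not_gt
      · exact h
    rcases Finset.mem_insert.1 hy with rfl | hy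
    · rw [Function.update_self]
      exact hc U (hUT.trans hT) hUk
    · rw [Function.update_of_ne (hxT y hy).ne']
      exact hg y hy U hUT hlt hUk

theorem ramsey (κ : Type*) [Finite κ] (k : ℕ) : ∀ m : ℕ, ∃ r : ℕ, ∀ (α : Type) [LinearOrder α]
    (S : Finset α), r ≤ S.card → ∀ col : Finset α → κ,
      ∃ T ⊆ S, T.card = m ∧ ∃ c, ∀ U ⊆ T, U.card = k → col U = c := by
  classical
  induction k with
  | zero =>
    intro m
    refine ⟨m, fun α _ S hS col => ?_⟩
    obtain ⟨T, hT, hm⟩ := Finset.exists_subset_card_eq hS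
    exact ⟨T, hT, hm, col ∅, fun U _ hU => by rw [Finset.card_eq_zero.1 hU]⟩
  | succ k ih =>
    intro m
    have := Fintype.ofFinite κ
    -- By the pigeonhole principle, `m` of these elements give the same colour to the sets of which
    -- they are the minimum.
    obtain ⟨r, hr⟩ := exists_min_homogeneous ih (Fintype.card κ * m)
    refine ⟨r, fun α _ S hS col => ?_⟩
    obtain ⟨T, hT, hTc, g, hg⟩ := hr α S hS col
    have : Nonempty κ := ⟨col ∅⟩
    obtain ⟨c, -, hc⟩ := Finset.exists_le_card_fiber_of_mul_le_card_of_maps_to (s := T)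
      (t := Finset.univ) (f := g) (n := m) (fun _ _ => Finset.mem_univ _) Finset.univ_nonempty
      (by rw [hTc, Finset.card_univ])
    obtain ⟨T', hT', hT'm⟩ := Finset.exists_subset_card_eq hc
    refine ⟨T', (hT'.trans (Finset.filter_subset _ _)).trans hT, hT'm, c, fun U hU hUk => ?_⟩
    have hne : U.Nonempty := Finset.card_pos.1 (by omega)
    have hmem := Finset.mem_filter.1 (hT' (hU (U.min'_mem hne)))
    rw [← Finset.insert_erase (U.min'_mem hne), ← hmem.2]
    refine hg _ hmem.1 _ (fun u hu => ?_)
      (fun y hy => Finset.min'_lt_of_mem_erase_min' _ hne hy)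
      (by rw [Finset.card_erase_of_mem (U.min'_mem hne), hUk]; rfl)
    exact (Finset.mem_filter.1 (hT' (hU (Finset.mem_of_mem_erase hu)))).1

theorem ramsey_strictMono (κ : Type*) [Finite κ] [Nonempty κ] (k m : ℕ) : ∃ r : ℕ,
    ∀ col : (Fin k → Fin r) → κ, ∃ h : Fin m → Fin r, StrictMono h ∧
      ∃ c, ∀ s : Fin k → Fin m, StrictMono s → col (h ∘ s) = c := by
  classical
  -- The extra colour `none` is a default for sets of the wrong size.
  obtain ⟨r, hr⟩ := ramsey (Option κ) k m
  refine ⟨r, fun col => ?_⟩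
  obtain ⟨T, -, hT, c, hc⟩ := hr (Fin r) Finset.univ (by simp) fun U =>
    if hU : U.card = k then some (col (U.orderEmbOfFin hU)) else none
  refine ⟨T.orderEmbOfFin hT, (T.orderEmbOfFin hT).strictMono, ?_⟩
  have key (s : Fin k → Fin m) (hs : StrictMono s) : some (col (T.orderEmbOfFin hT ∘ s)) = c := by
    have hinj : Function.Injective (T.orderEmbOfFin hT ∘ s) :=
      (T.orderEmbOfFin hT).injective.comp hs.injective
    have hU : (Finset.univ.image (T.orderEmbOfFin hT ∘ s)).card = k := by
      rw [Finset.card_image_of_injective _ hinj, Finset.card_fin]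
    have := hc (Finset.univ.image (T.orderEmbOfFin hT ∘ s)) (fun x hx => by
      obtain ⟨i, -, rfl⟩ := Finset.mem_image.1 hx
      exact Finset.orderEmbOfFin_mem T hT _) hU
    rw [dif_pos hU] at this
    rw [← this, ← Finset.orderEmbOfFin_unique hU
      (fun i => Finset.mem_image_of_mem _ (Finset.mem_univ i))
      ((T.orderEmbOfFin hT).strictMono.comp hs)]
  by_cases h : ∃ s : Fin k → Fin m, StrictMono s
  · obtain ⟨s₀, hs₀⟩ := h
    exact ⟨col (T.orderEmbOfFin hT ∘ s₀), fun s hs =>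
      Option.some_injective _ ((key s hs).trans (key s₀ hs₀).symm)⟩
  · exact ⟨Classical.arbitrary κ, fun s hs => absurd ⟨s, hs⟩ h⟩

/-! ### Crossings of the complete graph on five points of the plane -/

/-- The crossings of the three pairs of opposite edges of a complete graph on four points. -/
def boolQuad (A B C D : Bool) : ℤ :=
  boolPattern A B C D + boolPattern (!A) C B (!D) + boolPattern (!B) (!C) A D

/-- The letters are the orientations of the ten triples from {0, …, 4} in lexicographic order. The
five hypotheses are the sign forms of the Plücker relations, one for each point common to all
triples of the relation. -/
theorem bool_five_points : ∀ a b c d e f g h i j : Bool,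
    !((a == f) == (b != e) && (a == f) == (c == d)) →
    !((a == i) == (b != h) && (a == i) == (c == g)) →
    !((a == j) == (d != h) && (a == j) == (e == g)) →
    !((b != j) == (d == i) && (b != j) == (f != g)) →
    !((c == j) == (e != i) && (c == j) == (f == h)) →
    (boolQuad a b d g + boolQuad a c e h + boolQuad b c f i + boolQuad d e f j +
      boolQuad g h i j) % 2 = 1 := by
  decide

/-- The crossings of the three pairs of opposite edges of a complete graph on four points. -/
noncomputable def quadCrossing (v a b c d : Space) : ℤ :=
  crossingSign v a b c d + crossingSign v a c b d + crossingSign v a d b c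

theorem decide_neg_pos {x : ℝ} (hx : x ≠ 0) : decide (0 < -x) = !decide (0 < x) := by
  rcases lt_or_gt_of_ne hx with h | h
  · rw [decide_eq_true (neg_pos.2 h), decide_eq_false h.not_gt]; rfl
  · rw [decide_eq_false (neg_neg_of_pos h).not_gt, decide_eq_true h]; rfl

theorem quadCrossing_eq_boolQuad {v a b c d : Space} (hA : orient v a b c ≠ 0)
    (hB : orient v a b d ≠ 0) (hC : orient v a c d ≠ 0) (hD : orient v b c d ≠ 0) :
    quadCrossing v a b c d = boolQuad (decide (0 < orient v a b c)) (decide (0 < orient v a b d))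
      (decide (0 < orient v a c d)) (decide (0 < orient v b c d)) := by
  unfold quadCrossing crossingSign boolQuad
  rw [orient_rotate v a c d, orient_rotate v b c d, orient_swap₂₃ v a b c, orient_rotate v a b d,
    orient_swap₂₃ v b c d, orient_swap₂₃ v a b d, orient_swap₂₃ v a c d, orient_rotate v a b c,
    signPattern_eq_boolPattern hA hB hC hD,
    signPattern_eq_boolPattern (neg_ne_zero.2 hA) hC hB (neg_ne_zero.2 hD),
    signPattern_eq_boolPattern (neg_ne_zero.2 hB) (neg_ne_zero.2 hC) hA hD,
    decide_neg_pos hA, decide_neg_pos hB, decide_neg_pos hC, decide_neg_pos hD]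

/-- A straight line drawing of the complete graph on five points has an odd number of crossings. -/
theorem odd_sum_quadCrossing {v : Space} {z : ℕ → Space} (h : ∀ i j k, i < j → j < k → k < 5 →
    orient v (z i) (z j) (z k) ≠ 0) :
    (quadCrossing v (z 0) (z 1) (z 2) (z 3) + quadCrossing v (z 0) (z 1) (z 2) (z 4) +
      quadCrossing v (z 0) (z 1) (z 3) (z 4) + quadCrossing v (z 0) (z 2) (z 3) (z 4) +
      quadCrossing v (z 1) (z 2) (z 3) (z 4)) % 2 = 1 := by
  have h012 := h 0 1 2 (by norm_num) (by norm_num) (by norm_num)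
  have h013 := h 0 1 3 (by norm_num) (by norm_num) (by norm_num)
  have h014 := h 0 1 4 (by norm_num) (by norm_num) (by norm_num)
  have h023 := h 0 2 3 (by norm_num) (by norm_num) (by norm_num)
  have h024 := h 0 2 4 (by norm_num) (by norm_num) (by norm_num)
  have h034 := h 0 3 4 (by norm_num) (by norm_num) (by norm_num)
  have h123 := h 1 2 3 (by norm_num) (by norm_num) (by norm_num)
  have h124 := h 1 2 4 (by norm_num) (by norm_num) (by norm_num)
  have h134 := h 1 3 4 (by norm_num) (by norm_num) (by norm_num)
  have h234 := h 2 3 4 (by norm_num) (by norm_num) (by norm_num)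
  have f₀ := not_all_signs_eq_of_add_eq_zero (mul_ne_zero h012 h034)
    (neg_ne_zero.2 (mul_ne_zero h013 h024)) (mul_ne_zero h014 h023)
    (by simp only [orient, det3, Pi.sub_apply]; ring)
  have f₁ := not_all_signs_eq_of_add_eq_zero (mul_ne_zero h012 h134)
    (neg_ne_zero.2 (mul_ne_zero h013 h124)) (mul_ne_zero h014 h123)
    (by simp only [orient, det3, Pi.sub_apply]; ring)
  have f₂ := not_all_signs_eq_of_add_eq_zero (mul_ne_zero h012 h234)
    (neg_ne_zero.2 (mul_ne_zero h023 h124)) (mul_ne_zero h024 h123)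
    (by simp only [orient, det3, Pi.sub_apply]; ring)
  have f₃ := not_all_signs_eq_of_add_eq_zero (neg_ne_zero.2 (mul_ne_zero h013 h234))
    (mul_ne_zero h023 h134) (neg_ne_zero.2 (mul_ne_zero h034 h123))
    (by simp only [orient, det3, Pi.sub_apply]; ring)
  have f₄ := not_all_signs_eq_of_add_eq_zero (mul_ne_zero h014 h234)
    (neg_ne_zero.2 (mul_ne_zero h024 h134)) (mul_ne_zero h034 h124)
    (by simp only [orient, det3, Pi.sub_apply]; ring)
  rw [decide_mul_pos h012 h034, decide_neg_mul_pos h013 h024, decide_mul_pos h014 h023] at f₀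
  rw [decide_mul_pos h012 h134, decide_neg_mul_pos h013 h124, decide_mul_pos h014 h123] at f₁
  rw [decide_mul_pos h012 h234, decide_neg_mul_pos h023 h124, decide_mul_pos h024 h123] at f₂
  rw [decide_neg_mul_pos h013 h234, decide_mul_pos h023 h134, decide_neg_mul_pos h034 h123] at f₃
  rw [decide_mul_pos h014 h234, decide_neg_mul_pos h024 h134, decide_mul_pos h034 h124] at f₄
  rw [quadCrossing_eq_boolQuad h012 h013 h023 h123, quadCrossing_eq_boolQuad h012 h014 h024 h124,
    quadCrossing_eq_boolQuad h013 h014 h034 h134, quadCrossing_eq_boolQuad h023 h024 h034 h234,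
    quadCrossing_eq_boolQuad h123 h124 h134 h234]
  exact bool_five_points _ _ _ _ _ _ _ _ _ _ f₀ f₁ f₂ f₃ f₄

/-! ### Homogeneous crossing patterns -/

/-- An alternating function of two edges on `ℕ`, standing for the signed number of overcrossings
of the first edge over the second. -/
structure IsAlternating (w : ℕ → ℕ → ℕ → ℕ → ℤ) (m : ℕ) : Prop where
  left : ∀ i j k l, i < m → j < m → i ≠ j → w j i k l = -w i j k l
  right : ∀ i j k l, k < m → l < m → k ≠ l → w i j l k = -w i j k l

/-- Modulo `M`, the value of `w` on two disjoint edges with vertices below `m` depends only on the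
relative order of their endpoints. -/
structure IsHomogeneous (w : ℕ → ℕ → ℕ → ℕ → ℤ) (m M : ℕ) (α₁ α₂ β₁ β₂ γ₁ γ₂ : ZMod M) :
    Prop where
  alpha₁ : ∀ i j k l, i < j → j < k → k < l → l < m → (w i j k l : ZMod M) = α₁
  alpha₂ : ∀ i j k l, i < j → j < k → k < l → l < m → (w k l i j : ZMod M) = α₂
  beta₁ : ∀ i j k l, i < j → j < k → k < l → l < m → (w i k j l : ZMod M) = β₁
  beta₂ : ∀ i j k l, i < j → j < k → k < l → l < m → (w j l i k : ZMod M) = β₂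
  gamma₁ : ∀ i j k l, i < j → j < k → k < l → l < m → (w i l j k : ZMod M) = γ₁
  gamma₂ : ∀ i j k l, i < j → j < k → k < l → l < m → (w j k i l : ZMod M) = γ₂

/-- The linking number, in terms of crossings, of the cycles `c` and `d` with `N` and `N'` edges. -/
def cycleSum (w : ℕ → ℕ → ℕ → ℕ → ℤ) (N N' : ℕ) (c d : ℕ → ℕ) : ℤ :=
  ∑ i ∈ Finset.range N, ∑ j ∈ Finset.range N', w (c i) (c (i + 1)) (d j) (d (j + 1))

section Homogeneous

variable {w : ℕ → ℕ → ℕ → ℕ → ℤ} {m M : ℕ} {α₁ α₂ β₁ β₂ γ₁ γ₂ : ZMod M}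

/-- All nine pairs of edges of the triangles 012 and 345 are separated. In each triangle two edges
ascend and the closing one descends, so the signs of its edges add up to 1. -/
theorem IsHomogeneous.cycleSum_triangles (hw : IsAlternating w m)
    (h : IsHomogeneous w m M α₁ α₂ β₁ β₂ γ₁ γ₂) (hm : 6 ≤ m) :
    (cycleSum w 3 3 (fun i => i % 3) (fun i => 3 + i % 3) : ZMod M) = α₁ ∧
      (cycleSum w 3 3 (fun i => 3 + i % 3) (fun i => i % 3) : ZMod M) = α₂ := by
  have l20 (k l : ℕ) := hw.left 0 2 k l (by omega) (by omega) (by omega)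
  have l53 (k l : ℕ) := hw.left 3 5 k l (by omega) (by omega) (by omega)
  have r20 (k l : ℕ) := hw.right k l 0 2 (by omega) (by omega) (by omega)
  have r53 (k l : ℕ) := hw.right k l 3 5 (by omega) (by omega) (by omega)
  have a₁ (i j k l : ℕ) (h1 : i < j) (h2 : j < k) (h3 : k < l) (h4 : l < 6) :=
    h.alpha₁ i j k l h1 h2 h3 (by omega)
  have a₂ (i j k l : ℕ) (h1 : i < j) (h2 : j < k) (h3 : k < l) (h4 : l < 6) :=
    h.alpha₂ i j k l h1 h2 h3 (by omega)
  constructor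
  · simp [cycleSum, Finset.sum_range_succ, l20, r53, a₁]
  · simp [cycleSum, Finset.sum_range_succ, l53, r20, a₂]

/-- Each cycle has k + 1 short ascending edges and one long closing edge, which enters with a minus
sign. Short edges are interlaced when they have equal or certain neighbouring positions and
separated otherwise. A closing edge encloses all but one of the short edges of the other cycle and
interlaces with that one; the two closing edges interlace. -/
theorem IsHomogeneous.cycleSum_interleaved {α : ZMod M} (hw : IsAlternating w m)
    (h : IsHomogeneous w m M α α β₁ β₂ γ₁ γ₂) {n k a b : ℕ} (hab : a < b) (hb : b < n)
    (hm : n * (k + 2) ≤ m) :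
    (cycleSum w (k + 2) (k + 2) (fun i => n * (i % (k + 2)) + a)
      (fun i => n * (i % (k + 2)) + b) : ZMod M) = k * (β₁ + β₂ - γ₁ - γ₂) + α * k ^ 2 := by
  have lt_of_lt {i j x y : ℕ} (hij : i < j) (hx : x < n) : n * i + x < n * j + y := by
    have : n * (i + 1) ≤ n * j := Nat.mul_le_mul_left n hij
    rw [Nat.mul_succ] at this
    omega
  have ab (i : ℕ) : n * i + a < n * i + b := by omega
  have bound {i : ℕ} (hi : i < k + 2) : n * i + b < m := by
    have : n * (i + 1) ≤ n * (k + 2) := Nat.mul_le_mul_left n hi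
    rw [Nat.mul_succ] at this
    omega
  have bound' {i : ℕ} (hi : i < k + 2) : n * i + a < m := (ab i).trans (bound hi)
  have ha : a < n := hab.trans hb
  have mod_of_lt {i : ℕ} (hi : i < k + 2) : i % (k + 2) = i := Nat.mod_eq_of_lt hi
  unfold cycleSum
  rw [Finset.sum_range_succ]
  simp only [Finset.sum_range_succ _ (k + 1)]
  push_cast
  have closing : (k + 1 + 1) % (k + 2) = 0 := Nat.mod_self _
  have last : (k + 1) % (k + 2) = k + 1 := mod_of_lt (by omega)
  rw [closing, last]
  have left0 (x y : ℕ) : w (n * (k + 1) + a) (n * 0 + a) x y =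
      -w (n * 0 + a) (n * (k + 1) + a) x y :=
    hw.left _ _ _ _ (bound' (by omega)) (bound' (by omega)) (lt_of_lt (by omega) ha).ne
  have right0 (x y : ℕ) : w x y (n * (k + 1) + b) (n * 0 + b) =
      -w x y (n * 0 + b) (n * (k + 1) + b) :=
    hw.right _ _ _ _ (bound (by omega)) (bound (by omega)) (lt_of_lt (by omega) hb).ne
  simp only [left0, right0]
  have short : ∑ i ∈ Finset.range (k + 1), ∑ j ∈ Finset.range (k + 1),
      (w (n * (i % (k + 2)) + a) (n * ((i + 1) % (k + 2)) + a) (n * (j % (k + 2)) + b)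
        (n * ((j + 1) % (k + 2)) + b) : ZMod M) =
      α * (k + 1) ^ 2 + (k + 1) * (β₁ - α) + k * (β₂ - α) := by
    have e : ∀ i ∈ Finset.range (k + 1), ∀ j ∈ Finset.range (k + 1),
        (w (n * (i % (k + 2)) + a) (n * ((i + 1) % (k + 2)) + a) (n * (j % (k + 2)) + b)
        (n * ((j + 1) % (k + 2)) + b) : ZMod M) =
        α + (if i = j then β₁ - α else 0) + (if i = j + 1 then β₂ - α else 0) := by
      intro i hi j hj
      rw [Finset.mem_range] at hi hj
      rw [mod_of_lt (show i < k + 2 by omega), mod_of_lt (show i + 1 < k + 2 by omega),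
        mod_of_lt (show j < k + 2 by omega), mod_of_lt (show j + 1 < k + 2 by omega)]
      rcases lt_trichotomy i j with hij | rfl | hij
      · rw [if_neg (by omega), if_neg (by omega), add_zero, add_zero]
        refine h.alpha₁ _ _ _ _ (lt_of_lt (by omega) ha) ?_ (lt_of_lt (by omega) hb)
          (bound (by omega))
        rcases (Nat.succ_le_of_lt hij).eq_or_lt with e | e
        · rw [← e]; exact ab _
        · exact lt_of_lt e ha
      · rw [if_pos rfl, if_neg (by omega), h.beta₁ _ _ _ _ (ab i) (lt_of_lt (by omega) hb) (ab _)
          (bound (by omega))]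
        ring
      · rw [if_neg (by omega)]
        rcases (Nat.succ_le_of_lt hij).eq_or_lt with e | e
        · rw [if_pos (by omega), ← e, h.beta₂ _ _ _ _ (lt_of_lt (by omega) hb) (ab _)
            (lt_of_lt (by omega) hb) (bound' (by omega))]
          ring
        · rw [if_neg (by omega), add_zero, add_zero]
          exact h.alpha₂ _ _ _ _ (lt_of_lt (by omega) hb) (lt_of_lt (by omega) hb)
            (lt_of_lt (by omega) ha) (bound' (by omega))
    rw [Finset.sum_congr rfl fun i hi => Finset.sum_congr rfl (e i hi)]
    simp only [Finset.sum_add_distrib]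
    have s1 : ∑ i ∈ Finset.range (k + 1), ∑ j ∈ Finset.range (k + 1),
        (if i = j then β₁ - α else 0) = (k + 1) * (β₁ - α) := by
      rw [Finset.sum_congr rfl fun i hi => by rw [Finset.sum_ite_eq, if_pos hi]]
      simp
      ring
    have s2 : ∑ i ∈ Finset.range (k + 1), ∑ j ∈ Finset.range (k + 1),
        (if i = j + 1 then β₂ - α else 0) = k * (β₂ - α) := by
      rw [Finset.sum_range_succ', Finset.sum_congr rfl fun i hi => by
        rw [Finset.sum_congr rfl fun j _ => by rw [if_congr (add_left_inj 1) rfl rfl],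
          Finset.sum_ite_eq, if_pos (by
            rw [Finset.mem_range] at hi ⊢; omega)]]
      simp
      ring
    rw [s1, s2]
    simp
    ring
  -- Only the first short edge of the cycle `a` begins before the long edge of the cycle `b`; the
  -- other `k` are nested in it.
  have shortClosing : ∑ i ∈ Finset.range (k + 1),
      (w (n * (i % (k + 2)) + a) (n * ((i + 1) % (k + 2)) + a) (n * 0 + b)
        (n * (k + 1) + b) : ZMod M) = β₁ + k * γ₂ := by
    have e : ∀ i ∈ Finset.range k, (w (n * ((i + 1) % (k + 2)) + a) (n * ((i + 1 + 1) % (k + 2)) + a)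
        (n * 0 + b) (n * (k + 1) + b) : ZMod M) = γ₂ := fun i hi => by
      rw [Finset.mem_range] at hi
      rw [mod_of_lt (show i + 1 < k + 2 by omega), mod_of_lt (show i + 1 + 1 < k + 2 by omega)]
      refine h.gamma₂ _ _ _ _ (lt_of_lt (by omega) hb) (lt_of_lt (by omega) ha) ?_ (bound (by omega))
      rcases (show i + 1 + 1 ≤ k + 1 by omega).eq_or_lt with e | e
      · rw [e]; exact ab _
      · exact lt_of_lt e ha
    rw [Finset.sum_range_succ', Finset.sum_congr rfl e, mod_of_lt (show 0 < k + 2 by omega),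
      mod_of_lt (show 0 + 1 < k + 2 by omega),
      h.beta₁ _ _ _ _ (ab 0) (lt_of_lt (by omega) hb) ?_ (bound (by omega)), Finset.sum_const,
      Finset.card_range, nsmul_eq_mul, add_comm]
    rcases Nat.eq_zero_or_pos k with rfl | hk
    · exact ab _
    · exact lt_of_lt (by omega) ha
  -- Here the exception is the last short edge of the cycle `b`, which ends after the long edge of
  -- the cycle `a`.
  have closingShort : ∑ j ∈ Finset.range (k + 1),
      (w (n * 0 + a) (n * (k + 1) + a) (n * (j % (k + 2)) + b)
        (n * ((j + 1) % (k + 2)) + b) : ZMod M) = β₁ + k * γ₁ := by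
    have e : ∀ j ∈ Finset.range k, (w (n * 0 + a) (n * (k + 1) + a) (n * (j % (k + 2)) + b)
        (n * ((j + 1) % (k + 2)) + b) : ZMod M) = γ₁ := fun j hj => by
      rw [Finset.mem_range] at hj
      rw [mod_of_lt (show j < k + 2 by omega), mod_of_lt (show j + 1 < k + 2 by omega)]
      refine h.gamma₁ _ _ _ _ ?_ (lt_of_lt (by omega) hb) (lt_of_lt (by omega) hb) (bound' (by omega))
      rcases Nat.eq_zero_or_pos j with rfl | hj'
      · exact ab _
      · exact lt_of_lt (by omega) ha
    rw [Finset.sum_range_succ, Finset.sum_congr rfl e, last, mod_of_lt (show k < k + 2 by omega),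
      h.beta₁ _ _ _ _ ?_ (lt_of_lt (by omega) hb) (ab _) (bound (by omega)), Finset.sum_const,
      Finset.card_range, nsmul_eq_mul, add_comm]
    rcases Nat.eq_zero_or_pos k with rfl | hk
    · exact ab _
    · exact lt_of_lt (by omega) ha
  have closingClosing : (w (n * 0 + a) (n * (k + 1) + a) (n * 0 + b) (n * (k + 1) + b) : ZMod M) =
      β₁ := h.beta₁ _ _ _ _ (ab 0) (lt_of_lt (by omega) hb) (ab _) (bound (by omega))
  simp only [Finset.sum_add_distrib, Int.cast_neg, Finset.sum_neg_distrib]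
  rw [short, shortClosing, closingShort, closingClosing]
  ring

end Homogeneous

/-- With `k = 2 ^ t`, `t ≥ 1`, and `B` odd, the number `k B + A k ²` is an odd multiple of `2 ^ t`
modulo `2 ^ (t + 1)`. -/
theorem two_pow_le_abs {t : ℕ} (ht : 0 < t) {x A B : ℤ} (hB : B % 2 = 1)
    (h : (x : ZMod (2 ^ (t + 1))) = ((2 ^ t * B + A * (2 ^ t) ^ 2 : ℤ) : ZMod (2 ^ (t + 1)))) :
    2 ^ t ≤ |x| := by
  rw [ZMod.intCast_eq_intCast_iff, Int.modEq_iff_dvd] at h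
  obtain ⟨q, hq⟩ := h
  -- Positivity of `t` makes the square of 2^t divisible by 2^(t+1), so the cofactor of 2^t is `B`
  -- plus an even number.
  obtain ⟨s, rfl⟩ : ∃ s, t = s + 1 := ⟨t - 1, by omega⟩
  have e : x = 2 ^ (s + 1) * (B + 2 * (A * 2 ^ s - q)) := by
    push_cast at hq
    rw [pow_succ] at hq ⊢
    linear_combination -hq
  rw [e, abs_mul, abs_of_pos (by positivity)]
  refine le_mul_of_one_le_right (by positivity) (Int.one_le_abs ?_)
  omega

/-! ### Subdivided complete graphs -/

/-- The vertices of the complete graph on `r` vertices, every edge being subdivided into `L`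
edges. -/
abbrev SubdivisionIndex (r L : ℕ) : Type := Fin r ⊕ (Fin r × Fin r × Fin (L + 1))

/-- The `l`-th vertex of the subdivided edge from `u` to `v`. -/
def subdivisionPoint {r : ℕ} (L : ℕ) (u v : Fin r) (l : ℕ) : SubdivisionIndex r L :=
  if l = 0 then Sum.inl u else if L ≤ l then Sum.inl v
  else if u < v then Sum.inr (u, v, Fin.ofNat (L + 1) l)
  else Sum.inr (v, u, Fin.ofNat (L + 1) (L - l))

section subdivisionPoint

variable {r L : ℕ} {u v u' v' : Fin r} {l l' : ℕ}

@[simp] theorem subdivisionPoint_zero : subdivisionPoint L u v 0 = Sum.inl u := by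
  simp [subdivisionPoint]

@[simp] theorem subdivisionPoint_length (hL : 0 < L) : subdivisionPoint L u v L = Sum.inl v := by
  simp [subdivisionPoint, hL.ne']

theorem subdivisionPoint_swap (huv : u ≠ v) (hL : 0 < L) (hl : l ≤ L) :
    subdivisionPoint L v u l = subdivisionPoint L u v (L - l) := by
  rcases Nat.eq_zero_or_pos l with rfl | h0
  · simp [hL]
  rcases hl.eq_or_lt with rfl | h1
  · simp [hL]
  unfold subdivisionPoint
  rw [if_neg (show ¬l = 0 by omega), if_neg (show ¬L ≤ l by omega),
    if_neg (show ¬L - l = 0 by omega), if_neg (show ¬L ≤ L - l by omega)]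
  rcases lt_or_gt_of_ne huv with h | h
  · rw [if_neg h.not_gt, if_pos h]
  · rw [if_pos h, if_neg h.not_gt, show L - (L - l) = l by omega]

theorem subdivisionPoint_ne_succ (huv : u ≠ v) (hl : l < L) :
    subdivisionPoint L u v l ≠ subdivisionPoint L u v (l + 1) := by
  unfold subdivisionPoint
  rw [if_neg (Nat.succ_ne_zero l), if_neg (show ¬L ≤ l by omega)]
  have m1 : l % (L + 1) = l := Nat.mod_eq_of_lt (by omega)
  have m2 : L ≤ l + 1 ∨ (l + 1) % (L + 1) = l + 1 := by
    rcases Nat.lt_or_ge (l + 1) L with h | h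
    · exact Or.inr (Nat.mod_eq_of_lt (by omega))
    · exact Or.inl h
  have m3 : (L - l) % (L + 1) = L - l := Nat.mod_eq_of_lt (by omega)
  have m4 : (L - (l + 1)) % (L + 1) = L - (l + 1) := Nat.mod_eq_of_lt (by omega)
  split_ifs <;> simp [Fin.ext_iff, Fin.ofNat, m1, m3, m4, huv] <;> omega

theorem subdivisionPoint_ne (h1 : u ≠ u') (h2 : u ≠ v') (h3 : v ≠ u') (h4 : v ≠ v') :
    subdivisionPoint L u v l ≠ subdivisionPoint L u' v' l' := by
  unfold subdivisionPoint
  split_ifs <;> simp [h1, h2, h3, h4]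

theorem subdivisionPoint_ne_inl {x : Fin r} (h1 : u ≠ x) (h2 : v ≠ x) :
    subdivisionPoint L u v l ≠ Sum.inl x := by
  unfold subdivisionPoint
  split_ifs <;> simp [h1, h2]

end subdivisionPoint

/-- The sum of `χ` over the edges into which two edges of a complete graph are subdivided. -/
def edgeSum {r : ℕ} (L : ℕ) (χ : SubdivisionIndex r L → SubdivisionIndex r L →
    SubdivisionIndex r L → SubdivisionIndex r L → ℤ) (u v u' v' : Fin r) : ℤ :=
  ∑ l ∈ Finset.range L, ∑ l' ∈ Finset.range L,
    χ (subdivisionPoint L u v l) (subdivisionPoint L u v (l + 1))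
      (subdivisionPoint L u' v' l') (subdivisionPoint L u' v' (l' + 1))

section edgeSum

variable {r L : ℕ} {χ : SubdivisionIndex r L → SubdivisionIndex r L →
    SubdivisionIndex r L → SubdivisionIndex r L → ℤ} {u v u' v' : Fin r}

theorem edgeSum_swap_left (hχ : ∀ a b c d, χ b a c d = -χ a b c d) (hL : 0 < L) (huv : u ≠ v) :
    edgeSum L χ v u u' v' = -edgeSum L χ u v u' v' := by
  unfold edgeSum
  rw [← Finset.sum_range_reflect, ← Finset.sum_neg_distrib]
  refine Finset.sum_congr rfl fun l hl => ?_
  rw [← Finset.sum_neg_distrib]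
  refine Finset.sum_congr rfl fun l' _ => ?_
  have hl := Finset.mem_range.1 hl
  rw [subdivisionPoint_swap huv hL (by omega), subdivisionPoint_swap huv hL (by omega),
    show L - (L - 1 - l) = l + 1 by omega, show L - (L - 1 - l + 1) = l by omega]
  exact hχ _ _ _ _

theorem edgeSum_swap_right (hχ : ∀ a b c d, χ a b d c = -χ a b c d) (hL : 0 < L) (huv : u' ≠ v') :
    edgeSum L χ u v v' u' = -edgeSum L χ u v u' v' := by
  unfold edgeSum
  rw [← Finset.sum_neg_distrib]
  refine Finset.sum_congr rfl fun l _ => ?_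
  rw [← Finset.sum_range_reflect, ← Finset.sum_neg_distrib]
  refine Finset.sum_congr rfl fun l' hl' => ?_
  have hl := Finset.mem_range.1 hl'
  rw [subdivisionPoint_swap huv hL (by omega), subdivisionPoint_swap huv hL (by omega),
    show L - (L - 1 - l') = l' + 1 by omega, show L - (L - 1 - l' + 1) = l' by omega]
  exact hχ _ _ _ _

end edgeSum

/-- The vertices of a subdivided closed walk. -/
def cycleIndex {r : ℕ} (L : ℕ) (c : ℕ → Fin r) (i : ℕ) : SubdivisionIndex r L :=
  subdivisionPoint L (c (i / L)) (c (i / L + 1)) (i % L)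

section cycleIndex

variable {r L : ℕ}

/-- The case `l = L` is included: the end of one subdivided edge is the start of the next. -/
theorem cycleIndex_mul_add (c : ℕ → Fin r) (hL : 0 < L) (i : ℕ) {l : ℕ} (hl : l ≤ L) :
    cycleIndex L c (i * L + l) = subdivisionPoint L (c i) (c (i + 1)) l := by
  unfold cycleIndex
  rcases hl.eq_or_lt with rfl | hl
  · rw [show i * l + l = (i + 1) * l by ring, Nat.mul_div_cancel _ hL, Nat.mul_mod_left,
      subdivisionPoint_zero, subdivisionPoint_length hL]
  · rw [mul_comm i L, Nat.mul_add_div hL, Nat.div_eq_of_lt hl, Nat.mul_add_mod,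
      Nat.mod_eq_of_lt hl, add_zero]

theorem cycleIndex_mul (c : ℕ → Fin r) (hL : 0 < L) (N : ℕ) :
    cycleIndex L c (N * L) = Sum.inl (c N) := by
  have := cycleIndex_mul_add c hL N (Nat.zero_le L)
  rwa [add_zero, subdivisionPoint_zero] at this

theorem cycleIndex_closed {c : ℕ → Fin r} (hL : 0 < L) {N : ℕ} (hc : c N = c 0) :
    cycleIndex L c (N * L) = cycleIndex L c 0 := by
  have := cycleIndex_mul c hL 0
  rw [zero_mul] at this
  rw [cycleIndex_mul c hL, this, hc]

theorem cycleIndex_ne_succ {c : ℕ → Fin r} (hL : 0 < L) (hc : ∀ i, c i ≠ c (i + 1)) (i : ℕ) :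
    cycleIndex L c i ≠ cycleIndex L c (i + 1) := by
  have h1 : i % L < L := Nat.mod_lt _ hL
  have e : i = i / L * L + i % L := (Nat.div_add_mod' i L).symm
  rw [e, add_assoc, cycleIndex_mul_add c hL _ h1.le, cycleIndex_mul_add c hL _ h1]
  exact subdivisionPoint_ne_succ (hc _) h1

theorem cycleIndex_ne {c d : ℕ → Fin r} (hcd : ∀ i j, c i ≠ d j) (i j : ℕ) :
    cycleIndex L c i ≠ cycleIndex L d j :=
  subdivisionPoint_ne (hcd _ _) (hcd _ _) (hcd _ _) (hcd _ _)

theorem cycleIndex_ne_inl {c : ℕ → Fin r} {y : Fin r} (hy : ∀ i, c i ≠ y) (i : ℕ) :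
    cycleIndex L c i ≠ Sum.inl y :=
  subdivisionPoint_ne_inl (hy _) (hy _)

theorem sum_range_mul' (N L : ℕ) (g : ℕ → ℤ) :
    ∑ x ∈ Finset.range (N * L), g x =
      ∑ i ∈ Finset.range N, ∑ l ∈ Finset.range L, g (i * L + l) := by
  induction N with
  | zero => simp
  | succ N ih => rw [Nat.succ_mul, Finset.sum_range_add, ih, Finset.sum_range_succ]

theorem sum_cycleIndex (hL : 0 < L) (χ : SubdivisionIndex r L → SubdivisionIndex r L →
    SubdivisionIndex r L → SubdivisionIndex r L → ℤ) (N N' : ℕ) (c d : ℕ → Fin r) :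
    ∑ i ∈ Finset.range (N * L), ∑ j ∈ Finset.range (N' * L),
        χ (cycleIndex L c i) (cycleIndex L c (i + 1)) (cycleIndex L d j) (cycleIndex L d (j + 1)) =
      ∑ i ∈ Finset.range N, ∑ j ∈ Finset.range N', edgeSum L χ (c i) (c (i + 1)) (d j) (d (j + 1)) := by
  rw [sum_range_mul']
  refine Finset.sum_congr rfl fun i _ => ?_
  simp only [sum_range_mul']
  rw [Finset.sum_comm]
  refine Finset.sum_congr rfl fun j _ => Finset.sum_congr rfl fun l hl =>
    Finset.sum_congr rfl fun l' hl' => ?_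
  have hl := Finset.mem_range.1 hl
  have hl' := Finset.mem_range.1 hl'
  rw [add_assoc, add_assoc, cycleIndex_mul_add c hL _ hl.le, cycleIndex_mul_add c hL _ hl,
    cycleIndex_mul_add d hL _ hl'.le, cycleIndex_mul_add d hL _ hl']

end cycleIndex

/-! ### Crossings of a generic drawing -/

section Drawing

variable {r L : ℕ} {v : Space} {z : SubdivisionIndex r L → Space}

/-- The signed number of overcrossings of the edge `a b` over the edge `c d`. -/
noncomputable def edgeOvercrossing (v : Space) (z : SubdivisionIndex r L → Space)
    (a b c d : Fin r) : ℤ :=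
  edgeSum L (fun i j k l => overcrossingSign v (z i) (z j) (z k) (z l)) a b c d

/-- The signed number of crossings of the edges `a b` and `c d` in the projection. -/
noncomputable def edgeCrossing (v : Space) (z : SubdivisionIndex r L → Space)
    (a b c d : Fin r) : ℤ :=
  edgeSum L (fun i j k l => crossingSign v (z i) (z j) (z k) (z l)) a b c d

theorem Generic.edgeCrossing_eq_sub (hz : Generic v z) {a b c d : Fin r} (hab : a ≠ b)
    (hac : a ≠ c) (had : a ≠ d) (hbc : b ≠ c) (hbd : b ≠ d) (hcd : c ≠ d) :
    edgeCrossing v z a b c d = edgeOvercrossing v z a b c d - edgeOvercrossing v z c d a b := by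
  unfold edgeOvercrossing edgeCrossing edgeSum
  rw [Finset.sum_comm (s := Finset.range L) (t := Finset.range L)
    (f := fun l l' => overcrossingSign v (z (subdivisionPoint L c d l))
      (z (subdivisionPoint L c d (l + 1))) (z (subdivisionPoint L a b l'))
      (z (subdivisionPoint L a b (l' + 1)))), ← Finset.sum_sub_distrib]
  refine Finset.sum_congr rfl fun l hl => ?_
  rw [← Finset.sum_sub_distrib]
  refine Finset.sum_congr rfl fun l' hl' => crossingSign_eq_sub ?_
  have h (i j : ℕ) : subdivisionPoint L a b i ≠ subdivisionPoint L c d j :=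
    subdivisionPoint_ne hac had hbc hbd
  exact hz.vol_ne _ _ _ _ (subdivisionPoint_ne_succ hab (Finset.mem_range.1 hl)) (h _ _) (h _ _)
    (h _ _) (h _ _) (subdivisionPoint_ne_succ hcd (Finset.mem_range.1 hl'))

/-- Disjoint closed walks have intersection number zero in the projection. -/
theorem Generic.sum_edgeCrossing_closed (hz : Generic v z) (hL : 0 < L) {N N' : ℕ}
    {c d : ℕ → Fin r} {y : Fin r} (hcN : c N = c 0) (hdN : d N' = d 0) (hc : ∀ i, c i ≠ c (i + 1))
    (hd : ∀ i, d i ≠ d (i + 1)) (hcd : ∀ i j, c i ≠ d j) (hcy : ∀ i, c i ≠ y)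
    (hdy : ∀ i, d i ≠ y) :
    ∑ i ∈ Finset.range N, ∑ j ∈ Finset.range N',
      edgeCrossing v z (c i) (c (i + 1)) (d j) (d (j + 1)) = 0 := by
  have h1 := hz.sum_crossingSign_path (cycleIndex_closed hL hcN)
    (fun i _ => cycleIndex_ne_succ hL hc i) (fun i _ => cycleIndex_ne_succ hL hd i)
    (cycleIndex_ne hcd) (cycleIndex_ne_inl hcy) (cycleIndex_ne_inl hdy) (M := N' * L)
  rw [cycleIndex_closed hL hdN, sub_self] at h1
  rw [← h1]
  exact (sum_cycleIndex hL (fun i j k l => crossingSign v (z i) (z j) (z k) (z l)) N N' c d).symm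

/-- The vertices of the closed polygon formed by the subdivided edge from `a` to `b` and the straight
edge back. -/
def loopIndex (L : ℕ) (a b : Fin r) (l : ℕ) : SubdivisionIndex r L :=
  if l ≤ L then subdivisionPoint L a b l else Sum.inl a

/-- The winding number of the closed polygon formed by the subdivided edge from `a` to `b` and the
straight edge back around the vertex `c`, counted along the segment from `c` to `y`. -/
noncomputable def edgeWinding (v : Space) (z : SubdivisionIndex r L → Space) (y a b c : Fin r) : ℤ :=
  ∑ l ∈ Finset.range (L + 1), crossingSign v (z (loopIndex L a b l)) (z (loopIndex L a b (l + 1)))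
    (z (Sum.inl c)) (z (Sum.inl y))

theorem loopIndex_of_le {a b : Fin r} {l : ℕ} (hl : l ≤ L) :
    loopIndex L a b l = subdivisionPoint L a b l := if_pos hl

theorem loopIndex_succ_length {a b : Fin r} : loopIndex L a b (L + 1) = Sum.inl a :=
  if_neg (by omega)

theorem loopIndex_zero {a b : Fin r} : loopIndex L a b 0 = Sum.inl a := by
  rw [loopIndex_of_le (Nat.zero_le L), subdivisionPoint_zero]

theorem loopIndex_ne_succ {a b : Fin r} (hL : 0 < L) (hab : a ≠ b) (l : ℕ) (hl : l < L + 1) :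
    loopIndex L a b l ≠ loopIndex L a b (l + 1) := by
  rcases (Nat.le_of_lt_succ hl).eq_or_lt with rfl | hl
  · rw [loopIndex_succ_length, loopIndex_of_le le_rfl, subdivisionPoint_length hL]
    simpa using hab.symm
  · rw [loopIndex_of_le hl.le, loopIndex_of_le hl]
    exact subdivisionPoint_ne_succ hab hl

theorem loopIndex_ne {a b c d : Fin r} (hac : a ≠ c) (had : a ≠ d) (hbc : b ≠ c) (hbd : b ≠ d)
    (l l' : ℕ) : loopIndex L a b l ≠ subdivisionPoint L c d l' := by
  unfold loopIndex
  split_ifs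
  · exact subdivisionPoint_ne hac had hbc hbd
  · exact (subdivisionPoint_ne_inl hac.symm had.symm).symm

theorem loopIndex_ne_inl {a b y : Fin r} (ha : a ≠ y) (hb : b ≠ y) (l : ℕ) :
    loopIndex L a b l ≠ Sum.inl y := by
  unfold loopIndex
  split_ifs
  · exact subdivisionPoint_ne_inl ha hb
  · simpa using ha

theorem sum_loopIndex (hL : 0 < L) (a b : Fin r)
    (g : SubdivisionIndex r L → SubdivisionIndex r L → ℤ) :
    ∑ l ∈ Finset.range (L + 1), g (loopIndex L a b l) (loopIndex L a b (l + 1)) =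
      ∑ l ∈ Finset.range L, g (subdivisionPoint L a b l) (subdivisionPoint L a b (l + 1)) +
        g (Sum.inl b) (Sum.inl a) := by
  rw [Finset.sum_range_succ, loopIndex_succ_length, loopIndex_of_le le_rfl,
    subdivisionPoint_length hL]
  congr 1
  refine Finset.sum_congr rfl fun l hl => ?_
  have hl := Finset.mem_range.1 hl
  rw [loopIndex_of_le hl.le, loopIndex_of_le hl]

/-- The crossings of two edges, compared with those of the straight edges. -/
theorem Generic.edgeCrossing_eq_straight (hz : Generic v z) (hL : 0 < L) {a b c d y : Fin r}
    (hab : a ≠ b) (hac : a ≠ c) (had : a ≠ d) (hbc : b ≠ c) (hbd : b ≠ d) (hcd : c ≠ d)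
    (hay : a ≠ y) (hby : b ≠ y) (hcy : c ≠ y) (hdy : d ≠ y) :
    edgeCrossing v z a b c d =
      crossingSign v (z (Sum.inl a)) (z (Sum.inl b)) (z (Sum.inl c)) (z (Sum.inl d)) +
        (edgeWinding v z y a b c - edgeWinding v z y a b d) -
        (edgeWinding v z y c d a - edgeWinding v z y c d b) := by
  have closed (a b : Fin r) : loopIndex L a b (L + 1) = loopIndex L a b 0 := by
    rw [loopIndex_succ_length, loopIndex_zero]
  -- The loop made of the edge ab and its straight return meets the path cd according to the winding
  -- numbers around c and d. Below, the loop on cd is compared with the straight segment ab;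
  -- together the two relations straighten both edges.
  have h1 := hz.sum_crossingSign_path (N := L + 1) (M := L) (A := loopIndex L a b)
    (B := subdivisionPoint L c d) (y := Sum.inl y) (closed a b) (loopIndex_ne_succ hL hab)
    (fun i hi => subdivisionPoint_ne_succ hcd hi) (loopIndex_ne hac had hbc hbd)
    (loopIndex_ne_inl hay hby) (fun i => subdivisionPoint_ne_inl hcy hdy)
  rw [sum_loopIndex hL a b fun i j => ∑ l ∈ Finset.range L, crossingSign v (z i) (z j)
    (z (subdivisionPoint L c d l)) (z (subdivisionPoint L c d (l + 1))),
    subdivisionPoint_zero, subdivisionPoint_length hL] at h1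
  have h2 := hz.sum_crossingSign_triangle (N := L + 1) (A := loopIndex L c d) (c := Sum.inl a)
    (d := Sum.inl b) (y := Sum.inl y) (closed c d) (loopIndex_ne_succ hL hcd) (by simpa using hab)
    (by simpa using hay) (by simpa using hby) (loopIndex_ne_inl hac.symm had.symm)
    (loopIndex_ne_inl hbc.symm hbd.symm) (loopIndex_ne_inl hcy hdy)
  rw [sum_loopIndex hL c d fun i j => crossingSign v (z i) (z j) (z (Sum.inl a)) (z (Sum.inl b)),
    crossingSign_swap v (z (Sum.inl a)) (z (Sum.inl b)) (z (Sum.inl d)) (z (Sum.inl c)),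
    crossingSign_swap_right v (z (Sum.inl a)) (z (Sum.inl b)) (z (Sum.inl c)) (z (Sum.inl d)),
    neg_neg] at h2
  have h3 : ∑ l ∈ Finset.range L, crossingSign v (z (Sum.inl b)) (z (Sum.inl a))
      (z (subdivisionPoint L c d l)) (z (subdivisionPoint L c d (l + 1))) =
      ∑ l ∈ Finset.range L, crossingSign v (z (subdivisionPoint L c d l))
        (z (subdivisionPoint L c d (l + 1))) (z (Sum.inl a)) (z (Sum.inl b)) := by
    refine Finset.sum_congr rfl fun l _ => ?_
    rw [crossingSign_swap_left v (z (Sum.inl a)) (z (Sum.inl b)), ← crossingSign_swap]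
  rw [h3] at h1
  have h1' : edgeCrossing v z a b c d + ∑ l ∈ Finset.range L,
      crossingSign v (z (subdivisionPoint L c d l))
        (z (subdivisionPoint L c d (l + 1))) (z (Sum.inl a)) (z (Sum.inl b)) =
      edgeWinding v z y a b c - edgeWinding v z y a b d := h1
  have h2' : ∑ l ∈ Finset.range L, crossingSign v (z (subdivisionPoint L c d l))
        (z (subdivisionPoint L c d (l + 1))) (z (Sum.inl a)) (z (Sum.inl b)) +
      crossingSign v (z (Sum.inl a)) (z (Sum.inl b)) (z (Sum.inl c)) (z (Sum.inl d)) =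
      edgeWinding v z y c d a - edgeWinding v z y c d b := h2
  linarith

/-- The crossings of the three pairs of opposite edges of a subdivided complete graph on four
vertices. -/
noncomputable def edgeQuad (v : Space) (z : SubdivisionIndex r L → Space) (a b c d : Fin r) : ℤ :=
  edgeCrossing v z a b c d + edgeCrossing v z a c b d + edgeCrossing v z a d b c

/-- A generic drawing of the complete graph on five vertices has an odd number of crossings between
disjoint edges. -/
theorem Generic.odd_sum_edgeQuad (hz : Generic v z) (hL : 0 < L) {h : ℕ → Fin r}
    (hh : ∀ i j, i < j → j < 6 → h i ≠ h j) :
    (edgeQuad v z (h 0) (h 1) (h 2) (h 3) + edgeQuad v z (h 0) (h 1) (h 2) (h 4) +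
      edgeQuad v z (h 0) (h 1) (h 3) (h 4) + edgeQuad v z (h 0) (h 2) (h 3) (h 4) +
      edgeQuad v z (h 1) (h 2) (h 3) (h 4)) % 2 = 1 := by
  have straight := odd_sum_quadCrossing (v := v) (z := fun i => z (Sum.inl (h i)))
    fun i j k hij hjk hk => hz.orient_ne _ _ _ (by simpa using hh i j hij (by omega))
      (by simpa using hh i k (by omega) (by omega)) (by simpa using hh j k hjk (by omega))
  have quad (a b c d : ℕ) (hab : a < b) (hbc : b < c) (hcd : c < d) (hd : d < 5) :
      edgeQuad v z (h a) (h b) (h c) (h d) =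
        quadCrossing v (z (Sum.inl (h a))) (z (Sum.inl (h b))) (z (Sum.inl (h c)))
          (z (Sum.inl (h d))) +
        (edgeWinding v z (h 5) (h a) (h b) (h c) - edgeWinding v z (h 5) (h a) (h b) (h d) -
          (edgeWinding v z (h 5) (h c) (h d) (h a) - edgeWinding v z (h 5) (h c) (h d) (h b))) +
        (edgeWinding v z (h 5) (h a) (h c) (h b) - edgeWinding v z (h 5) (h a) (h c) (h d) -
          (edgeWinding v z (h 5) (h b) (h d) (h a) - edgeWinding v z (h 5) (h b) (h d) (h c))) +
        (edgeWinding v z (h 5) (h a) (h d) (h b) - edgeWinding v z (h 5) (h a) (h d) (h c) -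
          (edgeWinding v z (h 5) (h b) (h c) (h a) - edgeWinding v z (h 5) (h b) (h c) (h d))) := by
    have ab := hh a b hab (by omega)
    have ac := hh a c (by omega) (by omega)
    have ad := hh a d (by omega) (by omega)
    have bc := hh b c hbc (by omega)
    have bd := hh b d (by omega) (by omega)
    have cd := hh c d hcd (by omega)
    have a5 := hh a 5 (by omega) (by omega)
    have b5 := hh b 5 (by omega) (by omega)
    have c5 := hh c 5 (by omega) (by omega)
    have d5 := hh d 5 (by omega) (by omega)
    unfold edgeQuad quadCrossing
    rw [hz.edgeCrossing_eq_straight hL ab ac ad bc bd cd a5 b5 c5 d5,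
      hz.edgeCrossing_eq_straight hL ac ab ad bc.symm cd bd a5 c5 b5 d5,
      hz.edgeCrossing_eq_straight hL ad ab ac bd.symm cd.symm bc a5 d5 b5 c5]
    ring
  -- The winding number of an edge around a vertex c off it appears once for each of the two edges
  -- from c to the remaining vertices, so all corrections cancel modulo 2.
  rw [quad 0 1 2 3 (by omega) (by omega) (by omega) (by omega),
    quad 0 1 2 4 (by omega) (by omega) (by omega) (by omega),
    quad 0 1 3 4 (by omega) (by omega) (by omega) (by omega),
    quad 0 2 3 4 (by omega) (by omega) (by omega) (by omega),
    quad 1 2 3 4 (by omega) (by omega) (by omega) (by omega)]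
  omega

end Drawing

/-! ### Linked cycles in generic drawings -/

theorem isAlternating_edgeOvercrossing {r L m : ℕ} {v : Space} {z : SubdivisionIndex r L → Space}
    (hL : 0 < L) {h : ℕ → Fin r} (hh : ∀ i j, i < m → j < m → i ≠ j → h i ≠ h j) :
    IsAlternating (fun i j k l => edgeOvercrossing v z (h i) (h j) (h k) (h l)) m where
  left i j _ _ hi hj hij :=
    edgeSum_swap_left (fun _ _ _ _ => overcrossingSign_swap_left _ _ _ _ _) hL (hh i j hi hj hij)
  right _ _ k l hk hl hkl :=
    edgeSum_swap_right (fun _ _ _ _ => overcrossingSign_swap_right _ _ _ _ _) hL (hh k l hk hl hkl)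

theorem exists_isHomogeneous (m M : ℕ) [NeZero M] (hm : 0 < m) : ∃ r : ℕ,
    ∀ O : Fin r → Fin r → Fin r → Fin r → ℤ, ∃ h : ℕ → Fin r,
      (∀ i j, i < m → j < m → i ≠ j → h i ≠ h j) ∧ ∃ α₁ α₂ β₁ β₂ γ₁ γ₂ : ZMod M,
        IsHomogeneous (fun i j k l => O (h i) (h j) (h k) (h l)) m M α₁ α₂ β₁ β₂ γ₁ γ₂ := by
  obtain ⟨r, hr⟩ := ramsey_strictMono (Fin 6 → ZMod M) 4 m
  refine ⟨r, fun O => ?_⟩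
  -- The colour of a four-element set lists the residues for separated, interlaced and nested pairs
  -- of opposite edges, each in both orders.
  obtain ⟨h, hh, c, hc⟩ := hr fun s => ![(O (s 0) (s 1) (s 2) (s 3) : ZMod M),
    (O (s 2) (s 3) (s 0) (s 1) : ZMod M), (O (s 0) (s 2) (s 1) (s 3) : ZMod M),
    (O (s 1) (s 3) (s 0) (s 2) : ZMod M), (O (s 0) (s 3) (s 1) (s 2) : ZMod M),
    (O (s 1) (s 2) (s 0) (s 3) : ZMod M)]
  have key (i j k l : ℕ) (hij : i < j) (hjk : j < k) (hkl : k < l) (hl : l < m) (x : Fin 6) :=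
    congrFun (hc ![⟨i % m, Nat.mod_lt _ hm⟩, ⟨j % m, Nat.mod_lt _ hm⟩, ⟨k % m, Nat.mod_lt _ hm⟩,
      ⟨l % m, Nat.mod_lt _ hm⟩] (by
        rw [Fin.strictMono_iff_lt_succ]
        intro x
        fin_cases x <;> simp [Fin.lt_def, Nat.mod_eq_of_lt hl, Nat.mod_eq_of_lt (hkl.trans hl),
          Nat.mod_eq_of_lt (hjk.trans (hkl.trans hl)),
          Nat.mod_eq_of_lt (hij.trans (hjk.trans (hkl.trans hl))), hij, hjk, hkl])) x
  refine ⟨fun i => h ⟨i % m, Nat.mod_lt _ hm⟩, fun i j hi hj hij e => hij ?_,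
    c 0, c 1, c 2, c 3, c 4, c 5, ?_⟩
  · have := congrArg Fin.val (hh.injective e)
    simpa [Nat.mod_eq_of_lt hi, Nat.mod_eq_of_lt hj] using this
  · exact ⟨fun i j k l a b c d => key i j k l a b c d 0, fun i j k l a b c d => key i j k l a b c d 1,
      fun i j k l a b c d => key i j k l a b c d 2, fun i j k l a b c d => key i j k l a b c d 3,
      fun i j k l a b c d => key i j k l a b c d 4, fun i j k l a b c d => key i j k l a b c d 5⟩

/-- The difference of the two sides is the signed number of all crossings of two disjoint closed
curves in the plane, which is zero. The vertex `y` serves as the base point of the winding numbers.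
-/
theorem Generic.cycleSum_comm {r L m : ℕ} {v : Space} {z : SubdivisionIndex r L → Space}
    (hz : Generic v z) (hL : 0 < L) {h : ℕ → Fin r}
    (hh : ∀ i j, i < m → j < m → i ≠ j → h i ≠ h j) {N N' : ℕ} {c d : ℕ → ℕ} {y : ℕ}
    (hcN : c N = c 0) (hdN : d N' = d 0) (hcm : ∀ i, c i < m) (hdm : ∀ i, d i < m) (hym : y < m)
    (hc : ∀ i, c i ≠ c (i + 1)) (hd : ∀ i, d i ≠ d (i + 1)) (hcd : ∀ i j, c i ≠ d j)
    (hcy : ∀ i, c i ≠ y) (hdy : ∀ i, d i ≠ y) :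
    cycleSum (fun i j k l => edgeOvercrossing v z (h i) (h j) (h k) (h l)) N N' c d =
      cycleSum (fun i j k l => edgeOvercrossing v z (h i) (h j) (h k) (h l)) N' N d c := by
  have hcc (i : ℕ) := hh _ _ (hcm i) (hcm (i + 1)) (hc i)
  have hdd (i : ℕ) := hh _ _ (hdm i) (hdm (i + 1)) (hd i)
  have hcd' (i j : ℕ) := hh _ _ (hcm i) (hdm j) (hcd i j)
  have := hz.sum_edgeCrossing_closed hL (c := fun i => h (c i)) (d := fun i => h (d i)) (N := N)
    (N' := N') (y := h y) (by simp only [hcN]) (by simp only [hdN]) hcc hdd hcd'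
    (fun i => hh _ _ (hcm i) hym (hcy i)) (fun i => hh _ _ (hdm i) hym (hdy i))
  rw [← sub_eq_zero, ← this]
  unfold cycleSum
  rw [Finset.sum_comm (s := Finset.range N') (t := Finset.range N), ← Finset.sum_sub_distrib]
  refine Finset.sum_congr rfl fun i _ => ?_
  rw [← Finset.sum_sub_distrib]
  refine Finset.sum_congr rfl fun j _ => ?_
  exact (hz.edgeCrossing_eq_sub (hcc i) (hcd' _ _) (hcd' _ _) (hcd' _ _) (hcd' _ _) (hdd j)).symm

/-- A generic drawing of a sufficiently large complete graph contains `n` disjoint cycles with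
`2 ^ t + 2` edges any two of which have linking number at least `2 ^ t`, in terms of crossings. -/
theorem exists_linked_cycles (n : ℕ) {t : ℕ} (ht : 0 < t) : ∃ r : ℕ, ∀ L : ℕ, 0 < L →
    ∀ (v : Space) (z : SubdivisionIndex r L → Space), Generic v z → ∃ h : ℕ → Fin r,
      (∀ i j, i < n * (2 ^ t + 2) → j < n * (2 ^ t + 2) → i ≠ j → h i ≠ h j) ∧
      ∀ a b, a < b → b < n → 2 ^ t ≤ |∑ i ∈ Finset.range (2 ^ t + 2), ∑ j ∈ Finset.range (2 ^ t + 2),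
        edgeOvercrossing v z (h (n * (i % (2 ^ t + 2)) + a)) (h (n * ((i + 1) % (2 ^ t + 2)) + a))
          (h (n * (j % (2 ^ t + 2)) + b)) (h (n * ((j + 1) % (2 ^ t + 2)) + b))| := by
  -- The 7 extra vertices guarantee room for two triangles and a base point, and for K₅ with a base
  -- point, however small `n` is.
  obtain ⟨r, hr⟩ := exists_isHomogeneous (n * (2 ^ t + 2) + 7) (2 ^ (t + 1)) (by omega)
  refine ⟨r, fun L hL v z hz => ?_⟩
  obtain ⟨h, hh, α₁, α₂, β₁, β₂, γ₁, γ₂, H⟩ := hr (edgeOvercrossing v z)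
  refine ⟨h, fun i j hi hj => hh i j (by omega) (by omega), fun a b hab hb => ?_⟩
  set m := n * (2 ^ t + 2) + 7 with hm
  set w : ℕ → ℕ → ℕ → ℕ → ℤ := fun i j k l => edgeOvercrossing v z (h i) (h j) (h k) (h l) with hw
  have alt : IsAlternating w m := isAlternating_edgeOvercrossing hL hh
  have hα : α₁ = α₂ := by
    rw [← (H.cycleSum_triangles alt (by omega)).1, ← (H.cycleSum_triangles alt (by omega)).2]
    congr 1
    exact hz.cycleSum_comm hL hh (y := 6) (by simp) (by simp) (fun i => by omega)
      (fun i => by omega) (by omega) (fun i => by omega) (fun i => by omega) (fun i j => by omega)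
      (fun i => by omega) (fun i => by omega)
  subst hα
  have key := H.cycleSum_interleaved alt hab hb (k := 2 ^ t) (by omega)
  have a₁ := H.alpha₁ 0 1 2 3 (by omega) (by omega) (by omega) (by omega)
  have b₁ := H.beta₁ 0 1 2 3 (by omega) (by omega) (by omega) (by omega)
  have b₂ := H.beta₂ 0 1 2 3 (by omega) (by omega) (by omega) (by omega)
  have g₁ := H.gamma₁ 0 1 2 3 (by omega) (by omega) (by omega) (by omega)
  have g₂ := H.gamma₂ 0 1 2 3 (by omega) (by omega) (by omega) (by omega)
  set B : ℤ := w 0 2 1 3 + w 1 3 0 2 - w 0 3 1 2 - w 1 2 0 3 with hB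
  have quad (i j k l : ℕ) (hij : i < j) (hjk : j < k) (hkl : k < l) (hl : l < 5) :
      edgeQuad v z (h i) (h j) (h k) (h l) % 2 = B % 2 := by
    have hij' := hh i j (by omega) (by omega) (by omega)
    have hik' := hh i k (by omega) (by omega) (by omega)
    have hil' := hh i l (by omega) (by omega) (by omega)
    have hjk' := hh j k (by omega) (by omega) (by omega)
    have hjl' := hh j l (by omega) (by omega) (by omega)
    have hkl' := hh k l (by omega) (by omega) (by omega)
    have e : edgeQuad v z (h i) (h j) (h k) (h l) = w i j k l - w k l i j + (w i k j l - w j l i k)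
        + (w i l j k - w j k i l) := by
      unfold edgeQuad
      rw [hz.edgeCrossing_eq_sub hij' hik' hil' hjk' hjl' hkl',
        hz.edgeCrossing_eq_sub hik' hij' hil' hjk'.symm hkl' hjl',
        hz.edgeCrossing_eq_sub hil' hij' hik' hjl'.symm hkl'.symm hjk']
    have hlm : l < m := by omega
    -- The separated pairs cancel because α₁ = α₂, and the even correction turns β₁ - β₂ + γ₁ - γ₂
    -- into `B`. Parity can be read off since the modulus is even.
    have e' : ((edgeQuad v z (h i) (h j) (h k) (h l) + 2 * (w 1 3 0 2 - w 0 3 1 2) : ℤ) :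
        ZMod (2 ^ (t + 1))) = (B : ℤ) := by
      rw [e, hB]
      push_cast
      rw [H.alpha₁ i j k l hij hjk hkl hlm, H.alpha₂ i j k l hij hjk hkl hlm,
        H.beta₁ i j k l hij hjk hkl hlm, H.beta₂ i j k l hij hjk hkl hlm,
        H.gamma₁ i j k l hij hjk hkl hlm, H.gamma₂ i j k l hij hjk hkl hlm, b₁, b₂, g₁, g₂]
      ring
    rw [ZMod.intCast_eq_intCast_iff, Int.modEq_iff_dvd] at e'
    have h2 : (2 : ℤ) ∣ ((2 ^ (t + 1) : ℕ) : ℤ) := by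
      push_cast; exact dvd_pow_self 2 (Nat.succ_ne_zero t)
    have := h2.trans e'
    omega
  -- The five K₄ inside K₅ all have the parity of `B`, and their total is odd.
  have hBodd : B % 2 = 1 := by
    have odd := hz.odd_sum_edgeQuad hL (h := h) fun i j hij hj =>
      hh i j (by omega) (by omega) hij.ne
    have q1 := quad 0 1 2 3 (by omega) (by omega) (by omega) (by omega)
    have q2 := quad 0 1 2 4 (by omega) (by omega) (by omega) (by omega)
    have q3 := quad 0 1 3 4 (by omega) (by omega) (by omega) (by omega)
    have q4 := quad 0 2 3 4 (by omega) (by omega) (by omega) (by omega)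
    have q5 := quad 1 2 3 4 (by omega) (by omega) (by omega) (by omega)
    omega
  refine two_pow_le_abs ht (A := w 0 1 2 3) hBodd (Eq.trans key ?_)
  rw [hB]
  push_cast
  rw [a₁, b₁, b₂, g₁, g₂]

/-! ### Cycles in embedded complete graphs -/

/-- The piecewise linear hat function. -/
def hat (y : ℝ) : ℝ := max 0 (1 - |y|)

theorem continuous_hat : Continuous hat := by unfold hat; fun_prop

theorem hat_eq_zero {y : ℝ} (hy : 1 ≤ |y|) : hat y = 0 := max_eq_left (by linarith)

theorem hat_eq {y : ℝ} (hy : |y| ≤ 1) : hat y = 1 - |y| := max_eq_right (by linarith)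

section cyclePath

variable {V : Type*} [DecidableEq V]

/-- The edge from `u` to `v` in the geometric realization of a graph. -/
noncomputable def edgePath (u v : V) (s : ℝ) : V → ℝ :=
  AffineMap.lineMap (Pi.single u (1 : ℝ) : V → ℝ) (Pi.single v (1 : ℝ) : V → ℝ) s

theorem edgePath_zero (u v : V) : edgePath u v 0 = Pi.single u 1 := AffineMap.lineMap_apply_zero _ _

theorem edgePath_one (u v : V) : edgePath u v 1 = Pi.single v 1 := AffineMap.lineMap_apply_one _ _

/-- The closed path with vertices `c 0, …, c m` in the geometric realization of a graph. -/
noncomputable def cyclePath (c : ℕ → V) (m : ℕ) (x : ℝ) : V → ℝ :=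
  ∑ j ∈ Finset.range (m + 1), hat (m * x - j) • (Pi.single (c j) (1 : ℝ) : V → ℝ)

theorem continuous_cyclePath (c : ℕ → V) (m : ℕ) : Continuous (cyclePath c m) := by
  unfold cyclePath
  refine continuous_finsetSum _ fun j _ => Continuous.smul (f := fun x => hat (m * x - j)) ?_
    continuous_const
  exact continuous_hat.comp (by fun_prop)

/-- On the i-th parameter interval at most the hats centred at `i` and `i + 1` are nonzero, with
values `1 - s` and `s`. -/
theorem cyclePath_eq (c : ℕ → V) {m i : ℕ} (hi : i < m) {s : ℝ} (hs : s ∈ Icc (0 : ℝ) 1) :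
    cyclePath c m ((i + s) / m) =
      edgePath (c i) (c (i + 1)) s := by
  have hm : (m : ℝ) ≠ 0 := by exact_mod_cast (by omega : m ≠ 0)
  unfold cyclePath edgePath
  rw [mul_div_cancel₀ _ hm, Finset.sum_eq_add_of_mem i (i + 1) (Finset.mem_range.2 (by omega))
    (Finset.mem_range.2 (by omega)) (by omega)]
  · rw [AffineMap.lineMap_apply_module, add_sub_cancel_left, hat_eq (by rw [abs_of_nonneg hs.1]; exact hs.2),
      abs_of_nonneg hs.1]
    push_cast
    have e : (i : ℝ) + s - (i + 1) = -(1 - s) := by ring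
    have h1 : 0 ≤ 1 - s := by linarith [hs.2]
    rw [e, hat_eq (by rw [abs_neg, abs_of_nonneg h1]; linarith [hs.1]), abs_neg, abs_of_nonneg h1,
      sub_sub_cancel]
  · rintro j - ⟨h1, h2⟩
    rw [hat_eq_zero, zero_smul]
    rcases lt_or_gt_of_ne h1 with h | h
    · have : (j : ℝ) + 1 ≤ i := by exact_mod_cast h
      rw [abs_of_nonneg (by linarith [hs.1])]
      linarith [hs.1]
    · have : (i : ℝ) + 1 + 1 ≤ j := by exact_mod_cast (by omega : i + 1 + 1 ≤ j)
      rw [abs_of_neg (by linarith [hs.2])]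
      linarith [hs.2]

theorem exists_eq_add_div {m : ℕ} (hm : 0 < m) {x : ℝ} (hx : x ∈ Ico (0 : ℝ) 1) :
    ∃ i < m, ∃ s ∈ Ico (0 : ℝ) 1, x = (i + s) / m := by
  have hm' : (0 : ℝ) < m := by exact_mod_cast hm
  have h0 : 0 ≤ m * x := mul_nonneg hm'.le hx.1
  refine ⟨⌊m * x⌋₊, (Nat.floor_lt h0).2 (by nlinarith [hx.2]), m * x - ⌊m * x⌋₊,
    ⟨sub_nonneg.2 (Nat.floor_le h0), by linarith [Nat.lt_floor_add_one (m * x)]⟩, ?_⟩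
  rw [add_sub_cancel, mul_div_cancel_left₀ _ hm'.ne']

theorem edgePath_apply (u v w : V) (s : ℝ) :
    edgePath u v s w =
      (1 - s) * (if w = u then 1 else 0) + s * (if w = v then 1 else 0) := by
  rw [edgePath, AffineMap.lineMap_apply_module]
  simp [Pi.single_apply]

/-- The closed path with vertices `c 0, …, c m`, as a map of the circle. -/
noncomputable def cycleLoop (c : ℕ → V) (m : ℕ) : UnitAddCircle → V → ℝ :=
  AddCircle.liftIco 1 0 (cyclePath c m)

theorem cycleLoop_coe (c : ℕ → V) {m i : ℕ} (hi : i < m) {s : ℝ} (hs : s ∈ Ico (0 : ℝ) 1) :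
    cycleLoop c m (((i + s) / m : ℝ) : UnitAddCircle) =
      edgePath (c i) (c (i + 1)) s := by
  have hm' : (0 : ℝ) < m := by exact_mod_cast (by omega : 0 < m)
  have hi' : (i : ℝ) + 1 ≤ m := by exact_mod_cast hi
  rw [← cyclePath_eq c hi (Ico_subset_Icc_self hs)]
  refine AddCircle.liftIco_coe_apply ⟨div_nonneg (add_nonneg (Nat.cast_nonneg i) hs.1) hm'.le, ?_⟩
  rw [zero_add, div_lt_one hm']
  linarith [hs.2]

theorem continuous_cycleLoop {c : ℕ → V} {m : ℕ} (hm : 0 < m) (hc : c m = c 0) :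
    Continuous (cycleLoop c m) := by
  refine AddCircle.liftIco_continuous ?_ (continuous_cyclePath c m).continuousOn
  have h0 := cyclePath_eq c hm (s := 0) (by simp)
  have h1 := cyclePath_eq c (Nat.sub_lt hm one_pos) (s := 1) (by simp)
  have hm' : (m : ℝ) ≠ 0 := by exact_mod_cast hm.ne'
  rw [Nat.cast_sub (show 1 ≤ m from hm), Nat.sub_add_cancel (show 1 ≤ m from hm), hc] at h1
  simp only [Nat.cast_one, sub_add_cancel, div_self hm', edgePath_one] at h1
  simp only [Nat.cast_zero, add_zero, zero_div, edgePath_zero] at h0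
  rw [zero_add, h0, h1]

theorem exists_cycleLoop_eq (c : ℕ → V) {m : ℕ} (hm : 0 < m) (θ : UnitAddCircle) :
    ∃ i < m, ∃ s ∈ Ico (0 : ℝ) 1, θ = (((i + s) / m : ℝ) : UnitAddCircle) ∧ cycleLoop c m θ =
      edgePath (c i) (c (i + 1)) s := by
  obtain ⟨x, hx, rfl⟩ : ∃ x ∈ Ico (0 : ℝ) 1, (x : UnitAddCircle) = θ := by
    have := AddCircle.coe_image_Ico_eq (1 : ℝ) 0
    rw [zero_add] at this
    exact this.ge (mem_univ θ)
  obtain ⟨i, hi, s, hs, rfl⟩ := exists_eq_add_div hm hx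
  exact ⟨i, hi, s, hs, rfl, cycleLoop_coe c hi hs⟩

theorem edgePath_mem (u v : V) (huv : u ≠ v) {s : ℝ} (hs : s ∈ Icc (0 : ℝ) 1) :
    edgePath u v s ∈
      graphRealization (⊤ : SimpleGraph V) :=
  Or.inr ⟨u, v, by simpa using huv, by rw [segment_eq_image_lineMap]; exact ⟨s, hs, rfl⟩⟩

theorem cycleLoop_mem {c : ℕ → V} {m : ℕ} (hm : 0 < m) (hc : ∀ i, c i ≠ c (i + 1))
    (θ : UnitAddCircle) : cycleLoop c m θ ∈ graphRealization (⊤ : SimpleGraph V) := by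
  obtain ⟨i, -, s, hs, -, e⟩ := exists_cycleLoop_eq c hm θ
  rw [e]
  exact edgePath_mem _ _ (hc i) (Ico_subset_Icc_self hs)

/-- A point of a half-open edge has positive weight at its initial vertex. Comparing weights at `c
i` and `c j`, two different edges through the same point would have to be reverses of each other,
which `3 ≤ m` excludes. -/
theorem cycleLoop_injective {c : ℕ → V} {m : ℕ} (hm : 3 ≤ m)
    (hc : ∀ i j, c i = c j → i % m = j % m) : Function.Injective (cycleLoop c m) := by
  intro θ φ e
  have succ_cases (i : ℕ) (hi : i < m) : (i + 1 < m ∧ (i + 1) % m = i + 1) ∨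
      (i + 1 = m ∧ (i + 1) % m = 0) := by
    rcases (show i + 1 ≤ m from hi).eq_or_lt with h | h
    · exact Or.inr ⟨h, by rw [h, Nat.mod_self]⟩
    · exact Or.inl ⟨h, Nat.mod_eq_of_lt h⟩
  have ne_succ (i : ℕ) (hi : i < m) : c i ≠ c (i + 1) := fun h => by
    have := hc _ _ h
    rw [Nat.mod_eq_of_lt hi] at this
    rcases succ_cases i hi with h | h <;> omega
  obtain ⟨i, hi, s, hs, rfl, e1⟩ := exists_cycleLoop_eq c (by omega : 0 < m) θ
  obtain ⟨j, hj, t, ht, rfl, e2⟩ := exists_cycleLoop_eq c (by omega : 0 < m) φ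
  rw [e1, e2] at e
  have hi1 := congrFun e (c i)
  have hj1 := congrFun e (c j)
  rw [edgePath_apply, edgePath_apply, if_pos rfl, if_neg (ne_succ i hi)] at hi1
  rw [edgePath_apply, edgePath_apply, if_pos rfl, if_neg (ne_succ j hj)] at hj1
  by_cases hij : c i = c j
  · have hij' := hc _ _ hij
    rw [Nat.mod_eq_of_lt hi, Nat.mod_eq_of_lt hj] at hij'
    subst hij'
    rw [if_pos rfl, if_neg (ne_succ i hi)] at hi1
    have : s = t := by linarith
    rw [this]
  · rw [if_neg hij] at hi1
    rw [if_neg (Ne.symm hij)] at hj1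
    by_cases h1 : c i = c (j + 1)
    · by_cases h2 : c j = c (i + 1)
      · have h1 := hc _ _ h1
        have h2 := hc _ _ h2
        rw [Nat.mod_eq_of_lt hi] at h1
        rw [Nat.mod_eq_of_lt hj] at h2
        rcases succ_cases i hi with h | h <;> rcases succ_cases j hj with h' | h' <;> omega
      · rw [if_neg h2] at hj1
        linarith [ht.2]
    · rw [if_neg h1] at hi1
      linarith [hs.2]

theorem cycleLoop_ne {c d : ℕ → V} {m : ℕ} (hm : 0 < m) (hc : ∀ i, c i ≠ c (i + 1))
    (hcd : ∀ i j, c i ≠ d j) (θ φ : UnitAddCircle) : cycleLoop c m θ ≠ cycleLoop d m φ := by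
  intro e
  obtain ⟨i, hi, s, hs, -, e1⟩ := exists_cycleLoop_eq c hm θ
  obtain ⟨j, hj, t, ht, -, e2⟩ := exists_cycleLoop_eq d hm φ
  rw [e1, e2] at e
  have := congrFun e (c i)
  rw [edgePath_apply, edgePath_apply, if_pos rfl, if_neg (hc i), if_neg (hcd i j),
    if_neg (hcd i (j + 1))] at this
  linarith [hs.2]

/-- The image of a closed walk under a map of the geometric realization of a complete graph. -/
noncomputable def embeddedLoop (f : graphRealization (⊤ : SimpleGraph V) → Space)
    (hf : Continuous f) {c : ℕ → V} {m : ℕ} (hm : 0 < m) (hcm : c m = c 0)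
    (hc : ∀ i, c i ≠ c (i + 1)) : C(UnitAddCircle, Space) where
  toFun θ := f ⟨cycleLoop c m θ, cycleLoop_mem hm hc θ⟩
  continuous_toFun := hf.comp ((continuous_cycleLoop hm hcm).subtype_mk _)

/-- The extension of `f` by zero. -/
noncomputable def extendZero (f : graphRealization (⊤ : SimpleGraph V) → Space) (x : V → ℝ) :
    Space := by
  classical exact if hx : x ∈ graphRealization (⊤ : SimpleGraph V) then f ⟨x, hx⟩ else 0

theorem embeddedLoop_apply {f : graphRealization (⊤ : SimpleGraph V) → Space}
    (hf : Continuous f) {c : ℕ → V} {m : ℕ} (hm : 0 < m) (hcm : c m = c 0)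
    (hc : ∀ i, c i ≠ c (i + 1)) (θ : UnitAddCircle) :
    embeddedLoop f hf hm hcm hc θ = extendZero f (cycleLoop c m θ) := by
  unfold extendZero
  rw [dif_pos (cycleLoop_mem hm hc θ)]
  rfl

end cyclePath

/-! ### Generic approximation of an embedded complete graph. -/

/-- The points on the image of the complete graph that correspond to the vertices of its
subdivision. -/
noncomputable def subdivisionMap {r : ℕ} (L : ℕ)
    (f : graphRealization (⊤ : SimpleGraph (Fin r)) → Space) : SubdivisionIndex r L → Space :=
  Sum.elim (fun u => extendZero f (Pi.single u 1)) fun x => extendZero f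
    (edgePath x.1 x.2.1 ((x.2.2 : ℕ) / (L : ℝ)))

theorem subdivisionMap_subdivisionPoint {r L : ℕ}
    (f : graphRealization (⊤ : SimpleGraph (Fin r)) → Space) (hL : 0 < L) (u v : Fin r) {l : ℕ}
    (hl : l ≤ L) : subdivisionMap L f (subdivisionPoint L u v l) = extendZero f
      (edgePath u v (l / (L : ℝ))) := by
  have hL' : (L : ℝ) ≠ 0 := by exact_mod_cast hL.ne'
  unfold subdivisionPoint subdivisionMap
  split_ifs with h1 h2 h3
  · simp [h1, edgePath_zero]
  · have : l = L := le_antisymm hl h2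
    rw [this, div_self hL', edgePath_one]
    rfl
  · simp only [Sum.elim_inr, Fin.val_ofNat, Nat.mod_eq_of_lt (Nat.lt_succ_of_le hl)]
  · simp only [Sum.elim_inr, Fin.val_ofNat, Nat.mod_eq_of_lt (Nat.lt_succ_of_le (Nat.sub_le L l))]
    rw [Nat.cast_sub hl, sub_div, div_self hL', edgePath, AffineMap.lineMap_apply_one_sub, edgePath]

/-- The parameter `i / (m * L)` lies on edge number `i / L` at the fraction `(i % L) / L`. The
inscribed polygons of all cycles of length `m` thus have their vertices in one finite family, which
can be perturbed once for all. -/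
theorem inscribedPolygon_embeddedLoop {r L : ℕ}
    {f : graphRealization (⊤ : SimpleGraph (Fin r)) → Space} (hf : Continuous f) {c : ℕ → Fin r}
    {m : ℕ} (hm : 0 < m) (hcm : c m = c 0) (hc : ∀ i, c i ≠ c (i + 1)) (hL : 0 < L) {i : ℕ}
    (hi : i ≤ m * L) : inscribedPolygon (embeddedLoop f hf hm hcm hc) (m * L) i =
      subdivisionMap L f (cycleIndex L c i) := by
  have main (i : ℕ) (hi : i < m * L) : inscribedPolygon (embeddedLoop f hf hm hcm hc) (m * L) i =
      subdivisionMap L f (cycleIndex L c i) := by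
    have hL' : (0 : ℝ) < L := by exact_mod_cast hL
    have hm' : (0 : ℝ) < m := by exact_mod_cast hm
    have h1 : i % L < L := Nat.mod_lt _ hL
    have h1' : ((i % L : ℕ) : ℝ) < L := by exact_mod_cast h1
    have h2 : i / L < m := Nat.div_lt_of_lt_mul (by rwa [mul_comm] at hi)
    have e : (i : ℝ) / ((m * L : ℕ) : ℝ) = ((i / L : ℕ) + (i % L : ℕ) / (L : ℝ)) / m := by
      have := (Nat.div_add_mod' i L).symm
      nth_rewrite 1 [this]
      push_cast
      field_simp
    unfold inscribedPolygon cycleIndex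
    rw [subdivisionMap_subdivisionPoint f hL _ _ h1.le, embeddedLoop_apply, e,
      cycleLoop_coe c h2 ⟨by positivity, (div_lt_one hL').2 h1'⟩]
  rcases hi.eq_or_lt with rfl | hi
  · rw [inscribedPolygon_self _ (Nat.mul_pos hm hL), cycleIndex_closed hL hcm,
      main 0 (Nat.mul_pos hm hL)]
  · exact main i hi

/-- A vertex projecting to an edge would be collinear in the projection with the ends of that edge.
-/
theorem Generic.isRegularDirection {ι : Type*} {v : Space} {z : ι → Space} (hz : Generic v z)
    {N : ℕ} {A B : ℕ → ι} (hA : ∀ i, A i ≠ A (i + 1)) (hB : ∀ i, B i ≠ B (i + 1))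
    (hAB : ∀ i j, A i ≠ B j) :
    IsRegularDirection N (fun i => z (A i)) (fun i => z (B i)) v := by
  have key {a c d : Space} {t h : ℝ} (e : a = AffineMap.lineMap c d t + h • v) :
      orient v a c d = 0 := by
    have e' (i : Fin 3) : a i = t * (d i - c i) + c i + h * v i := by
      simpa [AffineMap.lineMap_apply] using congrFun e i
    simp only [orient, det3, Pi.sub_apply, e']
    ring
  refine ⟨?_, fun i _ j _ t _ h => ⟨fun e => ?_, fun e => ?_⟩⟩
  · rintro rfl
    refine hz.orient_ne _ _ _ (hA 0) (hAB 0 0) (hAB 1 0) ?_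
    simp [orient, det3]
  · exact hz.orient_ne _ _ _ (hAB i j) (hAB i (j + 1)) (hB j) (key e)
  · exact hz.orient_ne _ _ _ (hAB j i).symm (hAB (j + 1) i).symm (hA j) (key e)

/-- The periodic extension of a sequence of length `m`. -/
def periodicExtension {V : Type*} {m : ℕ} (hm : 0 < m) (c : Fin m → V) (i : ℕ) : V :=
  c ⟨i % m, Nat.mod_lt i hm⟩

theorem periodicExtension_length {V : Type*} {m : ℕ} (hm : 0 < m) (c : Fin m → V) :
    periodicExtension hm c m = periodicExtension hm c 0 := by
  simp [periodicExtension]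

theorem disjoint_range_embeddedLoop {V : Type*} [DecidableEq V]
    {f : graphRealization (⊤ : SimpleGraph V) → Space} (hf : Continuous f)
    (hinj : Function.Injective f) {c d : ℕ → V} {m : ℕ} (hm : 0 < m) (hcm : c m = c 0)
    (hdm : d m = d 0) (hc : ∀ i, c i ≠ c (i + 1)) (hd : ∀ i, d i ≠ d (i + 1))
    (hcd : ∀ i j, c i ≠ d j) :
    Disjoint (range (embeddedLoop f hf hm hcm hc)) (range (embeddedLoop f hf hm hdm hd)) := by
  rw [Set.disjoint_left]
  rintro _ ⟨θ, rfl⟩ ⟨φ, e⟩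
  exact cycleLoop_ne hm hc hcd θ φ (congrArg Subtype.val (hinj e)).symm

/-- There is a generic piecewise linear approximation of an embedded complete graph such that the
linking number of any two disjoint cycles with `m` edges is given by the crossings of the
approximation. -/
theorem exists_generic_approximation {r m : ℕ} (hm : 2 ≤ m) (hm0 : 0 < m)
    {f : graphRealization (⊤ : SimpleGraph (Fin r)) → Space} (hf : Continuous f)
    (hinj : Function.Injective f) :
    ∃ L > 0, ∃ (v : Space) (z : SubdivisionIndex r L → Space), Generic v z ∧
      ∀ (c d : Fin m → Fin r)
        (hc : ∀ i, periodicExtension hm0 c i ≠ periodicExtension hm0 c (i + 1))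
        (hd : ∀ i, periodicExtension hm0 d i ≠ periodicExtension hm0 d (i + 1)),
        (∀ i j, c i ≠ d j) →
        HasLinkingNumber (embeddedLoop f hf hm0 (periodicExtension_length hm0 c) hc)
          (embeddedLoop f hf hm0 (periodicExtension_length hm0 d) hd)
          (∑ i ∈ Finset.range m, ∑ j ∈ Finset.range m, edgeOvercrossing v z
            (periodicExtension hm0 c i) (periodicExtension hm0 c (i + 1))
            (periodicExtension hm0 d j) (periodicExtension hm0 d (j + 1))) := by
  set P : (Fin m → Fin r) → ℕ → Fin r := fun c => periodicExtension hm0 c with hP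
  have hPm (c : Fin m → Fin r) : P c m = P c 0 := periodicExtension_length hm0 c
  have lk (c d : Fin m → Fin r) : ∃ k, ∀ (hc : ∀ i, P c i ≠ P c (i + 1))
      (hd : ∀ i, P d i ≠ P d (i + 1)), (∀ i j, c i ≠ d j) → ∀ᶠ N : ℕ in atTop,
        PolygonsDisjoint N (inscribedPolygon (embeddedLoop f hf hm0 (hPm c) hc) N)
            (inscribedPolygon (embeddedLoop f hf hm0 (hPm d) hd) N) ∧
          HasPolygonalLinkingNumber N (inscribedPolygon (embeddedLoop f hf hm0 (hPm c) hc) N)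
            (inscribedPolygon (embeddedLoop f hf hm0 (hPm d) hd) N) k := by
    by_cases h : (∀ i, P c i ≠ P c (i + 1)) ∧ (∀ i, P d i ≠ P d (i + 1)) ∧ ∀ i j, c i ≠ d j
    · obtain ⟨k, hk⟩ := exists_linkingNumber (disjoint_range_embeddedLoop hf hinj hm0 (hPm c) (hPm d)
        h.1 h.2.1 fun i j => h.2.2 _ _)
      exact ⟨k, fun _ _ _ => hk⟩
    · exact ⟨0, fun hc hd hcd => absurd ⟨hc, hd, hcd⟩ h⟩
  choose k hk using lk
  -- There are finitely many pairs of sequences `c`, `d`, so one bound on `N` works for all;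
  -- likewise for the perturbation in `near`.
  have all : ∀ᶠ N : ℕ in atTop, ∀ (c d : Fin m → Fin r) (hc : ∀ i, P c i ≠ P c (i + 1))
      (hd : ∀ i, P d i ≠ P d (i + 1)), (∀ i j, c i ≠ d j) →
        PolygonsDisjoint N (inscribedPolygon (embeddedLoop f hf hm0 (hPm c) hc) N)
            (inscribedPolygon (embeddedLoop f hf hm0 (hPm d) hd) N) ∧
          HasPolygonalLinkingNumber N (inscribedPolygon (embeddedLoop f hf hm0 (hPm c) hc) N)
            (inscribedPolygon (embeddedLoop f hf hm0 (hPm d) hd) N) (k c d) := by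
    simp only [eventually_all]
    exact hk
  obtain ⟨N₀, hN₀⟩ := eventually_atTop.1 all
  obtain ⟨L, hL, hN⟩ : ∃ L > 0, N₀ ≤ m * L :=
    ⟨N₀ + 1, Nat.succ_pos _, by nlinarith⟩
  have hN2 : 2 ≤ m * L := hm.trans (Nat.le_mul_of_pos_right m hL)
  obtain ⟨e, he⟩ := exists_injective_nat (SubdivisionIndex r L)
  have hs : Function.Injective (fun i : SubdivisionIndex r L => (e i : ℝ)) :=
    Nat.cast_injective.comp he
  set z : ℝ → SubdivisionIndex r L → Space := fun t i =>
    subdivisionMap L f i + t • momentPoint (e i) with hz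
  have z0 (i : SubdivisionIndex r L) : z 0 i = subdivisionMap L f i := by simp [hz]
  have cont (c : Fin m → Fin r) (i : ℕ) : ContinuousAt (fun t => z t (cycleIndex L (P c) i)) 0 := by
    simp only [hz]; fun_prop
  have closed (c : Fin m → Fin r) (t : ℝ) : z t (cycleIndex L (P c) (m * L)) =
      z t (cycleIndex L (P c) 0) := by
    rw [cycleIndex_closed hL (hPm c)]
  have near : ∀ᶠ t in 𝓝 (0 : ℝ), ∀ (c d : Fin m → Fin r), (∀ i, P c i ≠ P c (i + 1)) →
      (∀ i, P d i ≠ P d (i + 1)) → (∀ i j, c i ≠ d j) →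
      HasPolygonalLinkingNumber (m * L) (fun i => z t (cycleIndex L (P c) i))
        (fun i => z t (cycleIndex L (P d) i)) (k c d) := by
    simp only [eventually_all]
    intro c d hc hd hcd
    obtain ⟨h1, h2⟩ := hN₀ _ hN c d hc hd hcd
    have hcz : ∀ i ≤ m * L, inscribedPolygon (embeddedLoop f hf hm0 (hPm c) hc) (m * L) i =
        z 0 (cycleIndex L (P c) i) := fun i hi => by
      rw [z0, inscribedPolygon_embeddedLoop hf hm0 _ _ hL hi]
    have hdz : ∀ i ≤ m * L, inscribedPolygon (embeddedLoop f hf hm0 (hPm d) hd) (m * L) i =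
        z 0 (cycleIndex L (P d) i) := fun i hi => by
      rw [z0, inscribedPolygon_embeddedLoop hf hm0 _ _ hL hi]
    refine HasPolygonalLinkingNumber.eventually hN2 (cont c) (cont d) (closed c) (closed d)
      (h1.congr hcz hdz) ⟨?_, fun v hv => ?_⟩
    · obtain ⟨v, hv⟩ := h2.1
      exact ⟨v, hv.congr hcz hdz⟩
    · rw [← overcrossingCount_congr hcz hdz]
      exact h2.2 v (hv.congr (fun i hi => (hcz i hi).symm) fun i hi => (hdz i hi).symm)
  -- The initial direction may be 0, as only its perturbation `t • vertical` is used as a projection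
  -- direction.
  obtain ⟨t, ht, hgen⟩ := ((near.filter_mono nhdsWithin_le_nhds).and
    (eventually_generic 0 (subdivisionMap L f) hs)).exists
  refine ⟨L, hL, _, z t, hgen, fun c d hc hd hcd => ?_⟩
  have count : overcrossingCount (m * L) (fun i => z t (cycleIndex L (P c) i))
      (fun i => z t (cycleIndex L (P d) i)) (0 + t • vertical) = k c d :=
    (ht c d hc hd hcd).2 _ (hgen.isRegularDirection (cycleIndex_ne_succ hL hc)
      (cycleIndex_ne_succ hL hd) (cycleIndex_ne fun i j => hcd _ _))
  have sum := sum_cycleIndex hL (fun i j k l => overcrossingSign (0 + t • vertical) (z t i) (z t j)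
    (z t k) (z t l)) m m (P c) (P d)
  have hk' := (hk c d hc hd hcd).mono fun N h => h.2
  rw [← count] at hk'
  exact (show overcrossingCount (m * L) (fun i => z t (cycleIndex L (P c) i))
      (fun i => z t (cycleIndex L (P d) i)) (0 + t • vertical) = _ from sum) ▸ hk'

/-! ### Conclusion. -/

theorem HasLinkingNumber.symm {γ δ : C(UnitAddCircle, Space)} {k : ℤ}
    (h : HasLinkingNumber γ δ k) : HasLinkingNumber δ γ k :=
  Eventually.mono h fun _ h => h.symm

theorem theorem1 (n lam : ℕ) :
    ∃ r : ℕ, ∀ f : graphRealization (⊤ : SimpleGraph (Fin r)) → Space, IsEmbedding f →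
      ∃ L : OrientedLink n, L.IsContainedIn f ∧
        L.linkingPattern = ⊤ ∧
        ∀ i j : Fin n, i ≠ j →
          ∃ k : ℤ, HasLinkingNumber (L.component i) (L.component j) k ∧ (lam : ℤ) ≤ |k| := by
  -- With exponent `lam + 1` the bound 2^(lam+1) exceeds `lam` and is positive, so it gives both the
  -- weights and the nonvanishing, also for `lam = 0`.
  obtain ⟨r, hr⟩ := exists_linked_cycles n (Nat.succ_pos lam)
  refine ⟨r, fun f hf => ?_⟩
  set m := 2 ^ (lam + 1) + 2 with hm
  have hm3 : 3 ≤ m := by have := Nat.two_pow_pos (lam + 1); omega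
  have hm0 : 0 < m := by omega
  obtain ⟨s, hs, v, z, hz, hlk⟩ := exists_generic_approximation (m := m) (by omega) hm0 hf.continuous
    hf.injective
  obtain ⟨h, hinj, hle⟩ := hr s hs v z hz
  have bound (i : ℕ) (hi : i < m) (a : Fin n) : n * i + a < n * m := by
    have : n * (i + 1) ≤ n * m := Nat.mul_le_mul_left n hi
    rw [Nat.mul_succ] at this
    omega
  have eq_of_eq {a b : Fin n} {i j : ℕ} (hi : i < m) (hj : j < m)
      (e : h (n * i + a) = h (n * j + b)) : a = b ∧ i = j := by
    have e' : n * i + a = n * j + b := by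
      by_contra hne
      exact hinj _ _ (bound i hi a) (bound j hj b) hne e
    have hn : 0 < n := a.pos
    have q := congrArg (· / n) e'
    have q' := congrArg (· % n) e'
    simp only [Nat.mul_add_div hn, Nat.div_eq_of_lt a.2, Nat.div_eq_of_lt b.2, add_zero,
      Nat.mul_add_mod, Nat.mod_eq_of_lt a.2, Nat.mod_eq_of_lt b.2] at q q'
    exact ⟨Fin.ext q', q⟩
  -- The cycles occupy different residue classes modulo `n`, hence are disjoint.
  set c : Fin n → Fin m → Fin r := fun a i => h (n * i + a) with hc
  have periodic_inj (a : Fin n) (i j : ℕ)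
      (e : periodicExtension hm0 (c a) i = periodicExtension hm0 (c a) j) : i % m = j % m :=
    (eq_of_eq (Nat.mod_lt i hm0) (Nat.mod_lt j hm0) e).2
  have ne_succ (a : Fin n) (i : ℕ) :
      periodicExtension hm0 (c a) i ≠ periodicExtension hm0 (c a) (i + 1) := fun e => by
    have h2 : m ∣ 1 := by
      simpa using (Nat.modEq_iff_dvd' (Nat.le_succ i)).1 (periodic_inj a _ _ e)
    have := Nat.le_of_dvd one_pos h2
    omega
  have disj {a b : Fin n} (hab : a ≠ b) (i j : Fin m) : c a i ≠ c b j := fun e =>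
    hab (eq_of_eq i.2 j.2 e).1
  let K : OrientedLink n :=
    { component := fun a => embeddedLoop f hf.continuous hm0
        (periodicExtension_length hm0 (c a)) (ne_succ a)
      injective := fun a θ φ e => cycleLoop_injective hm3 (periodic_inj a)
        (congrArg Subtype.val (hf.injective e))
      disjoint := fun a b hab => disjoint_range_embeddedLoop hf.continuous hf.injective hm0 _ _ _ _
        fun i j => disj hab _ _ }
  have main (a b : Fin n) (hab : a ≠ b) :
      ∃ k : ℤ, HasLinkingNumber (K.component a) (K.component b) k ∧ 2 ^ (lam + 1) ≤ |k| := by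
    rcases lt_or_gt_of_ne hab with hlt | hlt
    · exact ⟨_, hlk (c a) (c b) (ne_succ a) (ne_succ b) (disj hab), hle a b hlt b.2⟩
    · exact ⟨_, (hlk (c b) (c a) (ne_succ b) (ne_succ a) (disj hab.symm)).symm, hle b a hlt a.2⟩
  refine ⟨K, fun a => ?_, ?_, fun a b hab => ?_⟩
  · rintro _ ⟨θ, rfl⟩
    exact mem_range_self _
  · ext a b
    simp only [OrientedLink.linkingPattern, SimpleGraph.fromRel_adj, SimpleGraph.top_adj]
    refine ⟨fun h => h.1, fun hab => ⟨hab, Or.inl ?_⟩⟩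
    obtain ⟨k, hk, hk'⟩ := main a b hab
    exact ⟨k, hk, fun h0 => by
      rw [h0, abs_zero] at hk'
      exact absurd hk' (not_le.2 (by positivity))⟩
  · obtain ⟨k, hk, hk'⟩ := main a b hab
    refine ⟨k, hk, le_trans ?_ hk'⟩
    have : lam < 2 ^ (lam + 1) := (Nat.lt_succ_self lam).trans Nat.lt_two_pow_self
    exact_mod_cast this.le
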